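/- All graphs are finite and simple. For an integer $d\ge 1$, a $d$-cut of a graph $G$ is a partition of $V(G)$ into two nonempty sets $A,B$ such that every vertex of $A$ has at most $d$ neighbours in $B$ and every vertex of $B$ has at most $d$ neighbours in $A$; the problem $d$-Cut asks whether $G$ has a $d$-cut. A tree decomposition of $G$ consists of a tree $T$ and bags $B_x\subseteq V(G)$ for the nodes $x$ of $T$ such that every vertex of $G$ lies in some bag, both ends of every edge of $G$ lie in a common bag, and for every vertex $v$ the nodes $x$ with $v\in B_x$ induce a connected subtree of $T$. Its width is the maximum size of a bag minus one, and the treewidth $\mathrm{tw}(G)$ is the minimum width of a tree decomposition of $G$. A tree decomposition is nice if $T$ is rooted at a node with empty bag and every node $x$ is of one of the following types: a leaf node (no children, and $|B_x|=2$); an introduce node (exactly one child $y$, and $B_x\setminus B_y=\{u\}$ for some vertex $u$); a forget node (exactly one child $y$, and $B_y\setminus B_x=\{u\}$ for some vertex $u$); a join node (exactly two children $y,z$, and $B_x=B_y=B_z$). **Theorem.** There are an algorithm (a program of a random access machine, whose running time is measured by the logarithmic cost criterion) and a polynomial $q$ with the following property. Given any integer $d\ge 1$, any graph $G$ and any nice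 tree decomposition of $G$, of width $w$, the algorithm decides whether $G$ has a $d$-cut in time at most $$q(N)\cdot 2^{w+1}(d+1)^{2w+2},$$ where $N$ is the length of the input (the integer $d$ in binary, and $G$, $T$ and the bags as adjacency and incidence matrices). In particular, for every integer $d\ge 1$, given a nice tree decomposition of $G$ of width $\mathrm{tw}(G)$, $d$-Cut can be solved in time $O^*\bigl(2^{\mathrm{tw}(G)+1}(d+1)^{2\,\mathrm{tw}(G)+2}\bigr)$, where $O^*$ suppresses factors polynomial in the input size. -/

import Mathlib

/-! ### Cuts -/

/-- `(A, B)` is a `d`-cut of `G`: a bipartition of the vertex set into two nonempty parts such that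
every vertex has at most `d` neighbours in the other part. -/
structure IsDCut {V : Type*} (G : SimpleGraph V) (d : ℕ) (A B : Set V) : Prop where
  left_nonempty : A.Nonempty
  right_nonempty : B.Nonempty
  isCompl : IsCompl A B
  left_le : ∀ v ∈ A, (G.neighborSet v ∩ B).ncard ≤ d
  right_le : ∀ v ∈ B, (G.neighborSet v ∩ A).ncard ≤ d

/-- `G` is a yes-instance of `d`-Cut. -/
def HasDCut {V : Type*} (G : SimpleGraph V) (d : ℕ) : Prop :=
  ∃ A B : Set V, IsDCut G d A B

/-! ### Tree decompositions -/

/-- A tree decomposition of `G` whose tree has node set `ι`. -/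
structure TreeDecomposition {V : Type*} (G : SimpleGraph V) (ι : Type*) where
  tree : SimpleGraph ι
  isTree : tree.IsTree
  bag : ι → Finset V
  exists_mem_bag : ∀ v, ∃ x, v ∈ bag x
  exists_edge_bag : ∀ u v, G.Adj u v → ∃ x, u ∈ bag x ∧ v ∈ bag x
  connected : ∀ v, (tree.induce {x | v ∈ bag x}).Connected

namespace TreeDecomposition

variable {V ι : Type*} {G : SimpleGraph V}

/-- The width: the maximum size of a bag, minus one. -/
def width [Fintype ι] (D : TreeDecomposition G ι) : ℕ :=
  (Finset.univ.sup fun x => (D.bag x).card) - 1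

/-- The children of the node `x` when the tree is rooted at `r`. -/
def children (D : TreeDecomposition G ι) (r x : ι) : Set ι :=
  {y | D.tree.Adj x y ∧ D.tree.dist r y = D.tree.dist r x + 1}

/-- A leaf node: no children, and a bag of size two. -/
def IsLeafNode (D : TreeDecomposition G ι) (r x : ι) : Prop :=
  D.children r x = ∅ ∧ (D.bag x).card = 2

/-- An introduce node: one child `y`, with `B_x \ B_y` a singleton. -/
def IsIntroduceNode (D : TreeDecomposition G ι) (r x : ι) : Prop :=
  ∃ y, D.children r x = {y} ∧ ∃ u, (D.bag x : Set V) \ (D.bag y : Set V) = {u}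

/-- A forget node: one child `y`, with `B_y \ B_x` a singleton. -/
def IsForgetNode (D : TreeDecomposition G ι) (r x : ι) : Prop :=
  ∃ y, D.children r x = {y} ∧ ∃ u, (D.bag y : Set V) \ (D.bag x : Set V) = {u}

/-- A join node: two children, with the same bag as both of them. -/
def IsJoinNode (D : TreeDecomposition G ι) (r x : ι) : Prop :=
  ∃ y z, y ≠ z ∧ D.children r x = {y, z} ∧ D.bag x = D.bag y ∧ D.bag x = D.bag z

/-- The tree decomposition, rooted at `r`, is nice. -/
def IsNice (D : TreeDecomposition G ι) (r : ι) : Prop :=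
  D.bag r = ∅ ∧
    ∀ x, D.IsLeafNode r x ∨ D.IsIntroduceNode r x ∨ D.IsForgetNode r x ∨ D.IsJoinNode r x

end TreeDecomposition

/-- The treewidth of a finite graph: the least width of a tree decomposition. -/
noncomputable def treewidth {V : Type*} (G : SimpleGraph V) : ℕ :=
  sInf {w | ∃ (m : ℕ) (D : TreeDecomposition G (Fin m)), D.width = w}

/-! ### Random access machines with logarithmic cost

The programs are structured (sequence, conditional, while loop) programs of a random access
machine. They use finitely many named registers and an infinite memory with indirect addressing;
registers and memory cells hold natural numbers. Running time is counted by the logarithmic cost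
criterion. -/

namespace RAM

/-- The arithmetic operations: addition, truncated subtraction, multiplication, floor division. -/
inductive Op where
  | add
  | sub
  | mul
  | div

/-- The value of an arithmetic operation (division by zero gives zero). -/
def Op.apply : Op → ℕ → ℕ → ℕ
  | .add, a, b => a + b
  | .sub, a, b => a - b
  | .mul, a, b => a * b
  | .div, a, b => a / b

/-- Expressions: literals, register contents, contents of the memory cell with the given address,
and arithmetic operations. -/
inductive Expr where
  | lit (k : ℕ)
  | reg (i : ℕ)
  | load (addr : Expr)
  | bin (o : Op) (a b : Expr)

/-- The state of the machine. -/
structure State where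
  reg : ℕ → ℕ
  mem : ℕ → ℕ

/-- The value of an expression. -/
def Expr.val (s : State) : Expr → ℕ
  | .lit k => k
  | .reg i => s.reg i
  | .load e => s.mem (e.val s)
  | .bin o a b => o.apply (a.val s) (b.val s)

/-- The logarithmic cost of evaluating an expression: every subexpression, in particular every
address and every operand, is charged one plus the binary length of its value. -/
def Expr.cost (s : State) : Expr → ℕ
  | .lit k => k.size + 1
  | .reg i => (s.reg i).size + 1
  | .load e => e.cost s + ((Expr.load e).val s).size + 1
  | .bin o a b => a.cost s + b.cost s + ((Expr.bin o a b).val s).size + 1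

/-- Programs. A test succeeds if its value is nonzero. -/
inductive Program where
  | skip
  | assign (i : ℕ) (e : Expr)
  | store (addr e : Expr)
  | seq (p q : Program)
  | cond (e : Expr) (p q : Program)
  | loop (e : Expr) (p : Program)

/-- `Runs p s s' t`: started in state `s`, the program `p` halts in state `s'` after time `t`. -/
inductive Runs : Program → State → State → ℕ → Prop
  | skip (s : State) : Runs .skip s s 1
  | assign (i : ℕ) (e : Expr) (s : State) :
      Runs (.assign i e) s { s with reg := Function.update s.reg i (e.val s) } (e.cost s + 1)
  | store (a e : Expr) (s : State) :
      Runs (.store a e) s { s with mem := Function.update s.mem (a.val s) (e.val s) }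
        (a.cost s + e.cost s + 1)
  | seq {p q : Program} {s s₁ s₂ : State} {t₁ t₂ : ℕ} :
      Runs p s s₁ t₁ → Runs q s₁ s₂ t₂ → Runs (.seq p q) s s₂ (t₁ + t₂)
  | cond_true {e : Expr} {p q : Program} {s s₁ : State} {t : ℕ} :
      e.val s ≠ 0 → Runs p s s₁ t → Runs (.cond e p q) s s₁ (e.cost s + 1 + t)
  | cond_false {e : Expr} {p q : Program} {s s₁ : State} {t : ℕ} :
      e.val s = 0 → Runs q s s₁ t → Runs (.cond e p q) s s₁ (e.cost s + 1 + t)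
  | loop_done {e : Expr} {p : Program} {s : State} :
      e.val s = 0 → Runs (.loop e p) s s (e.cost s + 1)
  | loop_step {e : Expr} {p : Program} {s s₁ s₂ : State} {t₁ t₂ : ℕ} :
      e.val s ≠ 0 → Runs p s s₁ t₁ → Runs (.loop e p) s₁ s₂ t₂ →
        Runs (.loop e p) s s₂ (e.cost s + 1 + t₁ + t₂)

/-- The state in which a program is started on the input `l`: register `0` holds the length of `l`,
the memory cells `0, 1, 2, …` hold the entries of `l`, and everything else is zero. -/
def start (l : List ℕ) : State where
  reg i := if i = 0 then l.length else 0
  mem a := l.getD a 0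

/-- The size of an input: every number is written in binary and followed by a separator. -/
def inputSize (l : List ℕ) : ℕ :=
  (l.map fun x => x.size + 1).sum

open Classical in
/-- On the input `l`, the program `p` halts within time `T`, and register `0` then holds the truth
value (`1` or `0`) of `answer`. -/
def DecidesWithin (p : Program) (l : List ℕ) (answer : Prop) (T : ℕ) : Prop :=
  ∃ (s : State) (t : ℕ), Runs p (start l) s t ∧ t ≤ T ∧ s.reg 0 = if answer then 1 else 0

end RAM

/-! ### Instances as inputs -/

open Classical in
/-- The `a × b` zero-one matrix of a relation, row by row. -/
noncomputable def encodeRel {a b : ℕ} (R : Fin a → Fin b → Prop) : List ℕ :=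
  (List.finRange a).flatMap fun i => (List.finRange b).map fun j => if R i j then 1 else 0

/-- The input consisting of `d`, a graph `G` and a rooted tree decomposition of it: the numbers
`d`, `|V(G)|`, the number of nodes and the root, followed by the adjacency matrix of `G`, the
adjacency matrix of the tree, and the incidence matrix of nodes and the vertices in their bags. -/
noncomputable def encodeInstance (d : ℕ) {n m : ℕ} (G : SimpleGraph (Fin n))
    (D : TreeDecomposition G (Fin m)) (r : Fin m) : List ℕ :=
  [d, n, m, (r : ℕ)] ++ encodeRel G.Adj ++ encodeRel D.tree.Adj ++
    encodeRel fun (x : Fin m) (v : Fin n) => v ∈ D.bag x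

/-! The tree is consumed leaf by leaf. Every node carries a table of states of its bag. A state
consists of a 0/1 colouring of the bag, for each bag vertex a number of opposite neighbours already
accounted for, and a flag telling whether a vertex of colour one has been met. While two nodes are
left, some leaf other than the root exists (`Linked.exists_leaf`). Its table is merged into that of
its only remaining neighbour and the leaf is deleted. Introduce, forget and join nodes need no
separate treatment.

Correctness rests on the invariant `Solvable`: there are a colouring of the vertices still present
and a state from each remaining table such that, at every vertex, the counts of the states plus the
opposite neighbours among the present vertices sum to at most `d`. It survives a merge of `x` into
`p` (`DecomposesOn.solvable_erase_iff`). A vertex of `B x` that also occurs in another remaining bag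
must lie in `B p`, so the edges between present vertices split into those that stay present and
those inside `B x` but not inside `B p` (`DecomposesOn.oppDeg_present`). The latter are added to the
counts at this moment, so each edge is counted once. A vertex that disappears has its final count
tested against `d`, and its colour enters the flag.

At the beginning all states with flag zero are allowed, and solvability means the existence of a
`d`-cut (`solvable_univ_iff`). One fixed vertex gets colour zero, which costs nothing because the
sides may be exchanged; flags and colours ensure that the other side is nonempty. At the end only
the root with its empty bag is left, and the answer is one table entry (`solvable_singleton_iff`).

Two merged states must agree on the common vertices, so a pair amounts to two flags, one colouring
of `B p ∪ B x` and two count functions: `4 * 2 ^ |B p ∪ B x| * (d + 1) ^ (|B p| + |B x|)` choices.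
Niceness gives `|B p ∪ B x| ≤ w + 2` (`IsNice.card_union_le`), hence at most `8 * 2 ^ (w + 1) * (d +
1) ^ (2 * w + 2)` pairs per merge. There are `m - 1` merges, and the work per pair is polynomial.

On the machine, pairs are enumerated by a mixed radix counter, and a state is a number with `n`
digits that serves as an address. All numbers have polynomial binary length, so logarithmic cost
adds only a polynomial factor. Memory is initially zero, and each merge writes a table with a fresh
version number, so no table is ever initialised. The run is followed exactly: each loop has an
explicit sequence of machine states, or an invariant, given by functions of the input. -/

/-! ### Pruning tree decompositions -/

/-- Any two elements of `W` are joined by a walk of `t` that stays in `W`. -/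
def Linked {ι : Type*} (t : SimpleGraph ι) (W : Set ι) : Prop :=
  ∀ y ∈ W, ∀ z ∈ W, Relation.ReflTransGen (fun a b => t.Adj a b ∧ b ∈ W) y z

theorem linked_of_preconnected {ι : Type*} {t : SimpleGraph ι} {W : Set ι}
    (h : (t.induce W).Preconnected) : Linked t W := by
  intro y hy z hz
  have := (SimpleGraph.reachable_iff_reflTransGen _ _).1 (h ⟨y, hy⟩ ⟨z, hz⟩)
  exact this.lift Subtype.val fun a b hab => ⟨hab, b.2⟩

theorem Linked.preconnected {ι : Type*} {t : SimpleGraph ι} {W : Set ι}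
    (h : Linked t W) : (t.induce W).Preconnected := by
  rintro ⟨y, hy⟩ ⟨z, hz⟩
  have key : ∀ z, Relation.ReflTransGen (fun a b => t.Adj a b ∧ b ∈ W) y z →
      ∃ hz : z ∈ W, (t.induce W).Reachable ⟨y, hy⟩ ⟨z, hz⟩ := by
    intro z h
    induction h with
    | refl => exact ⟨hy, SimpleGraph.Reachable.refl _⟩
    | @tail b c _ hbc ih =>
      obtain ⟨hb, hr⟩ := ih
      refine ⟨hbc.2, hr.trans (SimpleGraph.Adj.reachable ?_)⟩
      exact hbc.1
  exact (key z (h y hy z hz)).2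

/-- A walk enters `x` only from `p` and leaves it only to `p`, so visits to `x` can be cut out.
While the walk stands at `x`, the induction keeps a shortened walk ending at `p`. -/
theorem Linked.diff_singleton {ι : Type*} {t : SimpleGraph ι} {W : Set ι} (h : Linked t W)
    {x p : ι} (hx : ∀ q ∈ W, t.Adj x q → q = p) : Linked t (W \ {x}) := by
  rintro y ⟨hy, hyx⟩ z ⟨hz, hzx⟩
  have key : ∀ z, Relation.ReflTransGen (fun a b => t.Adj a b ∧ b ∈ W) y z → z ∈ W ∧
      (z ≠ x → Relation.ReflTransGen (fun a b => t.Adj a b ∧ b ∈ W \ {x}) y z) ∧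
      (z = x → Relation.ReflTransGen (fun a b => t.Adj a b ∧ b ∈ W \ {x}) y p) := by
    intro z h
    induction h with
    | refl => exact ⟨hy, fun _ => .refl, fun h => absurd h hyx⟩
    | @tail b c _ hbc ih =>
      obtain ⟨hb, ih1, ih2⟩ := ih
      refine ⟨hbc.2, fun hc => ?_, fun hc => ?_⟩
      · by_cases hbx : b = x
        · subst hbx
          rw [hx c hbc.2 hbc.1]
          exact ih2 rfl
        · exact (ih1 hbx).tail ⟨hbc.1, hbc.2, hc⟩
      · subst hc
        rw [← hx b hb hbc.1.symm]
        exact ih1 hbc.1.ne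
  exact (key z (h y hy z hz)).2.1 hzx

/-- A linked set with at least two elements contains, besides any given node, a leaf. -/
theorem Linked.exists_leaf {ι : Type*} [DecidableEq ι] {t : SimpleGraph ι} (ht : t.IsAcyclic)
    {S : Finset ι} (h : Linked t (S : Set ι)) (hS : 2 ≤ S.card) (r : ι) :
    ∃ x ∈ S, x ≠ r ∧ ∃ p ∈ S, t.Adj x p ∧ ∀ q ∈ S, t.Adj x q → q = p := by
  classical
  have hT : (t.induce (S : Set ι)).IsTree := by
    obtain ⟨a, ha⟩ : S.Nonempty := Finset.card_pos.1 (by omega)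
    have : Nonempty (S : Set ι) := ⟨⟨a, ha⟩⟩
    exact ⟨⟨h.preconnected⟩, ht.induce _⟩
  obtain ⟨a, ha, b, hb, hab⟩ := Finset.one_lt_card.1 hS
  have : Nontrivial (S : Set ι) := ⟨⟨a, ha⟩, ⟨b, hb⟩, by simpa [Subtype.ext_iff] using hab⟩
  -- Two distinct leaves are available, so at least one of them differs from `r`.
  obtain ⟨u, v, huv, hu, hv⟩ := hT.exists_ne_and_degree_eq_one
  have key : ∀ u : (S : Set ι), (t.induce (S : Set ι)).degree u = 1 →
      ∃ p ∈ S, t.Adj u p ∧ ∀ q ∈ S, t.Adj u q → q = p := by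
    intro u hu
    obtain ⟨w, hw, hw'⟩ := SimpleGraph.degree_eq_one_iff_existsUnique_adj.1 hu
    refine ⟨w, w.2, hw, fun q hq huq => ?_⟩
    exact congrArg Subtype.val (hw' ⟨q, hq⟩ huq)
  by_cases hur : (u : ι) = r
  · refine ⟨v, v.2, fun hvr => huv (Subtype.ext (hur.trans hvr.symm)), key v hv⟩
  · exact ⟨u, u.2, hur, key u hu⟩

/-- The nodes in `S` with the tree `t` and the bags `B` form a tree decomposition of the graph
induced by `G` on the union of these bags. -/
structure DecomposesOn {V ι : Type*} (G : SimpleGraph V) (t : SimpleGraph ι) (B : ι → Finset V)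
    (S : Finset ι) : Prop where
  linked : Linked t (S : Set ι)
  linked_bag : ∀ v, Linked t {x | x ∈ S ∧ v ∈ B x}
  edge : ∀ u v, G.Adj u v → (∃ x ∈ S, u ∈ B x) → (∃ x ∈ S, v ∈ B x) →
    ∃ x ∈ S, u ∈ B x ∧ v ∈ B x

theorem TreeDecomposition.decomposesOn_univ {V ι : Type*} [Fintype ι] {G : SimpleGraph V}
    (D : TreeDecomposition G ι) : DecomposesOn G D.tree D.bag Finset.univ where
  linked := by
    intro y _ z _
    have := (SimpleGraph.reachable_iff_reflTransGen _ _).1 (D.isTree.connected y z)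
    exact Relation.ReflTransGen.mono (fun a b hab => ⟨hab, by simp⟩) y z this
  linked_bag v := by simpa using linked_of_preconnected (D.connected v).preconnected
  edge u v h _ _ := by
    obtain ⟨x, hx⟩ := D.exists_edge_bag u v h
    exact ⟨x, Finset.mem_univ x, hx⟩

namespace DecomposesOn

variable {V ι : Type*} {G : SimpleGraph V} {t : SimpleGraph ι} {B : ι → Finset V} {S : Finset ι}

/-- The walk from `x` to `y` through bags containing `v` has to begin with the step to `p`. -/
theorem mem_bag_parent (h : DecomposesOn G t B S) {x p : ι} (hx : x ∈ S)
    (hxp : ∀ q ∈ S, t.Adj x q → q = p) {v : V} (hv : v ∈ B x) {y : ι} (hy : y ∈ S) (hyx : y ≠ x)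
    (hvy : v ∈ B y) : v ∈ B p := by
  have := h.linked_bag v x ⟨hx, hv⟩ y ⟨hy, hvy⟩
  rcases Relation.ReflTransGen.cases_head this with rfl | ⟨c, hc, -⟩
  · exact absurd rfl hyx
  · rw [← hxp c hc.2.1 hc.1]
    exact hc.2.2

/-- If the bag covering an edge is the deleted one, both ends still occur elsewhere, so both lie in
`B p`, which takes over. -/
theorem erase [DecidableEq ι] (h : DecomposesOn G t B S) {x p : ι} (hx : x ∈ S) (hp : p ∈ S)
    (hpx : p ≠ x) (hxp : ∀ q ∈ S, t.Adj x q → q = p) : DecomposesOn G t B (S.erase x) where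
  linked := by
    have := h.linked.diff_singleton (x := x) (p := p) fun q hq => hxp q hq
    simpa using this
  linked_bag v := by
    have := (h.linked_bag v).diff_singleton (x := x) (p := p) fun q hq => hxp q hq.1
    convert this using 1
    ext y
    simp only [Finset.mem_erase, Set.mem_ofPred_eq, Set.mem_sdiff, Set.mem_singleton_iff]
    tauto
  edge u v huv := by
    rintro ⟨y, hy, huy⟩ ⟨z, hz, hvz⟩
    rw [Finset.mem_erase] at hy hz
    obtain ⟨w, hw, huw, hvw⟩ := h.edge u v huv ⟨y, hy.2, huy⟩ ⟨z, hz.2, hvz⟩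
    by_cases hwx : w = x
    · subst hwx
      exact ⟨p, Finset.mem_erase.2 ⟨hpx, hp⟩, h.mem_bag_parent hx hxp huw hy.2 hy.1 huy,
        h.mem_bag_parent hx hxp hvw hz.2 hz.1 hvz⟩
    · exact ⟨w, Finset.mem_erase.2 ⟨hwx, hw⟩, huw, hvw⟩

end DecomposesOn

/-! ### Nice tree decompositions -/

namespace TreeDecomposition

variable {V ι : Type*} {G : SimpleGraph V}

theorem card_bag_le [Fintype ι] (D : TreeDecomposition G ι) (x : ι) :
    (D.bag x).card ≤ D.width + 1 := by
  have : (D.bag x).card ≤ Finset.univ.sup fun x => (D.bag x).card :=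
    Finset.le_sup (f := fun x => (D.bag x).card) (Finset.mem_univ x)
  unfold width
  omega

/-- An introduce or forget node need not be comparable by inclusion with its child. The bound comes
from the one-element difference: the union exceeds one of the two bags by a single vertex. -/
theorem IsNice.card_union_le_of_mem_children [Fintype ι] [DecidableEq V]
    {D : TreeDecomposition G ι} {r : ι} (h : D.IsNice r) {x y : ι} (hy : y ∈ D.children r x) :
    (D.bag x ∪ D.bag y).card ≤ D.width + 2 := by
  have hx := D.card_bag_le x
  have hy' := D.card_bag_le y
  have aux : ∀ s t : Finset V, (∃ u, (s : Set V) \ (t : Set V) = {u}) →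
      (s ∪ t).card ≤ t.card + 1 := by
    rintro s t ⟨u, hu⟩
    have : s \ t = {u} := by
      apply Finset.coe_injective
      simpa using hu
    rw [← Finset.sdiff_union_self_eq_union, this]
    exact (Finset.card_union_le _ _).trans (by simp [add_comm])
  rcases h.2 x with h1 | ⟨z, hz, h1⟩ | ⟨z, hz, h1⟩ | ⟨z, z', -, hz, h1, h2⟩
  · simp [h1.1] at hy
  · rw [hz, Set.mem_singleton_iff] at hy
    subst hy
    have := aux _ _ h1
    omega
  · rw [hz, Set.mem_singleton_iff] at hy
    subst hy
    have := aux _ _ h1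
    rw [Finset.union_comm] at this
    omega
  · rw [hz] at hy
    have : D.bag x = D.bag y := by
      rcases hy with rfl | rfl
      · exact h1
      · exact h2
    rw [← this, Finset.union_self]
    omega

theorem IsNice.card_union_le [Fintype ι] [DecidableEq V] {D : TreeDecomposition G ι} {r : ι}
    (h : D.IsNice r) {x y : ι} (hxy : D.tree.Adj x y) :
    (D.bag x ∪ D.bag y).card ≤ D.width + 2 := by
  rcases D.isTree.dist_eq_dist_add_one_of_adj r hxy with h1 | h1
  · rw [Finset.union_comm]
    exact h.card_union_le_of_mem_children ⟨hxy.symm, h1⟩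
  · exact h.card_union_le_of_mem_children ⟨hxy, h1⟩

end TreeDecomposition

/-! ### Partial solutions -/

open Classical in
/-- The function `f` on `s`, and zero elsewhere. -/
noncomputable def restr {V : Type*} (s : Finset V) (f : V → ℕ) (v : V) : ℕ :=
  if v ∈ s then f v else 0

theorem restr_of_mem {V : Type*} {s : Finset V} {f : V → ℕ} {v : V} (h : v ∈ s) :
    restr s f v = f v :=
  if_pos h

theorem restr_of_notMem {V : Type*} {s : Finset V} {f : V → ℕ} {v : V} (h : v ∉ s) :
    restr s f v = 0 :=
  if_neg h

theorem restr_le {V : Type*} (s : Finset V) (f : V → ℕ) (v : V) : restr s f v ≤ f v := by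
  unfold restr
  split_ifs <;> simp

theorem restr_congr {V : Type*} {s : Finset V} {f g : V → ℕ} (h : ∀ v ∈ s, f v = g v) :
    restr s f = restr s g := by
  funext v
  unfold restr
  split_ifs with hv
  · exact h v hv
  · rfl

section PartialSolutions

variable {V ι : Type*} [Fintype V] {G : SimpleGraph V}

open Classical in
/-- The number of neighbours `u` of `v` of another colour such that `R v u`. -/
noncomputable def oppDeg (G : SimpleGraph V) (R : V → V → Prop) (c : V → ℕ) (v : V) : ℕ :=
  ∑ u, if R v u ∧ G.Adj v u ∧ c u ≠ c v then 1 else 0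

/-- The pairs of vertices that lie in the bag `Bx` but not both in the bag `Bp`. -/
def NewPair (Bp Bx : Finset V) (v u : V) : Prop :=
  v ∈ Bx ∧ u ∈ Bx ∧ ¬(v ∈ Bp ∧ u ∈ Bp)

/-- The number of opposite neighbours of `v` counted when the bag `Bx` is merged into `Bp`. -/
noncomputable def mergedCount (G : SimpleGraph V) (Bp Bx : Finset V) (c a b : V → ℕ) (v : V) : ℕ :=
  a v + b v + oppDeg G (NewPair Bp Bx) c v

/-- The bag states of two adjacent nodes are compatible. The state of a bag consists of a flag, the
colours of the vertices of the bag, and the numbers of opposite neighbours counted so far. -/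
structure Compatible (G : SimpleGraph V) (d : ℕ) (v₀ : V) (Bp Bx : Finset V) (ep ex : ℕ)
    (c a b : V → ℕ) : Prop where
  flag_left : ep ≤ 1
  flag_right : ex ≤ 1
  color_le : ∀ v, c v ≤ 1
  color_eq : ∀ v, v ∉ Bp → v ∉ Bx → c v = 0
  left_le : ∀ v, a v ≤ d
  left_eq : ∀ v, v ∉ Bp → a v = 0
  right_le : ∀ v, b v ≤ d
  right_eq : ∀ v, v ∉ Bx → b v = 0
  color_base : c v₀ = 0
  count_le : ∀ v, mergedCount G Bp Bx c a b v ≤ d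

/-- The state `(e, c', a')` of the bag `Bp` arises by merging compatible states from the tables `Tp`
and `Tx`. -/
def Merge (G : SimpleGraph V) (d : ℕ) (v₀ : V) (Bp Bx : Finset V)
    (Tp Tx : ℕ → (V → ℕ) → (V → ℕ) → Prop) (e : ℕ) (c' a' : V → ℕ) : Prop :=
  ∃ (ep ex : ℕ) (c a b : V → ℕ), Compatible G d v₀ Bp Bx ep ex c a b ∧
    Tp ep (restr Bp c) a ∧ Tx ex (restr Bx c) b ∧ e = min 1 (ep + ex + ∑ v, c v) ∧
    c' = restr Bp c ∧ a' = restr Bp (mergedCount G Bp Bx c a b)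

/-- Possible states of the bag `B`. -/
structure ValidState (d : ℕ) (B : Finset V) (e : ℕ) (c a : V → ℕ) : Prop where
  flag_le : e ≤ 1
  color_le : ∀ v, c v ≤ 1
  color_eq : ∀ v, v ∉ B → c v = 0
  count_le : ∀ v, a v ≤ d
  count_eq : ∀ v, v ∉ B → a v = 0

/-- Both vertices occur in bags of nodes of `S`. -/
def Present (B : ι → Finset V) (S : Finset ι) (v u : V) : Prop :=
  (∃ x ∈ S, v ∈ B x) ∧ (∃ x ∈ S, u ∈ B x)

/-- The tables `T` of the nodes in `S` contain states that fit together to a solution. -/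
def Solvable (G : SimpleGraph V) (d : ℕ) (v₀ : V) (B : ι → Finset V) (S : Finset ι)
    (T : ι → ℕ → (V → ℕ) → (V → ℕ) → Prop) : Prop :=
  ∃ (c : V → ℕ) (e : ι → ℕ) (a : ι → V → ℕ),
    (∀ v, c v ≤ 1) ∧ c v₀ = 0 ∧ (∀ v, (∀ x ∈ S, v ∉ B x) → c v = 0) ∧
    (∀ x ∈ S, ValidState d (B x) (e x) (restr (B x) c) (a x) ∧
      T x (e x) (restr (B x) c) (a x)) ∧
    (∀ v, ∑ x ∈ S, a x v + oppDeg G (Present B S) c v ≤ d) ∧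
    1 ≤ ∑ x ∈ S, e x + ∑ v, c v

/-- Pruning a leaf `x` splits the pairs of adjacent vertices that are present. -/
theorem DecomposesOn.oppDeg_present [DecidableEq ι] {t : SimpleGraph ι} {B : ι → Finset V}
    {S : Finset ι} (h : DecomposesOn G t B S) {x p : ι} (hx : x ∈ S) (hp : p ∈ S) (hpx : p ≠ x)
    (hxp : ∀ q ∈ S, t.Adj x q → q = p) {c c₁ c₂ : V → ℕ}
    (h₁ : ∀ v, (∃ y ∈ S.erase x, v ∈ B y) → c₁ v = c v) (h₂ : ∀ v ∈ B x, c₂ v = c v) (v : V) :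
    oppDeg G (Present B S) c v =
      oppDeg G (Present B (S.erase x)) c₁ v + oppDeg G (NewPair (B p) (B x)) c₂ v := by
  classical
  unfold oppDeg
  rw [← Finset.sum_add_distrib]
  refine Finset.sum_congr rfl fun u _ => ?_
  by_cases huv : G.Adj v u
  swap
  · simp [huv]
  -- For adjacent vertices there is a common bag in `S`. Either it survives, or it is `B x`; in that
  -- case the pair is new unless `B p` contains both ends as well.
  have hpr : Present B S v u ↔ Present B (S.erase x) v u ∨ NewPair (B p) (B x) v u := by
    constructor
    · rintro ⟨hv, hu⟩
      obtain ⟨z, hz, hvz, huz⟩ := h.edge v u huv hv hu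
      by_cases hzx : z = x
      · subst hzx
        by_cases hb : v ∈ B p ∧ u ∈ B p
        · have := Finset.mem_erase.2 ⟨hpx, hp⟩
          exact Or.inl ⟨⟨p, this, hb.1⟩, ⟨p, this, hb.2⟩⟩
        · exact Or.inr ⟨hvz, huz, hb⟩
      · have := Finset.mem_erase.2 ⟨hzx, hz⟩
        exact Or.inl ⟨⟨z, this, hvz⟩, ⟨z, this, huz⟩⟩
    · rintro (⟨⟨y, hy, hvy⟩, ⟨z, hz, huz⟩⟩ | ⟨hv, hu, -⟩)
      · exact ⟨⟨y, Finset.mem_of_mem_erase hy, hvy⟩, ⟨z, Finset.mem_of_mem_erase hz, huz⟩⟩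
      · exact ⟨⟨x, hx, hv⟩, ⟨x, hx, hu⟩⟩
  -- Vertices of `B x` that survive, even in different bags, both lie in `B p`; hence no pair is
  -- counted twice.
  have hdisj : Present B (S.erase x) v u → ¬ NewPair (B p) (B x) v u := by
    rintro ⟨⟨y, hy, hvy⟩, ⟨z, hz, huz⟩⟩ ⟨hv, hu, hn⟩
    rw [Finset.mem_erase] at hy hz
    exact hn ⟨h.mem_bag_parent hx hxp hv hy.2 hy.1 hvy, h.mem_bag_parent hx hxp hu hz.2 hz.1 huz⟩
  by_cases hP : Present B (S.erase x) v u
  · have e1 := h₁ v hP.1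
    have e2 := h₁ u hP.2
    rw [if_neg (c := NewPair (B p) (B x) v u ∧ _) fun h => hdisj hP h.1, add_zero]
    exact if_congr (by rw [e1, e2]; tauto) rfl rfl
  · by_cases hN : NewPair (B p) (B x) v u
    · have e1 := h₂ v hN.1
      have e2 := h₂ u hN.2.1
      rw [if_neg (c := Present B (S.erase x) v u ∧ _) fun h => hP h.1, zero_add]
      exact if_congr (by rw [e1, e2]; tauto) rfl rfl
    · rw [if_neg (c := Present B (S.erase x) v u ∧ _) fun h => hP h.1,
        if_neg (c := NewPair (B p) (B x) v u ∧ _) fun h => hN h.1,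
        if_neg (c := Present B S v u ∧ _) fun h => by tauto]

/-- Bookkeeping of a merge: the terms of `x` and `p` are replaced by the single term `k`. It is
stated without subtraction so that `omega` can use it. -/
theorem sum_erase_update [DecidableEq ι] {S : Finset ι} {x p : ι} (hx : x ∈ S) (hp : p ∈ S)
    (hpx : p ≠ x) (f : ι → ℕ) (k : ℕ) :
    ∑ y ∈ S.erase x, Function.update f p k y + f p + f x = ∑ y ∈ S, f y + k := by
  have hp' := Finset.mem_erase.2 ⟨hpx, hp⟩
  rw [← Finset.sum_erase_add _ _ hx, ← Finset.sum_erase_add _ _ hp',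
    ← Finset.sum_erase_add _ _ hp', Function.update_self,
    Finset.sum_congr rfl fun y hy => Function.update_of_ne (Finset.ne_of_mem_erase hy) k f]
  ring

/-- Merging the table of a leaf `x` into the table of its neighbour `p`. -/
theorem DecomposesOn.solvable_erase_iff [DecidableEq ι] {t : SimpleGraph ι} {B : ι → Finset V}
    {S : Finset ι} (h : DecomposesOn G t B S) {x p : ι} (hx : x ∈ S) (hp : p ∈ S) (hpx : p ≠ x)
    (hxp : ∀ q ∈ S, t.Adj x q → q = p) {d : ℕ} {v₀ : V}
    {T T' : ι → ℕ → (V → ℕ) → (V → ℕ) → Prop}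
    (hT : ∀ y ∈ S, y ≠ x → y ≠ p → ∀ e ≤ 1, ∀ c a, T' y e c a ↔ T y e c a)
    (hTp : ∀ e c a, ValidState d (B p) e c a →
      (T' p e c a ↔ Merge G d v₀ (B p) (B x) (T p) (T x) e c a)) :
    Solvable G d v₀ B S T ↔ Solvable G d v₀ B (S.erase x) T' := by
  have hpe := Finset.mem_erase.2 ⟨hpx, hp⟩
  have hin : ∀ v ∈ B x, (∃ y ∈ S.erase x, v ∈ B y) → v ∈ B p := by
    rintro v hv ⟨y, hy, hvy⟩
    rw [Finset.mem_erase] at hy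
    exact h.mem_bag_parent hx hxp hv hy.2 hy.1 hvy
  constructor
  · rintro ⟨c, e, a, hc, hc0, hcz, hst, hcnt, hfl⟩
    classical
    -- The merge sees the colours on the two bags only, and the colouring of the pruned instance has
    -- to vanish on vertices that occur only in `B x`.
    set cu := restr (B p ∪ B x) c with hcu
    set c' : V → ℕ := fun v => if ∃ y ∈ S.erase x, v ∈ B y then c v else 0 with hc'
    have hcup : ∀ v ∈ B p, cu v = c v := fun v hv => restr_of_mem (Finset.mem_union_left _ hv)
    have hcux : ∀ v ∈ B x, cu v = c v := fun v hv => restr_of_mem (Finset.mem_union_right _ hv)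
    have hc'y : ∀ y ∈ S.erase x, ∀ v ∈ B y, c' v = c v := fun y hy v hv => if_pos ⟨y, hy, hv⟩
    have hopp := h.oppDeg_present hx hp hpx hxp (c := c) (c₁ := c') (c₂ := cu)
      (fun v hv => if_pos hv) hcux
    have hsum := fun v => sum_erase_update hx hp hpx (fun y => a y v)
    set na := restr (B p) (mergedCount G (B p) (B x) cu (a p) (a x)) with hna
    have hmc : ∀ v, mergedCount G (B p) (B x) cu (a p) (a x) v ≤ d := by
      intro v
      have h1 := hcnt v
      have h2 := hopp v
      have h3 := Finset.sum_erase_add S (fun y => a y v) hx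
      have h4 := Finset.sum_erase_add _ (fun y => a y v) hpe
      unfold mergedCount
      omega
    have hcomp : Compatible G d v₀ (B p) (B x) (e p) (e x) cu (a p) (a x) :=
      { flag_left := (hst p hp).1.flag_le
        flag_right := (hst x hx).1.flag_le
        color_le := fun v => (restr_le _ _ _).trans (hc v)
        color_eq := fun v h1 h2 => restr_of_notMem (by simp [h1, h2])
        left_le := (hst p hp).1.count_le
        left_eq := (hst p hp).1.count_eq
        right_le := (hst x hx).1.count_le
        right_eq := (hst x hx).1.count_eq
        color_base := Nat.le_zero.1 (hc0 ▸ restr_le _ _ _)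
        count_le := hmc }
    have hrp : restr (B p) cu = restr (B p) c := restr_congr hcup
    have hrx : restr (B x) cu = restr (B x) c := restr_congr hcux
    have hry : ∀ y ∈ S.erase x, restr (B y) c' = restr (B y) c := fun y hy => restr_congr (hc'y y hy)
    set ne := min 1 (e p + e x + ∑ v, cu v) with hne
    have hval : ValidState d (B p) ne (restr (B p) c) na :=
      { flag_le := min_le_left _ _
        color_le := (hst p hp).1.color_le
        color_eq := (hst p hp).1.color_eq
        count_le := fun v => (restr_le _ _ _).trans (hmc v)
        count_eq := fun v hv => restr_of_notMem hv }
    have hmerge : Merge G d v₀ (B p) (B x) (T p) (T x) ne (restr (B p) c) na :=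
      ⟨e p, e x, cu, a p, a x, hcomp, hrp ▸ (hst p hp).2, hrx ▸ (hst x hx).2, rfl, hrp.symm, rfl⟩
    refine ⟨c', Function.update e p ne, Function.update a p na, ?_, ?_, ?_, ?_, ?_, ?_⟩
    · intro v
      simp only [hc']
      split_ifs
      exacts [hc v, Nat.zero_le _]
    · simp only [hc']
      split_ifs
      exacts [hc0, rfl]
    · intro v hv
      exact if_neg fun ⟨y, hy, hvy⟩ => hv y hy hvy
    · intro y hy
      rw [hry y hy]
      by_cases hyp : y = p
      · subst hyp
        rw [Function.update_self, Function.update_self]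
        exact ⟨hval, (hTp _ _ _ hval).2 hmerge⟩
      · rw [Function.update_of_ne hyp, Function.update_of_ne hyp]
        have hy' := Finset.mem_erase.1 hy
        exact ⟨(hst y hy'.2).1, (hT y hy'.2 hy'.1 hyp _ (hst y hy'.2).1.flag_le _ _).2 (hst y hy'.2).2⟩
    · intro v
      have h1 := hcnt v
      have h2 := hopp v
      have h3 := hsum v (na v)
      have h4 : ∑ y ∈ S.erase x, Function.update a p na y v =
          ∑ y ∈ S.erase x, Function.update (fun y => a y v) p (na v) y := by
        refine Finset.sum_congr rfl fun y _ => ?_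
        by_cases hyp : y = p
        · subst hyp; simp
        · simp [hyp]
      rw [h4]
      have h5 : na v ≤ a p v + a x v + oppDeg G (NewPair (B p) (B x)) cu v := restr_le _ _ v
      omega
    · have h3 := sum_erase_update hx hp hpx e ne
      -- The new flag is zero only if both old flags and all colours on the two bags are zero. Then
      -- no vertex of colour one disappears and the colour sum is unchanged. Otherwise the new flag
      -- alone suffices.
      by_cases hpos : ne = 0
      · have h0 : e p + e x + ∑ v, cu v = 0 := by
          have := hne.symm.trans hpos
          omega
        have hcu0 : ∀ v, cu v = 0 := by
          have : ∑ v, cu v = 0 := by omega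
          simpa using this
        have hcc : ∀ v, c' v = c v := by
          intro v
          simp only [hc']
          split_ifs with hv
          · rfl
          · by_cases hvx : v ∈ B x
            · rw [← hcux v hvx, hcu0]
            · refine (hcz v fun y hy hvy => ?_).symm
              by_cases hyx : y = x
              · exact hvx (hyx ▸ hvy)
              · exact hv ⟨y, Finset.mem_erase.2 ⟨hyx, hy⟩, hvy⟩
        have h4 : ∑ v, c' v = ∑ v, c v := Finset.sum_congr rfl fun v _ => hcc v
        have h5 : 1 ≤ ∑ x ∈ S, e x + ∑ v, c v := hfl
        omega
      · have : Function.update e p ne p ≤ ∑ y ∈ S.erase x, Function.update e p ne y :=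
          Finset.single_le_sum (fun _ _ => Nat.zero_le _) hpe
        rw [Function.update_self] at this
        omega
  · rintro ⟨c', e', a', hc, hc0, hcz, hst, hcnt, hfl⟩
    classical
    obtain ⟨ep, ex, cu, a, b, hcomp, hTp', hTx', he, hcp, ha⟩ :=
      (hTp _ _ _ (hst p hpe).1).1 (hst p hpe).2
    -- The colourings `cu` and `c'` glue: their overlap on `B x` lies in `B p`, where the merge
    -- makes them equal.
    set c : V → ℕ := fun v => if v ∈ B x then cu v else c' v with hcdef
    have hcp' : ∀ v ∈ B p, c' v = cu v := by
      intro v hv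
      have := congrFun hcp v
      rwa [restr_of_mem hv, restr_of_mem hv] at this
    have hcx : ∀ v ∈ B x, c v = cu v := fun v hv => if_pos hv
    have hcy : ∀ v, (∃ y ∈ S.erase x, v ∈ B y) → c' v = c v := by
      intro v hv
      by_cases hvx : v ∈ B x
      · rw [hcx v hvx, hcp' v (hin v hvx hv)]
      · exact (if_neg hvx).symm
    have hopp := h.oppDeg_present hx hp hpx hxp (c := c) (c₁ := c') (c₂ := cu)
      hcy (fun v hv => (hcx v hv).symm)
    have hrx : restr (B x) c = restr (B x) cu := restr_congr hcx
    have hry : ∀ y ∈ S.erase x, restr (B y) c = restr (B y) c' :=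
      fun y hy => restr_congr fun v hv => (hcy v ⟨y, hy, hv⟩).symm
    set e : ι → ℕ := Function.update (Function.update e' p ep) x ex with hedef
    set A : ι → V → ℕ := Function.update (Function.update a' p a) x b with hAdef
    have hex : e x = ex := Function.update_self ..
    have hAx : A x = b := Function.update_self ..
    have hep : e p = ep := by rw [hedef, Function.update_of_ne hpx, Function.update_self]
    have hAp : A p = a := by rw [hAdef, Function.update_of_ne hpx, Function.update_self]
    have hey : ∀ y, y ≠ x → y ≠ p → e y = e' y := fun y h1 h2 => by
      rw [hedef, Function.update_of_ne h1, Function.update_of_ne h2]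
    have hAy : ∀ y, y ≠ x → y ≠ p → A y = a' y := fun y h1 h2 => by
      rw [hAdef, Function.update_of_ne h1, Function.update_of_ne h2]
    have hsume : ∑ y ∈ S.erase x, e' y + ep + ex = ∑ y ∈ S, e y + e' p := by
      have h1 := sum_erase_update hx hp hpx e (e' p)
      rw [hep, hex] at h1
      rw [← h1]
      congr 2
      refine Finset.sum_congr rfl fun y hy => ?_
      by_cases hyp : y = p
      · subst hyp; simp
      · rw [Function.update_of_ne hyp, hey y (Finset.ne_of_mem_erase hy) hyp]
    have hsumA : ∀ v, ∑ y ∈ S.erase x, a' y v + a v + b v = ∑ y ∈ S, A y v + a' p v := by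
      intro v
      have h1 := sum_erase_update hx hp hpx (fun y => A y v) (a' p v)
      simp only [hAp, hAx] at h1
      rw [← h1]
      congr 2
      refine Finset.sum_congr rfl fun y hy => ?_
      by_cases hyp : y = p
      · subst hyp; simp
      · rw [Function.update_of_ne hyp, hAy y (Finset.ne_of_mem_erase hy) hyp]
    refine ⟨c, e, A, ?_, ?_, ?_, ?_, ?_, ?_⟩
    · intro v
      simp only [hcdef]
      split_ifs
      exacts [hcomp.color_le v, hc v]
    · simp only [hcdef]
      split_ifs
      exacts [hcomp.color_base, hc0]
    · intro v hv
      rw [hcdef]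
      simp only [if_neg (hv x hx)]
      exact hcz v fun y hy => hv y (Finset.mem_of_mem_erase hy)
    · intro y hy
      by_cases hyx : y = x
      · subst hyx
        rw [hex, hAx, hrx]
        refine ⟨⟨hcomp.flag_right, fun v => (restr_le _ _ _).trans (hcomp.color_le v),
          fun v hv => restr_of_notMem hv, hcomp.right_le, hcomp.right_eq⟩, hTx'⟩
      have hye := Finset.mem_erase.2 ⟨hyx, hy⟩
      rw [hry y hye]
      by_cases hyp : y = p
      · subst hyp
        rw [hep, hAp, hcp]
        refine ⟨⟨hcomp.flag_left, fun v => (restr_le _ _ _).trans (hcomp.color_le v),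
          fun v hv => restr_of_notMem hv, hcomp.left_le, hcomp.left_eq⟩, hTp'⟩
      · rw [hey y hyx hyp, hAy y hyx hyp]
        exact ⟨(hst y hye).1, (hT y hy hyx hyp _ (hst y hye).1.flag_le _ _).1 (hst y hye).2⟩
    · intro v
      have h1 := hcnt v
      have h2 := hopp v
      have h3 := hsumA v
      have h4 := congrFun ha v
      -- On `B p` the merged count is split back into its summands. A vertex of `B x` outside `B p`
      -- occurs nowhere else, so its bound is the test `count_le` of the merge. At a vertex in
      -- neither bag the merge contributes nothing.
      by_cases hvp : v ∈ B p
      · rw [restr_of_mem hvp] at h4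
        unfold mergedCount at h4
        omega
      · rw [restr_of_notMem hvp] at h4
        by_cases hvx : v ∈ B x
        · have h5 := hcomp.count_le v
          have h6 : ∀ y ∈ S.erase x, v ∉ B y := fun y hy hvy => hvp (hin v hvx ⟨y, hy, hvy⟩)
          have h7 : ∑ y ∈ S.erase x, a' y v = 0 :=
            Finset.sum_eq_zero fun y hy => (hst y hy).1.count_eq v (h6 y hy)
          have h8 : oppDeg G (Present B (S.erase x)) c' v = 0 := by
            refine Finset.sum_eq_zero fun u _ => if_neg ?_
            rintro ⟨⟨⟨y, hy, hvy⟩, -⟩, -⟩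
            exact h6 y hy hvy
          unfold mergedCount at h5
          omega
        · have h5 : oppDeg G (NewPair (B p) (B x)) cu v = 0 := by
            refine Finset.sum_eq_zero fun u _ => if_neg ?_
            rintro ⟨⟨hv, -⟩, -⟩
            exact hvx hv
          have h6 := hcomp.left_eq v hvp
          have h7 := hcomp.right_eq v hvx
          omega
    -- If the glued colouring vanishes, so do `cu` and `c'`; the positive total then comes from
    -- flags, and the flag of `p` is at most the sum of the two flags it was merged from.
    · by_cases hcz' : ∑ v, c v = 0
      · have hc0' : ∀ v, c v = 0 := by simpa using hcz'
        have h1 : ∀ v, cu v = 0 := by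
          intro v
          by_cases hvx : v ∈ B x
          · rw [← hcx v hvx, hc0']
          · by_cases hvp : v ∈ B p
            · rw [← hcp' v hvp, hcy v ⟨p, hpe, hvp⟩, hc0']
            · exact hcomp.color_eq v hvp hvx
        have h2 : ∀ v, c' v = 0 := by
          intro v
          by_cases hv : ∃ y ∈ S.erase x, v ∈ B y
          · rw [hcy v hv, hc0']
          · exact hcz v fun y hy hvy => hv ⟨y, hy, hvy⟩
        have h3 : ∑ v, cu v = 0 := Finset.sum_eq_zero fun v _ => h1 v
        have h4 : ∑ v, c' v = 0 := Finset.sum_eq_zero fun v _ => h2 v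
        rw [h3] at he
        rw [h4] at hfl
        have := min_le_right 1 (ep + ex + 0)
        omega
      · omega

/-- Before any merging, the tables contain all states with flag zero. -/
theorem solvable_univ_iff [Fintype ι] (D : TreeDecomposition G ι) {d : ℕ} (v₀ : V)
    {T : ι → ℕ → (V → ℕ) → (V → ℕ) → Prop}
    (hT : ∀ x e c a, ValidState d (D.bag x) e c a → (T x e c a ↔ e = 0)) :
    Solvable G d v₀ D.bag Finset.univ T ↔ HasDCut G d := by
  classical
  have hpres : ∀ v u, Present D.bag Finset.univ v u := fun v u => by
    obtain ⟨x, hx⟩ := D.exists_mem_bag v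
    obtain ⟨y, hy⟩ := D.exists_mem_bag u
    exact ⟨⟨x, Finset.mem_univ x, hx⟩, ⟨y, Finset.mem_univ y, hy⟩⟩
  have hopp : ∀ (c : V → ℕ) (v : V), oppDeg G (Present D.bag Finset.univ) c v =
      (G.neighborSet v ∩ {u | c u ≠ c v}).ncard := by
    intro c v
    unfold oppDeg
    rw [Finset.sum_boole, Nat.cast_id, ← Set.ncard_coe_finset]
    congr 1
    ext u
    simp [hpres]
  constructor
  · rintro ⟨c, e, a, hc, hc0, -, hst, hcnt, hfl⟩
    have he : ∑ x, e x = 0 := Finset.sum_eq_zero fun x hx =>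
      (hT x _ _ _ (hst x hx).1).1 (hst x hx).2
    obtain ⟨w, hw⟩ : ∃ w, c w ≠ 0 := by
      by_contra! hcon
      have : ∑ v, c v = 0 := Finset.sum_eq_zero fun v _ => hcon v
      omega
    -- The counts in the chosen states need not be zero, but they can only strengthen the bound.
    have hcnt' : ∀ v, (G.neighborSet v ∩ {u | c u ≠ c v}).ncard ≤ d := fun v => by
      rw [← hopp]
      exact le_of_add_le_right (hcnt v)
    refine ⟨{v | c v = 0}, {v | c v ≠ 0}, ⟨⟨v₀, hc0⟩, ⟨w, hw⟩, ?_, ?_, ?_⟩⟩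
    · exact isCompl_compl
    · intro v hv
      have hv : c v = 0 := hv
      simpa [hv] using hcnt' v
    · intro v hv
      have hv : c v ≠ 0 := hv
      have hset : {u | c u = 0} = {u | c u ≠ c v} := by
        ext u
        have h1 := hc u
        have h2 := hc v
        change c u = 0 ↔ c u ≠ c v
        omega
      rw [hset]
      exact hcnt' v
  · rintro ⟨A, B, hAB⟩
    -- Exchanging the two sides puts `v₀` on the side of colour zero.
    wlog hv : v₀ ∈ A generalizing A B
    · refine this B A ⟨hAB.right_nonempty, hAB.left_nonempty, hAB.isCompl.symm, hAB.right_le,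
        hAB.left_le⟩ ?_
      rw [← hAB.isCompl.compl_eq]
      exact hv
    have hB : B = Aᶜ := hAB.isCompl.compl_eq.symm
    subst hB
    set c : V → ℕ := fun v => if v ∈ A then 0 else 1 with hcdef
    have hc : ∀ v, c v ≤ 1 := fun v => by
      simp only [hcdef]
      split_ifs <;> omega
    have hval : ∀ x, ValidState d (D.bag x) 0 (restr (D.bag x) c) (fun _ => 0) := fun x =>
      ⟨by simp, fun v => (restr_le _ _ _).trans (hc v), fun v hv => restr_of_notMem hv,
        by simp, by simp⟩
    refine ⟨c, fun _ => 0, fun _ _ => 0, hc, if_pos hv, ?_, ?_, ?_, ?_⟩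
    · intro v hv
      obtain ⟨x, hx⟩ := D.exists_mem_bag v
      exact absurd hx (hv x (Finset.mem_univ x))
    · exact fun x _ => ⟨hval x, (hT x _ _ _ (hval x)).2 rfl⟩
    · intro v
      rw [hopp]
      rw [Finset.sum_const_zero, zero_add]
      by_cases hvA : v ∈ A
      · convert hAB.left_le v hvA using 4
        ext u
        by_cases hu : u ∈ A <;> simp [hcdef, hvA, hu]
      · convert hAB.right_le v hvA using 4
        ext u
        by_cases hu : u ∈ A <;> simp [hcdef, hvA, hu]
    · obtain ⟨w, hw⟩ := hAB.right_nonempty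
      have : c w ≤ ∑ v, c v := Finset.single_le_sum (fun _ _ => Nat.zero_le _) (Finset.mem_univ w)
      have hw1 : c w = 1 := if_neg hw
      omega

/-- After all merging, only the root with its empty bag is left. -/
theorem solvable_singleton_iff {B : ι → Finset V} {d : ℕ} (v₀ : V) {r : ι} (hr : B r = ∅)
    {T : ι → ℕ → (V → ℕ) → (V → ℕ) → Prop} :
    Solvable G d v₀ B {r} T ↔ T r 1 (fun _ => 0) (fun _ => 0) := by
  have hre : ∀ c : V → ℕ, restr (B r) c = fun _ => 0 := fun c => by
    funext v
    exact restr_of_notMem (by simp [hr])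
  constructor
  · rintro ⟨c, e, a, hc, hc0, hcz, hst, hcnt, hfl⟩
    have h1 := hst r (Finset.mem_singleton_self r)
    have h2 : ∑ v, c v = 0 := Finset.sum_eq_zero fun v _ => hcz v (by simp [hr])
    have h3 : a r = fun _ => 0 := funext fun v => h1.1.count_eq v (by simp [hr])
    have h4 := h1.1.flag_le
    rw [h2, Finset.sum_singleton] at hfl
    have h5 : e r = 1 := by omega
    have := h1.2
    rwa [h5, h3, hre] at this
  · intro h
    refine ⟨fun _ => 0, fun _ => 1, fun _ _ => 0, by simp, rfl, by simp, ?_, ?_, by simp⟩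
    · intro x hx
      rw [Finset.mem_singleton] at hx
      subst hx
      rw [hre]
      exact ⟨⟨le_rfl, by simp, by simp, by simp, by simp⟩, h⟩
    · intro v
      simp [oppDeg]

end PartialSolutions

/-! ### Mixed radix and positional notation -/

/-- Surjectivity of the pair counter. The part `q` above all digits absorbs the last digit as `δ n +
ρ n * q` in the induction, which is why `Q` and `q` must vary. -/
theorem exists_mixed_radix (ρ δ : ℕ → ℕ) (n Q q : ℕ) (hδ : ∀ v < n, δ v < ρ v) (hq : q < Q) :
    ∃ K < (∏ v ∈ Finset.range n, ρ v) * Q,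
      (∀ v < n, K / (∏ w ∈ Finset.range v, ρ w) % ρ v = δ v) ∧
        K / (∏ w ∈ Finset.range n, ρ w) = q := by
  induction n generalizing Q q with
  | zero => exact ⟨q, by simpa using hq, by simp, by simp⟩
  | succ n ih =>
    have hn := hδ n n.lt_succ_self
    have hlt : δ n + ρ n * q < ρ n * Q := by
      have : ρ n * (q + 1) ≤ ρ n * Q := Nat.mul_le_mul_left _ hq
      rw [Nat.mul_add] at this
      omega
    obtain ⟨K, hK, hd, hk⟩ := ih (ρ n * Q) (δ n + ρ n * q) (fun v hv => hδ v (by omega)) hlt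
    refine ⟨K, by rwa [Finset.prod_range_succ, mul_assoc], fun v hv => ?_, ?_⟩
    · rcases Nat.lt_succ_iff_lt_or_eq.1 hv with h | rfl
      · exact hd v h
      · rw [hk, Nat.add_mul_mod_self_left, Nat.mod_eq_of_lt hn]
    · rw [Finset.prod_range_succ, ← Nat.div_div_eq_div_mul, hk,
        Nat.add_mul_div_left _ _ (by omega), Nat.div_eq_of_lt hn, zero_add]

/-- The digit of one vertex in the pair counter is itself composed of three: its colour, its count
at `p` and its count at `x`. -/
theorem mixed_radix_three {K r s t x y z : ℕ} (hx : x < r) (hy : y < s) (hz : z < t)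
    (h : K % (r * s * t) = x + r * (y + s * z)) :
    K % r = x ∧ K / r % s = y ∧ K / r / s % t = z := by
  have hK : K = x + r * (y + s * (z + t * (K / (r * s * t)))) := by
    conv_lhs => rw [← Nat.mod_add_div K (r * s * t), h]
    ring
  generalize K / (r * s * t) = w at hK
  have h1 : K / r = y + s * (z + t * w) := by
    rw [hK, Nat.add_mul_div_left _ _ (by omega), Nat.div_eq_of_lt hx, zero_add]
  have h2 : K / r / s = z + t * w := by
    rw [h1, Nat.add_mul_div_left _ _ (by omega), Nat.div_eq_of_lt hy, zero_add]
  refine ⟨?_, ?_, ?_⟩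
  · rw [hK, Nat.add_mul_mod_self_left, Nat.mod_eq_of_lt hx]
  · rw [h1, Nat.add_mul_mod_self_left, Nat.mod_eq_of_lt hy]
  · rw [h2, Nat.add_mul_mod_self_left, Nat.mod_eq_of_lt hz]

/-- The number with the digits `f 0, …, f (n - 1)` in base `M`. -/
def horner (M : ℕ) (f : ℕ → ℕ) : ℕ → ℕ
  | 0 => 0
  | n + 1 => horner M f n * M + f n

theorem horner_lt {M : ℕ} {f : ℕ → ℕ} {n : ℕ} (hf : ∀ v < n, f v < M) : horner M f n < M ^ n := by
  induction n with
  | zero => simp [horner]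
  | succ n ih =>
    have h1 := ih fun v hv => hf v (by omega)
    have h2 := hf n n.lt_succ_self
    have h3 : (horner M f n + 1) * M ≤ M ^ n * M := Nat.mul_le_mul_right _ h1
    rw [horner, pow_succ]
    rw [Nat.add_mul] at h3
    omega

theorem horner_congr {M : ℕ} {f g : ℕ → ℕ} {n : ℕ} (h : ∀ v < n, f v = g v) :
    horner M f n = horner M g n := by
  induction n with
  | zero => rfl
  | succ n ih => rw [horner, horner, ih fun v hv => h v (by omega), h n n.lt_succ_self]

/-- The last digit is the remainder modulo `M`, and cancelling it leaves the shorter number. This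
makes codes usable as addresses of states. -/
theorem horner_injective {M : ℕ} {f g : ℕ → ℕ} {n : ℕ} (hf : ∀ v < n, f v < M)
    (hg : ∀ v < n, g v < M) (h : horner M f n = horner M g n) : ∀ v < n, f v = g v := by
  induction n with
  | zero => intro v hv; omega
  | succ n ih =>
    have h1 := hf n n.lt_succ_self
    have h2 := hg n n.lt_succ_self
    rw [horner, horner] at h
    have e1 : (horner M f n * M + f n) % M = f n := by
      rw [Nat.mul_add_mod', Nat.mod_eq_of_lt h1]
    have e2 : (horner M g n * M + g n) % M = g n := by
      rw [Nat.mul_add_mod', Nat.mod_eq_of_lt h2]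
    have e3 : f n = g n := by rw [← e1, ← e2, h]
    have e4 : horner M f n = horner M g n := by
      rw [e3] at h
      exact Nat.eq_of_mul_eq_mul_right (by omega) (Nat.add_right_cancel h)
    intro v hv
    rcases Nat.lt_succ_iff_lt_or_eq.1 hv with h | rfl
    · exact ih (fun v hv => hf v (by omega)) (fun v hv => hg v (by omega)) e4 v h
    · exact e3

theorem horner_zero_fun (M n : ℕ) : horner M (fun _ => 0) n = 0 := by
  induction n with
  | zero => rfl
  | succ n ih => rw [horner, ih]; simp

/-! ### Running times of random access machine programs -/

namespace RAM

/-- The program `p` takes the state `s` to the state `s'` within time `T`. -/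
def RunsIn (p : Program) (s s' : State) (T : ℕ) : Prop :=
  ∃ t ≤ T, Runs p s s' t

theorem RunsIn.mono {p : Program} {s s' : State} {T T' : ℕ} (h : RunsIn p s s' T) (hT : T ≤ T') :
    RunsIn p s s' T' :=
  let ⟨t, ht, hr⟩ := h
  ⟨t, ht.trans hT, hr⟩

theorem RunsIn.seq {p q : Program} {s s₁ s₂ : State} {T₁ T₂ : ℕ} (hp : RunsIn p s s₁ T₁)
    (hq : RunsIn q s₁ s₂ T₂) : RunsIn (.seq p q) s s₂ (T₁ + T₂) :=
  let ⟨t₁, ht₁, h₁⟩ := hp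
  let ⟨t₂, ht₂, h₂⟩ := hq
  ⟨t₁ + t₂, add_le_add ht₁ ht₂, h₁.seq h₂⟩

/-- A loop whose test succeeds exactly `N` times, with the invariant `Inv`. -/
theorem runsIn_loop_of_invariant {e : Expr} {p : Program} (Inv : ℕ → State → Prop) {N C T : ℕ}
    (step : ∀ j < N, ∀ s, Inv j s →
      e.val s ≠ 0 ∧ e.cost s + 1 ≤ C ∧ ∃ s', RunsIn p s s' T ∧ Inv (j + 1) s')
    (done : ∀ s, Inv N s → e.val s = 0 ∧ e.cost s + 1 ≤ C) {s : State} (init : Inv 0 s) :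
    ∃ s', RunsIn (.loop e p) s s' (N * (C + T) + C) ∧ Inv N s' := by
  have key : ∀ k j, j + k = N → ∀ s, Inv j s →
      ∃ s', RunsIn (.loop e p) s s' (k * (C + T) + C) ∧ Inv N s' := by
    intro k
    induction k with
    | zero =>
      intro j hj s hs
      obtain rfl : j = N := by omega
      obtain ⟨h1, h2⟩ := done s hs
      exact ⟨s, ⟨_, by omega, Runs.loop_done h1⟩, hs⟩
    | succ k ih =>
      intro j hj s hs
      obtain ⟨h1, h2, s₁, ⟨t₁, ht₁, hr₁⟩, hs₁⟩ := step j (by omega) s hs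
      obtain ⟨s₂, ⟨t₂, ht₂, hr₂⟩, hs₂⟩ := ih (j + 1) (by omega) s₁ hs₁
      refine ⟨s₂, ⟨_, ?_, Runs.loop_step h1 hr₁ hr₂⟩, hs₂⟩
      rw [Nat.succ_mul]
      omega
  exact key N 0 (by omega) s init

/-- The case in which the state before each pass is known exactly, so that the invariant is an
equation and nested loops compose by rewriting. -/
theorem runsIn_loop {e : Expr} {p : Program} (F : ℕ → State) {N C T : ℕ}
    (step : ∀ j < N, e.val (F j) ≠ 0 ∧ e.cost (F j) + 1 ≤ C ∧ RunsIn p (F j) (F (j + 1)) T)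
    (done : e.val (F N) = 0 ∧ e.cost (F N) + 1 ≤ C) :
    RunsIn (.loop e p) (F 0) (F N) (N * (C + T) + C) := by
  obtain ⟨s', h, rfl⟩ := runsIn_loop_of_invariant (e := e) (p := p) (fun j s => s = F j)
    (N := N) (C := C) (T := T)
    (fun j hj s hs => by
      subst hs
      exact ⟨(step j hj).1, (step j hj).2.1, _, (step j hj).2.2, rfl⟩)
    (fun s hs => by subst hs; exact done) rfl
  exact h

/-- The size of an expression. -/
def Expr.weight : Expr → ℕ
  | .lit k => k + 1
  | .reg _ => 1
  | .load e => e.weight + 1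
  | .bin _ a b => a.weight + b.weight + 1

/-- All registers and memory cells hold numbers of binary length at most `Λ`. -/
def State.Bounded (Λ : ℕ) (s : State) : Prop :=
  (∀ i, (s.reg i).size ≤ Λ) ∧ ∀ a, (s.mem a).size ≤ Λ

theorem size_add_le (a b : ℕ) : (a + b).size ≤ a.size + b.size + 1 := by
  rw [Nat.size_le]
  have ha := Nat.lt_size_self a
  have hb := Nat.lt_size_self b
  have h1 : 2 ^ a.size ≤ 2 ^ (a.size + b.size) := Nat.pow_le_pow_right (by omega) (by omega)
  have h2 : 2 ^ b.size ≤ 2 ^ (a.size + b.size) := Nat.pow_le_pow_right (by omega) (by omega)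
  rw [pow_succ]
  omega

theorem size_mul_le (a b : ℕ) : (a * b).size ≤ a.size + b.size := by
  rw [Nat.size_le, pow_add]
  exact Nat.mul_lt_mul'' (Nat.lt_size_self a) (Nat.lt_size_self b)

theorem size_le_self (k : ℕ) : k.size ≤ k :=
  Nat.size_le.2 Nat.lt_two_pow_self

theorem Op.size_apply_le (o : Op) (a b : ℕ) : (o.apply a b).size ≤ a.size + b.size + 1 := by
  cases o with
  | add => exact size_add_le a b
  | sub => exact (Nat.size_le_size (Nat.sub_le a b)).trans (by omega)
  | mul => exact (size_mul_le a b).trans (by omega)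
  | div => exact (Nat.size_le_size (Nat.div_le_self a b)).trans (by omega)

/-- An operation yields at most the sum of the lengths of its operands plus one, and a load yields a
stored number; so lengths grow linearly with the size of the expression. -/
theorem Expr.size_val_le {Λ : ℕ} {s : State} (hs : s.Bounded Λ) (e : Expr) :
    (e.val s).size ≤ e.weight * (Λ + 1) := by
  induction e with
  | lit k =>
    have h := size_le_self k
    have : (k + 1) * 1 ≤ (k + 1) * (Λ + 1) := Nat.mul_le_mul_left _ (by omega)
    simp only [Expr.val, Expr.weight]
    omega
  | reg i =>
    have := hs.1 i
    simp only [Expr.val, Expr.weight]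
    omega
  | load e _ =>
    have h := hs.2 (e.val s)
    have : 1 * (Λ + 1) ≤ (e.weight + 1) * (Λ + 1) := Nat.mul_le_mul_right _ (by omega)
    simp only [Expr.val, Expr.weight]
    omega
  | bin o a b iha ihb =>
    have := o.size_apply_le (a.val s) (b.val s)
    simp only [Expr.val, Expr.weight]
    rw [Nat.add_mul, Nat.add_mul]
    omega

/-- The induction runs over subexpressions while `W` keeps bounding them all; each of them is
charged at most the length bound `W * (Λ + 1)` plus one. -/
theorem Expr.cost_le {Λ W : ℕ} {s : State} (hs : s.Bounded Λ) (e : Expr) (he : e.weight ≤ W) :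
    e.cost s ≤ e.weight * (W * (Λ + 1) + 1) := by
  induction e with
  | lit k =>
    have h := size_le_self k
    have : (k + 1) * 1 ≤ (k + 1) * (W * (Λ + 1) + 1) := Nat.mul_le_mul_left _ (by omega)
    simp only [Expr.cost, Expr.weight]
    omega
  | reg i =>
    have h := hs.1 i
    have : 1 * (Λ + 1) ≤ W * (Λ + 1) := Nat.mul_le_mul_right _ he
    simp only [Expr.cost, Expr.weight]
    omega
  | load e ih =>
    have h1 := (Expr.load e).size_val_le hs
    have h2 : (Expr.load e).weight * (Λ + 1) ≤ W * (Λ + 1) := Nat.mul_le_mul_right _ he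
    simp only [Expr.weight] at he
    have h3 := ih (by omega)
    simp only [Expr.cost, Expr.weight]
    rw [Nat.add_mul]
    omega
  | bin o a b iha ihb =>
    have h1 := (Expr.bin o a b).size_val_le hs
    have h2 : (Expr.bin o a b).weight * (Λ + 1) ≤ W * (Λ + 1) := Nat.mul_le_mul_right _ he
    simp only [Expr.weight] at he
    have h3 := iha (by omega)
    have h4 := ihb (by omega)
    simp only [Expr.cost, Expr.weight]
    rw [Nat.add_mul, Nat.add_mul]
    omega

/-- A bound for the time of a single step in a state bounded by `Λ`. -/
def stepTime (Λ : ℕ) : ℕ :=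
  -- The factor two pays for a store, which evaluates two expressions. The number 3000 exceeds the
  -- weight of every expression in the program, which `decide` checks at each use.
  2 * (3000 * (3000 * (Λ + 1) + 1)) + 1

theorem Expr.cost_le_stepTime {Λ : ℕ} {s : State} (hs : s.Bounded Λ) {e : Expr}
    (he : e.weight ≤ 3000) : e.cost s + 1 ≤ stepTime Λ := by
  have h1 := e.cost_le hs he
  have h2 := Nat.mul_le_mul_right (3000 * (Λ + 1) + 1) he
  unfold stepTime
  omega

theorem runsIn_assign {Λ : ℕ} {s s' : State} {i : ℕ} {e : Expr} (hs : s.Bounded Λ)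
    (he : e.weight ≤ 3000) (h : { s with reg := Function.update s.reg i (e.val s) } = s') :
    RunsIn (.assign i e) s s' (stepTime Λ) := by
  subst h
  exact ⟨_, e.cost_le_stepTime hs he, Runs.assign i e s⟩

theorem runsIn_store {Λ : ℕ} {s s' : State} {a e : Expr} (hs : s.Bounded Λ)
    (ha : a.weight ≤ 3000) (he : e.weight ≤ 3000)
    (h : { s with mem := Function.update s.mem (a.val s) (e.val s) } = s') :
    RunsIn (.store a e) s s' (stepTime Λ) := by
  subst h
  refine ⟨_, ?_, Runs.store a e s⟩
  have h1 := a.cost_le hs ha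
  have h2 := e.cost_le hs he
  have h3 := Nat.mul_le_mul_right (3000 * (Λ + 1) + 1) ha
  have h4 := Nat.mul_le_mul_right (3000 * (Λ + 1) + 1) he
  unfold stepTime
  omega

theorem runsIn_cond {Λ T : ℕ} {s s' : State} {e : Expr} {p q : Program} (hs : s.Bounded Λ)
    (he : e.weight ≤ 3000) (hp : e.val s ≠ 0 → RunsIn p s s' T) (hq : e.val s = 0 → RunsIn q s s' T) :
    RunsIn (.cond e p q) s s' (stepTime Λ + T) := by
  have h := e.cost_le_stepTime hs he
  by_cases hv : e.val s = 0
  · obtain ⟨t, ht, hr⟩ := hq hv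
    exact ⟨_, by omega, Runs.cond_false hv hr⟩
  · obtain ⟨t, ht, hr⟩ := hp hv
    exact ⟨_, by omega, Runs.cond_true hv hr⟩

instance : Add Expr := ⟨.bin .add⟩
instance : Sub Expr := ⟨.bin .sub⟩
instance : Mul Expr := ⟨.bin .mul⟩
instance : Div Expr := ⟨.bin .div⟩
instance (k : ℕ) : OfNat Expr k := ⟨.lit k⟩

namespace Expr

variable (s : State)

@[simp] theorem val_zero : (0 : Expr).val s = 0 := rfl
@[simp] theorem val_one : (1 : Expr).val s = 1 := rfl
@[simp] theorem val_two : (2 : Expr).val s = 2 := rfl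
@[simp] theorem val_three : (3 : Expr).val s = 3 := rfl
@[simp] theorem val_four : (4 : Expr).val s = 4 := rfl
@[simp] theorem val_add (a b : Expr) : (a + b).val s = a.val s + b.val s := rfl
@[simp] theorem val_sub (a b : Expr) : (a - b).val s = a.val s - b.val s := rfl
@[simp] theorem val_mul (a b : Expr) : (a * b).val s = a.val s * b.val s := rfl
@[simp] theorem val_div (a b : Expr) : (a / b).val s = a.val s / b.val s := rfl
@[simp] theorem val_load (a : Expr) : (Expr.load a).val s = s.mem (a.val s) := rfl

/-- The remainder of a division. -/
def mod (a b : Expr) : Expr := a - a / b * b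

@[simp] theorem val_mod (a b : Expr) : (mod a b).val s = a.val s % b.val s := by
  simp only [mod, val_sub, val_mul, val_div]
  have := Nat.div_add_mod' (a.val s) (b.val s)
  omega

end Expr

end RAM

/-! ### The machine state -/

namespace DCutProgram

open RAM

/-- The registers and memory arrays used by the program. -/
structure Mach where
  /-- number of merged nodes -/
  i : ℕ
  /-- candidate leaf -/
  x : ℕ
  /-- candidate neighbour -/
  y : ℕ
  /-- number of remaining neighbours of `x` -/
  cnt : ℕ
  /-- sum of the remaining neighbours of `x` -/
  nbr : ℕ
  /-- leaf to be merged -/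
  leaf : ℕ
  /-- its neighbour -/
  par : ℕ
  /-- current vertex -/
  v : ℕ
  /-- number of pairs of states -/
  total : ℕ
  /-- index of the current pair -/
  K : ℕ
  /-- undecoded part of `K` -/
  k : ℕ
  /-- current second vertex -/
  u : ℕ
  /-- number of opposite neighbours -/
  opp : ℕ
  /-- undecoded part of `K` in the inner loop -/
  kk : ℕ
  /-- code of the state of `par` -/
  cp : ℕ
  /-- code of the state of `leaf` -/
  cx : ℕ
  /-- code of the merged state -/
  cn : ℕ
  /-- compatibility of the pair -/
  ok : ℕ
  /-- number of vertices of colour one -/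
  col : ℕ
  /-- marks of the merged nodes -/
  dead : ℕ → ℕ
  /-- versions of the tables of the nodes -/
  ver : ℕ → ℕ
  /-- tables -/
  tab : ℕ → ℕ

/-- The contents of the registers, register `0` holding the length of the input. -/
def Mach.reg (L : ℕ) (h : Mach) : ℕ → ℕ
  | 0 => L
  | 1 => h.i
  | 2 => h.x
  | 3 => h.y
  | 4 => h.cnt
  | 5 => h.nbr
  | 6 => h.leaf
  | 7 => h.par
  | 8 => h.v
  | 9 => h.total
  | 10 => h.K
  | 11 => h.k
  | 12 => h.u
  | 13 => h.opp
  | 14 => h.kk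
  | 15 => h.cp
  | 16 => h.cx
  | 17 => h.cn
  | 18 => h.ok
  | 19 => h.col
  | _ => 0

/-- The contents of the memory: the input is followed by three interleaved arrays. -/
def Mach.mem (I : List ℕ) (h : Mach) (a : ℕ) : ℕ :=
  if a < I.length then I.getD a 0
  else if (a - I.length) % 3 = 0 then h.dead ((a - I.length) / 3)
  else if (a - I.length) % 3 = 1 then h.ver ((a - I.length) / 3)
  else h.tab ((a - I.length) / 3)

/-- The state of the machine on the input `I`. -/
def Mach.toState (I : List ℕ) (h : Mach) : State where
  reg := h.reg I.length
  mem := h.mem I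

/-- All numbers in the state are at most `X`. -/
structure Mach.Bdd (I : List ℕ) (X : ℕ) (h : Mach) : Prop where
  length_le : I.length ≤ X
  input_le : ∀ a, I.getD a 0 ≤ X
  i : h.i ≤ X
  x : h.x ≤ X
  y : h.y ≤ X
  cnt : h.cnt ≤ X
  nbr : h.nbr ≤ X
  leaf : h.leaf ≤ X
  par : h.par ≤ X
  v : h.v ≤ X
  total : h.total ≤ X
  K : h.K ≤ X
  k : h.k ≤ X
  u : h.u ≤ X
  opp : h.opp ≤ X
  kk : h.kk ≤ X
  cp : h.cp ≤ X
  cx : h.cx ≤ X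
  cn : h.cn ≤ X
  ok : h.ok ≤ X
  col : h.col ≤ X
  dead : ∀ a, h.dead a ≤ X
  ver : ∀ a, h.ver a ≤ X
  tab : ∀ a, h.tab a ≤ X

theorem Mach.Bdd.bounded {I : List ℕ} {X : ℕ} {h : Mach} (hB : h.Bdd I X) :
    (h.toState I).Bounded X.size := by
  constructor
  · intro j
    apply Nat.size_le_size
    change h.reg I.length j ≤ X
    unfold Mach.reg
    split
    exacts [hB.length_le, hB.i, hB.x, hB.y, hB.cnt, hB.nbr, hB.leaf, hB.par, hB.v,
      hB.total, hB.K, hB.k, hB.u, hB.opp, hB.kk, hB.cp, hB.cx, hB.cn, hB.ok, hB.col, Nat.zero_le _]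
  · intro a
    apply Nat.size_le_size
    change h.mem I a ≤ X
    unfold Mach.mem
    split_ifs
    exacts [hB.input_le _, hB.dead _, hB.ver _, hB.tab _]

/-- Identifies an update of one register with an update of one field of `Mach`; each assignment
lemma below is an instance. -/
theorem Mach.toState_eq {I : List ℕ} {h h' : Mach} {j w : ℕ}
    (hm : h.dead = h'.dead ∧ h.ver = h'.ver ∧ h.tab = h'.tab)
    (hr : h'.reg I.length j = w) (hr' : ∀ l, l ≠ j → h'.reg I.length l = h.reg I.length l) :
    ({ h.toState I with reg := Function.update (h.toState I).reg j w } : State) =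
      h'.toState I := by
  obtain ⟨h1, h2, h3⟩ := hm
  have e1 : Function.update (h.reg I.length) j w = h'.reg I.length := by
    funext l
    by_cases hl : l = j
    · subst hl
      rw [Function.update_self, hr]
    · rw [Function.update_of_ne hl, hr' l hl]
  have e2 : h.mem I = h'.mem I := by
    funext a
    simp only [Mach.mem, h1, h2, h3]
  exact congrArg₂ State.mk e1 e2

/-! ### Assignments to the individual registers -/

section Assign

variable {I : List ℕ} {X : ℕ} {h : Mach} {e : Expr} {w : ℕ}

theorem Mach.Bdd.assign_i (hB : h.Bdd I X) (hv : e.val (h.toState I) = w)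
    (he : e.weight ≤ 3000 := by decide) :
    RunsIn (.assign 1 e) (h.toState I) (Mach.toState I { h with i := w })
      (stepTime X.size) :=
  runsIn_assign hB.bounded he (hv ▸ Mach.toState_eq ⟨rfl, rfl, rfl⟩ rfl
    (by intro l hl; unfold Mach.reg; split <;> first | rfl | exact absurd rfl hl))

theorem Mach.Bdd.assign_x (hB : h.Bdd I X) (hv : e.val (h.toState I) = w)
    (he : e.weight ≤ 3000 := by decide) :
    RunsIn (.assign 2 e) (h.toState I) (Mach.toState I { h with x := w })
      (stepTime X.size) :=
  runsIn_assign hB.bounded he (hv ▸ Mach.toState_eq ⟨rfl, rfl, rfl⟩ rfl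
    (by intro l hl; unfold Mach.reg; split <;> first | rfl | exact absurd rfl hl))

theorem Mach.Bdd.assign_y (hB : h.Bdd I X) (hv : e.val (h.toState I) = w)
    (he : e.weight ≤ 3000 := by decide) :
    RunsIn (.assign 3 e) (h.toState I) (Mach.toState I { h with y := w })
      (stepTime X.size) :=
  runsIn_assign hB.bounded he (hv ▸ Mach.toState_eq ⟨rfl, rfl, rfl⟩ rfl
    (by intro l hl; unfold Mach.reg; split <;> first | rfl | exact absurd rfl hl))

theorem Mach.Bdd.assign_cnt (hB : h.Bdd I X) (hv : e.val (h.toState I) = w)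
    (he : e.weight ≤ 3000 := by decide) :
    RunsIn (.assign 4 e) (h.toState I) (Mach.toState I { h with cnt := w })
      (stepTime X.size) :=
  runsIn_assign hB.bounded he (hv ▸ Mach.toState_eq ⟨rfl, rfl, rfl⟩ rfl
    (by intro l hl; unfold Mach.reg; split <;> first | rfl | exact absurd rfl hl))

theorem Mach.Bdd.assign_nbr (hB : h.Bdd I X) (hv : e.val (h.toState I) = w)
    (he : e.weight ≤ 3000 := by decide) :
    RunsIn (.assign 5 e) (h.toState I) (Mach.toState I { h with nbr := w })
      (stepTime X.size) :=
  runsIn_assign hB.bounded he (hv ▸ Mach.toState_eq ⟨rfl, rfl, rfl⟩ rfl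
    (by intro l hl; unfold Mach.reg; split <;> first | rfl | exact absurd rfl hl))

theorem Mach.Bdd.assign_leaf (hB : h.Bdd I X) (hv : e.val (h.toState I) = w)
    (he : e.weight ≤ 3000 := by decide) :
    RunsIn (.assign 6 e) (h.toState I) (Mach.toState I { h with leaf := w })
      (stepTime X.size) :=
  runsIn_assign hB.bounded he (hv ▸ Mach.toState_eq ⟨rfl, rfl, rfl⟩ rfl
    (by intro l hl; unfold Mach.reg; split <;> first | rfl | exact absurd rfl hl))

theorem Mach.Bdd.assign_par (hB : h.Bdd I X) (hv : e.val (h.toState I) = w)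
    (he : e.weight ≤ 3000 := by decide) :
    RunsIn (.assign 7 e) (h.toState I) (Mach.toState I { h with par := w })
      (stepTime X.size) :=
  runsIn_assign hB.bounded he (hv ▸ Mach.toState_eq ⟨rfl, rfl, rfl⟩ rfl
    (by intro l hl; unfold Mach.reg; split <;> first | rfl | exact absurd rfl hl))

theorem Mach.Bdd.assign_v (hB : h.Bdd I X) (hv : e.val (h.toState I) = w)
    (he : e.weight ≤ 3000 := by decide) :
    RunsIn (.assign 8 e) (h.toState I) (Mach.toState I { h with v := w })
      (stepTime X.size) :=
  runsIn_assign hB.bounded he (hv ▸ Mach.toState_eq ⟨rfl, rfl, rfl⟩ rfl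
    (by intro l hl; unfold Mach.reg; split <;> first | rfl | exact absurd rfl hl))

theorem Mach.Bdd.assign_total (hB : h.Bdd I X) (hv : e.val (h.toState I) = w)
    (he : e.weight ≤ 3000 := by decide) :
    RunsIn (.assign 9 e) (h.toState I) (Mach.toState I { h with total := w })
      (stepTime X.size) :=
  runsIn_assign hB.bounded he (hv ▸ Mach.toState_eq ⟨rfl, rfl, rfl⟩ rfl
    (by intro l hl; unfold Mach.reg; split <;> first | rfl | exact absurd rfl hl))

theorem Mach.Bdd.assign_K (hB : h.Bdd I X) (hv : e.val (h.toState I) = w)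
    (he : e.weight ≤ 3000 := by decide) :
    RunsIn (.assign 10 e) (h.toState I) (Mach.toState I { h with K := w })
      (stepTime X.size) :=
  runsIn_assign hB.bounded he (hv ▸ Mach.toState_eq ⟨rfl, rfl, rfl⟩ rfl
    (by intro l hl; unfold Mach.reg; split <;> first | rfl | exact absurd rfl hl))

theorem Mach.Bdd.assign_k (hB : h.Bdd I X) (hv : e.val (h.toState I) = w)
    (he : e.weight ≤ 3000 := by decide) :
    RunsIn (.assign 11 e) (h.toState I) (Mach.toState I { h with k := w })
      (stepTime X.size) :=
  runsIn_assign hB.bounded he (hv ▸ Mach.toState_eq ⟨rfl, rfl, rfl⟩ rfl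
    (by intro l hl; unfold Mach.reg; split <;> first | rfl | exact absurd rfl hl))

theorem Mach.Bdd.assign_u (hB : h.Bdd I X) (hv : e.val (h.toState I) = w)
    (he : e.weight ≤ 3000 := by decide) :
    RunsIn (.assign 12 e) (h.toState I) (Mach.toState I { h with u := w })
      (stepTime X.size) :=
  runsIn_assign hB.bounded he (hv ▸ Mach.toState_eq ⟨rfl, rfl, rfl⟩ rfl
    (by intro l hl; unfold Mach.reg; split <;> first | rfl | exact absurd rfl hl))

theorem Mach.Bdd.assign_opp (hB : h.Bdd I X) (hv : e.val (h.toState I) = w)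
    (he : e.weight ≤ 3000 := by decide) :
    RunsIn (.assign 13 e) (h.toState I) (Mach.toState I { h with opp := w })
      (stepTime X.size) :=
  runsIn_assign hB.bounded he (hv ▸ Mach.toState_eq ⟨rfl, rfl, rfl⟩ rfl
    (by intro l hl; unfold Mach.reg; split <;> first | rfl | exact absurd rfl hl))

theorem Mach.Bdd.assign_kk (hB : h.Bdd I X) (hv : e.val (h.toState I) = w)
    (he : e.weight ≤ 3000 := by decide) :
    RunsIn (.assign 14 e) (h.toState I) (Mach.toState I { h with kk := w })
      (stepTime X.size) :=
  runsIn_assign hB.bounded he (hv ▸ Mach.toState_eq ⟨rfl, rfl, rfl⟩ rfl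
    (by intro l hl; unfold Mach.reg; split <;> first | rfl | exact absurd rfl hl))

theorem Mach.Bdd.assign_cp (hB : h.Bdd I X) (hv : e.val (h.toState I) = w)
    (he : e.weight ≤ 3000 := by decide) :
    RunsIn (.assign 15 e) (h.toState I) (Mach.toState I { h with cp := w })
      (stepTime X.size) :=
  runsIn_assign hB.bounded he (hv ▸ Mach.toState_eq ⟨rfl, rfl, rfl⟩ rfl
    (by intro l hl; unfold Mach.reg; split <;> first | rfl | exact absurd rfl hl))

theorem Mach.Bdd.assign_cx (hB : h.Bdd I X) (hv : e.val (h.toState I) = w)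
    (he : e.weight ≤ 3000 := by decide) :
    RunsIn (.assign 16 e) (h.toState I) (Mach.toState I { h with cx := w })
      (stepTime X.size) :=
  runsIn_assign hB.bounded he (hv ▸ Mach.toState_eq ⟨rfl, rfl, rfl⟩ rfl
    (by intro l hl; unfold Mach.reg; split <;> first | rfl | exact absurd rfl hl))

theorem Mach.Bdd.assign_cn (hB : h.Bdd I X) (hv : e.val (h.toState I) = w)
    (he : e.weight ≤ 3000 := by decide) :
    RunsIn (.assign 17 e) (h.toState I) (Mach.toState I { h with cn := w })
      (stepTime X.size) :=
  runsIn_assign hB.bounded he (hv ▸ Mach.toState_eq ⟨rfl, rfl, rfl⟩ rfl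
    (by intro l hl; unfold Mach.reg; split <;> first | rfl | exact absurd rfl hl))

theorem Mach.Bdd.assign_ok (hB : h.Bdd I X) (hv : e.val (h.toState I) = w)
    (he : e.weight ≤ 3000 := by decide) :
    RunsIn (.assign 18 e) (h.toState I) (Mach.toState I { h with ok := w })
      (stepTime X.size) :=
  runsIn_assign hB.bounded he (hv ▸ Mach.toState_eq ⟨rfl, rfl, rfl⟩ rfl
    (by intro l hl; unfold Mach.reg; split <;> first | rfl | exact absurd rfl hl))

theorem Mach.Bdd.assign_col (hB : h.Bdd I X) (hv : e.val (h.toState I) = w)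
    (he : e.weight ≤ 3000 := by decide) :
    RunsIn (.assign 19 e) (h.toState I) (Mach.toState I { h with col := w })
      (stepTime X.size) :=
  runsIn_assign hB.bounded he (hv ▸ Mach.toState_eq ⟨rfl, rfl, rfl⟩ rfl
    (by intro l hl; unfold Mach.reg; split <;> first | rfl | exact absurd rfl hl))

end Assign

end DCutProgram

namespace DCutProgram

open RAM

/-! ### Quantities computed from the input -/

section Quantities

variable (I : List ℕ)

/-- The bound `d`. -/
def inD : ℕ := I.getD 0 0
/-- The number of vertices. -/
def inN : ℕ := I.getD 1 0
/-- The number of nodes. -/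
def inM : ℕ := I.getD 2 0
/-- The root. -/
def inR : ℕ := I.getD 3 0
/-- Adjacency in the graph. -/
def inG (u v : ℕ) : ℕ := I.getD (4 + u * inN I + v) 0
/-- Adjacency in the tree. -/
def inT (x y : ℕ) : ℕ := I.getD (4 + inN I * inN I + x * inM I + y) 0
/-- Incidence of nodes and vertices. -/
def inB (x v : ℕ) : ℕ := I.getD (4 + inN I * inN I + inM I * inM I + x * inN I + v) 0

/-- The base of the codes of states. -/
def base : ℕ := 4 * (inD I + inN I + 1)

/-- The input has the expected form, and `X` is large. -/
structure Admissible (X : ℕ) : Prop where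
  length_eq : I.length = 4 + inN I * inN I + inM I * inM I + inM I * inN I
  graph_le : ∀ u < inN I, ∀ v < inN I, inG I u v ≤ 1
  tree_le : ∀ x < inM I, ∀ y < inM I, inT I x y ≤ 1
  bag_le : ∀ x < inM I, ∀ v < inN I, inB I x v ≤ 1
  input_le : ∀ a, I.getD a 0 ≤ X
  length_le : I.length ≤ X
  sq_le : inM I * inM I ≤ X
  code_le : base I ^ inN I ≤ X
  pairs_le : 4 * (2 * (inD I + 1) * (inD I + 1)) ^ inN I ≤ X

variable (p x : ℕ)

/-- The number of possible colours of the vertex `v`. -/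
def colorRadix (v : ℕ) : ℕ := 2 - (1 - inB I p v) * (1 - inB I x v)
/-- The number of possible counts of the vertex `v` at the node `p`. -/
def countRadix (v : ℕ) : ℕ := 1 + inB I p v * inD I
/-- The number of possible digits of the vertex `v`. -/
def radix (v : ℕ) : ℕ := colorRadix I p x v * countRadix I p v * countRadix I x v
/-- The weight of the digit of the vertex `v`. -/
def place (v : ℕ) : ℕ := ∏ w ∈ Finset.range v, radix I p x w

variable (K : ℕ)

/-- The colour of `v` encoded by `K`. -/
def dColor (v : ℕ) : ℕ := K / place I p x v % colorRadix I p x v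
/-- The count of `v` at the node `p` encoded by `K`. -/
def dLeft (v : ℕ) : ℕ := K / place I p x v / colorRadix I p x v % countRadix I p v
/-- The count of `v` at the node `x` encoded by `K`. -/
def dRight (v : ℕ) : ℕ :=
  K / place I p x v / colorRadix I p x v / countRadix I p v % countRadix I x v
/-- Whether `u` is a newly counted opposite neighbour of `v`. -/
def oppTerm (v u : ℕ) : ℕ :=
  inG I v u * inB I x v * inB I x u * (1 - inB I p v * inB I p u) *
    (dColor I p x K u - dColor I p x K v + (dColor I p x K v - dColor I p x K u))
/-- The number of opposite neighbours of `v` among the first `j` vertices. -/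
def oppSum (v j : ℕ) : ℕ := ∑ u ∈ Finset.range j, oppTerm I p x K v u
/-- The new count of `v`. -/
def newCount (v : ℕ) : ℕ := dLeft I p x K v + dRight I p x K v + oppSum I p x K v (inN I)
/-- The digit of `v` in the code of the state of `p`. -/
def digitLeft (v : ℕ) : ℕ := inB I p v * dColor I p x K v + 2 * dLeft I p x K v
/-- The digit of `v` in the code of the state of `x`. -/
def digitRight (v : ℕ) : ℕ := inB I x v * dColor I p x K v + 2 * dRight I p x K v
/-- The digit of `v` in the code of the merged state. -/
def digitNew (v : ℕ) : ℕ := inB I p v * (dColor I p x K v + 2 * newCount I p x K v)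
/-- Whether the conditions hold at `v`. -/
def okTerm (v : ℕ) : ℕ := (1 - (newCount I p x K v - inD I)) * (1 - dColor I p x K v * (1 - v))
/-- Whether the conditions hold at the first `j` vertices. -/
def okProd (j : ℕ) : ℕ := ∏ v ∈ Finset.range j, okTerm I p x K v
/-- The number of vertices of colour one among the first `j`. -/
def colSum (j : ℕ) : ℕ := ∑ v ∈ Finset.range j, dColor I p x K v
/-- The flag of the state of `p`. -/
def flagLeft : ℕ := K / place I p x (inN I) % 2
/-- The flag of the state of `x`. -/
def flagRight : ℕ := K / place I p x (inN I) / 2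
/-- The flag of the merged state. -/
def flagNew : ℕ := 1 - (1 - (flagLeft I p x K + flagRight I p x K + colSum I p x K (inN I)))
/-- The code of the state of `p`. -/
def codeLeft : ℕ := horner (base I) (digitLeft I p x K) (inN I)
/-- The code of the state of `x`. -/
def codeRight : ℕ := horner (base I) (digitRight I p x K) (inN I)
/-- The code of the merged state. -/
def codeNew : ℕ := horner (base I) (digitNew I p x K) (inN I)

end Quantities

section Tables

variable (I : List ℕ)

/-- The index of an entry of the table with version `t`. -/
def cell (t e c : ℕ) : ℕ := (c * (inM I + 1) + t) * 2 + e

/-- Whether the table with version `t` contains a state. -/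
def accepts (tab : ℕ → ℕ) (t e c : ℕ) : ℕ := (1 - t) * (1 - e) + tab (cell I t e c)

/-- The tables after the first pairs of states of `p` and `x` have been processed. -/
def mergeTab (p x t : ℕ) (ver tab : ℕ → ℕ) : ℕ → ℕ → ℕ
  | 0 => tab
  | K + 1 =>
    let T := mergeTab p x t ver tab K
    let a := cell I t (flagNew I p x K) (codeNew I p x K)
    -- `1 - (1 - z)` is the indicator of `z ≠ 0`, so the entry becomes the disjunction of its old
    -- value and the tests. A pair that fails leaves an entry in `{0, 1}` unchanged.
    Function.update T a (1 - (1 - (T a + okProd I p x K (inN I) *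
      accepts I T (ver p) (flagLeft I p x K) (codeLeft I p x K) *
      accepts I T (ver x) (flagRight I p x K) (codeRight I p x K))))

/-- The number of remaining neighbours of `x` among the first `j` nodes. -/
def nbrCount (dead : ℕ → ℕ) (x j : ℕ) : ℕ := ∑ y ∈ Finset.range j, inT I x y * (1 - dead y)

/-- The sum of the remaining neighbours of `x` among the first `j` nodes. -/
def nbrSum (dead : ℕ → ℕ) (x j : ℕ) : ℕ := ∑ y ∈ Finset.range j, inT I x y * (1 - dead y) * y

/-- Whether `x` is a remaining leaf other than the root. -/
def leafTest (dead : ℕ → ℕ) (x : ℕ) : ℕ :=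
  -- The sum of the two truncated differences is the distance from the root index, and `k * (2 - k)`
  -- is nonzero only for `k = 1`.
  (1 - dead x) * (x - inR I + (inR I - x)) *
    (nbrCount I dead x (inM I) * (2 - nbrCount I dead x (inM I)))

/-- The last leaf among the first nodes, together with its neighbour. -/
def findLeaf (dead : ℕ → ℕ) (w : ℕ × ℕ) : ℕ → ℕ × ℕ
  | 0 => w
  | x + 1 => if leafTest I dead x ≠ 0 then (x, nbrSum I dead x (inM I)) else findLeaf dead w x

end Tables

/-! ### The program -/

/-- The registers. -/
abbrev rL : Expr := .reg 0
abbrev rI : Expr := .reg 1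
abbrev rX : Expr := .reg 2
abbrev rY : Expr := .reg 3
abbrev rCnt : Expr := .reg 4
abbrev rNbr : Expr := .reg 5
abbrev rLeaf : Expr := .reg 6
abbrev rPar : Expr := .reg 7
abbrev rV : Expr := .reg 8
abbrev rTotal : Expr := .reg 9
abbrev rK : Expr := .reg 10
abbrev rk : Expr := .reg 11
abbrev rU : Expr := .reg 12
abbrev rOpp : Expr := .reg 13
abbrev rkk : Expr := .reg 14
abbrev rCp : Expr := .reg 15
abbrev rCx : Expr := .reg 16
abbrev rCn : Expr := .reg 17
abbrev rOk : Expr := .reg 18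
abbrev rCol : Expr := .reg 19
abbrev eD : Expr := .load 0
abbrev eN : Expr := .load 1
abbrev eM : Expr := .load 2
abbrev eR : Expr := .load 3
def eG (u v : Expr) : Expr := .load (4 + u * eN + v)
def eT (x y : Expr) : Expr := .load (4 + eN * eN + x * eM + y)
def eB (x v : Expr) : Expr := .load (4 + eN * eN + eM * eM + x * eN + v)
def eDead (y : Expr) : Expr := .load (rL + 3 * y)
def eVer (y : Expr) : Expr := .load (rL + 3 * y + 1)
def tabAddr (t e c : Expr) : Expr := rL + 3 * ((c * (eM + 1) + t) * 2 + e) + 2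
def eTab (t e c : Expr) : Expr := .load (tabAddr t e c)
def eBase : Expr := 4 * (eD + eN + 1)
def eColorRadix (v : Expr) : Expr := 2 - (1 - eB rPar v) * (1 - eB rLeaf v)
def eCountRadix (x v : Expr) : Expr := 1 + eB x v * eD
def eRadix (v : Expr) : Expr := eColorRadix v * eCountRadix rPar v * eCountRadix rLeaf v
def eColor (k v : Expr) : Expr := Expr.mod k (eColorRadix v)
def eLeft : Expr := Expr.mod (rk / eColorRadix rV) (eCountRadix rPar rV)
def eRight : Expr := Expr.mod (rk / eColorRadix rV / eCountRadix rPar rV) (eCountRadix rLeaf rV)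
def eAccepts (t e c : Expr) : Expr := (1 - t) * (1 - e) + eTab t e c
def eFlagLeft : Expr := Expr.mod rk 2
def eFlagRight : Expr := rk / 2
def eFlagNew : Expr := 1 - (1 - (eFlagLeft + eFlagRight + rCol))

theorem mul_add_lt {a b A B : ℕ} (ha : a < A) (hb : b < B) : a * B + b < A * B := by
  have := Nat.mul_le_mul_right B ha
  rw [Nat.succ_mul] at this
  omega

/-! ### Evaluation of the expressions of the program -/

section Values

variable {I : List ℕ} {X : ℕ} {h : Mach}

theorem val_L : rL.val (h.toState I) = I.length := rfl
theorem val_rI : rI.val (h.toState I) = h.i := rfl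
theorem val_rX : rX.val (h.toState I) = h.x := rfl
theorem val_rY : rY.val (h.toState I) = h.y := rfl
theorem val_rLeaf : rLeaf.val (h.toState I) = h.leaf := rfl
theorem val_rPar : rPar.val (h.toState I) = h.par := rfl
theorem val_rV : rV.val (h.toState I) = h.v := rfl
theorem val_rK : rK.val (h.toState I) = h.K := rfl
theorem val_rk : rk.val (h.toState I) = h.k := rfl
theorem val_rU : rU.val (h.toState I) = h.u := rfl
theorem val_rkk : rkk.val (h.toState I) = h.kk := rfl

theorem mem_of_lt {a : ℕ} (ha : a < I.length) : (h.toState I).mem a = I.getD a 0 := if_pos ha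

theorem val_load_of_lt {a : Expr} (ha : a.val (h.toState I) < I.length) :
    (Expr.load a).val (h.toState I) = I.getD (a.val (h.toState I)) 0 := if_pos ha

variable (hI : Admissible I X)
include hI

theorem val_D : eD.val (h.toState I) = inD I :=
  mem_of_lt (by have := hI.length_eq; change 0 < _; omega)
theorem val_N : eN.val (h.toState I) = inN I :=
  mem_of_lt (by have := hI.length_eq; change 1 < _; omega)
theorem val_M : eM.val (h.toState I) = inM I :=
  mem_of_lt (by have := hI.length_eq; change 2 < _; omega)
theorem val_R : eR.val (h.toState I) = inR I :=
  mem_of_lt (by have := hI.length_eq; change 3 < _; omega)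

theorem val_base : eBase.val (h.toState I) = base I := by
  simp only [eBase, Expr.val_mul, Expr.val_add, val_D hI, val_N hI, Expr.val_one,
    Expr.val_four, base]

theorem val_G {u v : Expr} {u' v' : ℕ} (hu : u.val (h.toState I) = u')
    (hv : v.val (h.toState I) = v') (hu' : u' < inN I) (hv' : v' < inN I) :
    (eG u v).val (h.toState I) = inG I u' v' := by
  have ha : (4 + u * eN + v).val (h.toState I) = 4 + u' * inN I + v' := by
    simp only [Expr.val_add, Expr.val_mul, Expr.val_four, val_N hI, hu, hv]
  have h1 := mul_add_lt hu' hv'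
  have h2 := hI.length_eq
  unfold eG inG
  rw [val_load_of_lt, ha]
  rw [ha]
  omega

theorem val_T {x y : Expr} {x' y' : ℕ} (hx : x.val (h.toState I) = x')
    (hy : y.val (h.toState I) = y') (hx' : x' < inM I) (hy' : y' < inM I) :
    (eT x y).val (h.toState I) = inT I x' y' := by
  have ha : (4 + eN * eN + x * eM + y).val (h.toState I) =
      4 + inN I * inN I + x' * inM I + y' := by
    simp only [Expr.val_add, Expr.val_mul, Expr.val_four, val_N hI, val_M hI, hx, hy]
  have h1 := mul_add_lt hx' hy'
  have h2 := hI.length_eq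
  unfold eT inT
  rw [val_load_of_lt, ha]
  rw [ha]
  omega

theorem val_B {x v : Expr} {x' v' : ℕ} (hx : x.val (h.toState I) = x')
    (hv : v.val (h.toState I) = v') (hx' : x' < inM I) (hv' : v' < inN I) :
    (eB x v).val (h.toState I) = inB I x' v' := by
  have ha : (4 + eN * eN + eM * eM + x * eN + v).val (h.toState I) =
      4 + inN I * inN I + inM I * inM I + x' * inN I + v' := by
    simp only [Expr.val_add, Expr.val_mul, Expr.val_four, val_N hI, val_M hI, hx, hv]
  have h1 := mul_add_lt hx' hv'
  have h2 := hI.length_eq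
  unfold eB inB
  rw [val_load_of_lt, ha]
  rw [ha]
  omega

omit hI in
theorem mem_array (a j : ℕ) (hj : j < 3) : (h.toState I).mem (I.length + 3 * a + j) =
    if j = 0 then h.dead a else if j = 1 then h.ver a else h.tab a := by
  change h.mem I _ = _
  unfold Mach.mem
  rw [if_neg (by omega)]
  have h1 : (I.length + 3 * a + j - I.length) / 3 = a := by omega
  have h2 : (I.length + 3 * a + j - I.length) % 3 = j := by omega
  rw [h1, h2]

omit hI in
theorem val_dead {y : Expr} {y' : ℕ} (hy : y.val (h.toState I) = y') :
    (eDead y).val (h.toState I) = h.dead y' := by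
  have := mem_array (I := I) (h := h) y' 0 (by omega)
  rw [eDead, Expr.val_load, Expr.val_add, Expr.val_mul, Expr.val_three, val_L, hy]
  exact this

omit hI in
theorem val_ver {y : Expr} {y' : ℕ} (hy : y.val (h.toState I) = y') :
    (eVer y).val (h.toState I) = h.ver y' := by
  have := mem_array (I := I) (h := h) y' 1 (by omega)
  rw [eVer, Expr.val_load, Expr.val_add, Expr.val_add, Expr.val_mul, Expr.val_three, Expr.val_one,
    val_L, hy]
  exact this

theorem val_tabAddr {t e c : Expr} {t' e' c' : ℕ} (ht : t.val (h.toState I) = t')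
    (he : e.val (h.toState I) = e') (hc : c.val (h.toState I) = c') :
    (tabAddr t e c).val (h.toState I) = I.length + 3 * cell I t' e' c' + 2 := by
  simp only [tabAddr, Expr.val_add, Expr.val_mul, Expr.val_one, Expr.val_two, Expr.val_three,
    val_L, val_M hI, ht, he, hc,
    cell]

theorem val_tab {t e c : Expr} {t' e' c' : ℕ} (ht : t.val (h.toState I) = t')
    (he : e.val (h.toState I) = e') (hc : c.val (h.toState I) = c') :
    (eTab t e c).val (h.toState I) = h.tab (cell I t' e' c') := by
  have := mem_array (I := I) (h := h) (cell I t' e' c') 2 (by omega)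
  rw [eTab, Expr.val_load, val_tabAddr hI ht he hc]
  simpa using this

theorem val_accepts {t e c : Expr} {t' e' c' : ℕ} (ht : t.val (h.toState I) = t')
    (he : e.val (h.toState I) = e') (hc : c.val (h.toState I) = c') :
    (eAccepts t e c).val (h.toState I) = accepts I h.tab t' e' c' := by
  simp only [eAccepts, Expr.val_add, Expr.val_mul, Expr.val_sub, Expr.val_one,
    val_tab hI ht he hc, ht, he, accepts]

theorem val_colorRadix (hp : h.par < inM I) (hx : h.leaf < inM I) {v : Expr} {v' : ℕ}
    (hv : v.val (h.toState I) = v') (hv' : v' < inN I) :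
    (eColorRadix v).val (h.toState I) = colorRadix I h.par h.leaf v' := by
  simp only [eColorRadix, Expr.val_mul, Expr.val_sub, Expr.val_one, Expr.val_two,
    val_B hI val_rPar hv hp hv', val_B hI val_rLeaf hv hx hv', colorRadix]

theorem val_countRadix {x v : Expr} {x' v' : ℕ} (hx : x.val (h.toState I) = x')
    (hv : v.val (h.toState I) = v') (hx' : x' < inM I) (hv' : v' < inN I) :
    (eCountRadix x v).val (h.toState I) = countRadix I x' v' := by
  simp only [eCountRadix, Expr.val_mul, Expr.val_add, Expr.val_one, val_D hI,
    val_B hI hx hv hx' hv', countRadix]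

theorem val_radix (hp : h.par < inM I) (hx : h.leaf < inM I) {v : Expr} {v' : ℕ}
    (hv : v.val (h.toState I) = v') (hv' : v' < inN I) :
    (eRadix v).val (h.toState I) = radix I h.par h.leaf v' := by
  simp only [eRadix, Expr.val_mul, val_colorRadix hI hp hx hv hv',
    val_countRadix hI val_rPar hv hp hv', val_countRadix hI val_rLeaf hv hx hv', radix]

theorem val_color (hp : h.par < inM I) (hx : h.leaf < inM I) {k v : Expr} {K v' : ℕ}
    (hk : k.val (h.toState I) = K / place I h.par h.leaf v')
    (hv : v.val (h.toState I) = v') (hv' : v' < inN I) :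
    (eColor k v).val (h.toState I) = dColor I h.par h.leaf K v' := by
  simp only [eColor, Expr.val_mod, val_colorRadix hI hp hx hv hv', hk, dColor]

theorem val_left (hp : h.par < inM I) (hx : h.leaf < inM I) (hv : h.v < inN I) {K : ℕ}
    (hk : h.k = K / place I h.par h.leaf h.v) :
    eLeft.val (h.toState I) = dLeft I h.par h.leaf K h.v := by
  simp only [eLeft, Expr.val_mod, Expr.val_div, val_colorRadix hI hp hx val_rV hv,
    val_countRadix hI val_rPar val_rV hp hv, val_rk, hk, dLeft]

theorem val_right (hp : h.par < inM I) (hx : h.leaf < inM I) (hv : h.v < inN I) {K : ℕ}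
    (hk : h.k = K / place I h.par h.leaf h.v) :
    eRight.val (h.toState I) = dRight I h.par h.leaf K h.v := by
  simp only [eRight, Expr.val_mod, Expr.val_div, val_colorRadix hI hp hx val_rV hv,
    val_countRadix hI val_rPar val_rV hp hv, val_countRadix hI val_rLeaf val_rV hx hv, val_rk, hk,
    dRight]

end Values

/-! ### Effect of stores on the three interleaved arrays -/

section Stores

variable {I : List ℕ} {X : ℕ} {h : Mach}

/-- The residue modulo three of the offset behind the input selects the array, so a write to one
array leaves the other two and the input untouched. -/
theorem update_mem {h' : Mach} {a j w : ℕ} (hj : j < 3) (hr : h.reg I.length = h'.reg I.length)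
    (hd : h'.dead = if j = 0 then Function.update h.dead a w else h.dead)
    (hv : h'.ver = if j = 1 then Function.update h.ver a w else h.ver)
    (ht : h'.tab = if j = 2 then Function.update h.tab a w else h.tab) :
    ({ h.toState I with
      mem := Function.update (h.toState I).mem (I.length + 3 * a + j) w } : State) =
      h'.toState I := by
  refine congrArg₂ State.mk hr ?_
  funext b
  by_cases hb : b = I.length + 3 * a + j
  · subst hb
    have := mem_array (I := I) (h := h') a j hj
    rw [Function.update_self]
    refine Eq.trans ?_ this.symm
    rw [hd, hv, ht]
    interval_cases j <;> simp
  · rw [Function.update_of_ne hb]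
    change h.mem I b = h'.mem I b
    unfold Mach.mem
    by_cases hlt : b < I.length
    · rw [if_pos hlt, if_pos hlt]
    · rw [if_neg hlt, if_neg hlt]
      have key : (b - I.length) % 3 = j → (b - I.length) / 3 ≠ a := by omega
      have hu : ∀ f : ℕ → ℕ, (b - I.length) % 3 = j →
          Function.update f a w ((b - I.length) / 3) = f ((b - I.length) / 3) :=
        fun f hf => Function.update_of_ne (key hf) _ _
      have e1 : (b - I.length) % 3 = 0 →
          h.dead ((b - I.length) / 3) = h'.dead ((b - I.length) / 3) := fun h1 => by
        rw [hd]
        split_ifs with h2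
        exacts [(hu _ (h1.trans h2.symm)).symm, rfl]
      have e2 : (b - I.length) % 3 = 1 →
          h.ver ((b - I.length) / 3) = h'.ver ((b - I.length) / 3) := fun h1 => by
        rw [hv]
        split_ifs with h2
        exacts [(hu _ (h1.trans h2.symm)).symm, rfl]
      have e3 : (b - I.length) % 3 = 2 →
          h.tab ((b - I.length) / 3) = h'.tab ((b - I.length) / 3) := fun h1 => by
        rw [ht]
        split_ifs with h2
        exacts [(hu _ (h1.trans h2.symm)).symm, rfl]
      split_ifs with h1 h2
      exacts [e1 h1, e2 h2, e3 (by omega)]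

theorem Mach.Bdd.store_dead (hB : h.Bdd I X) {y e : Expr} {y' w : ℕ}
    (hy : y.val (h.toState I) = y') (he : e.val (h.toState I) = w)
    (hyw : (rL + 3 * y).weight ≤ 3000 := by decide) (hew : e.weight ≤ 3000 := by decide) :
    RunsIn (.store (rL + 3 * y) e) (h.toState I)
      (Mach.toState I { h with dead := Function.update h.dead y' w }) (stepTime X.size) := by
  refine runsIn_store hB.bounded hyw hew ?_
  have ha : (rL + 3 * y).val (h.toState I) = I.length + 3 * y' + 0 := by
    simp only [Expr.val_add, Expr.val_mul, Expr.val_three, val_L, hy, add_zero]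
  rw [ha, he]
  exact update_mem (by omega) rfl rfl rfl rfl

theorem Mach.Bdd.store_ver (hB : h.Bdd I X) {y e : Expr} {y' w : ℕ}
    (hy : y.val (h.toState I) = y') (he : e.val (h.toState I) = w)
    (hyw : (rL + 3 * y + 1).weight ≤ 3000 := by decide) (hew : e.weight ≤ 3000 := by decide) :
    RunsIn (.store (rL + 3 * y + 1) e) (h.toState I)
      (Mach.toState I { h with ver := Function.update h.ver y' w }) (stepTime X.size) := by
  refine runsIn_store hB.bounded hyw hew ?_
  have ha : (rL + 3 * y + 1).val (h.toState I) = I.length + 3 * y' + 1 := by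
    simp only [Expr.val_add, Expr.val_mul, Expr.val_one, Expr.val_three, val_L, hy]
  rw [ha, he]
  exact update_mem (by omega) rfl rfl rfl rfl

theorem Mach.Bdd.store_tab (hB : h.Bdd I X) (hI : Admissible I X) {t e c f : Expr}
    {t' e' c' w : ℕ} (ht : t.val (h.toState I) = t') (he : e.val (h.toState I) = e')
    (hc : c.val (h.toState I) = c') (hf : f.val (h.toState I) = w)
    (haw : (tabAddr t e c).weight ≤ 3000 := by decide) (hfw : f.weight ≤ 3000 := by decide) :
    RunsIn (.store (tabAddr t e c) f) (h.toState I)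
      (Mach.toState I { h with tab := Function.update h.tab (cell I t' e' c') w })
      (stepTime X.size) := by
  refine runsIn_store hB.bounded haw hfw ?_
  rw [val_tabAddr hI ht he hc, hf]
  exact update_mem (by omega) rfl rfl rfl rfl

end Stores

end DCutProgram

namespace DCutProgram

open RAM

/-! ### Bounds -/

section Bounds

variable {I : List ℕ} {X p x K : ℕ}

theorem colorRadix_pos (v : ℕ) : 0 < colorRadix I p x v := by
  unfold colorRadix
  have : (1 - inB I p v) * (1 - inB I x v) ≤ 1 * 1 :=
    Nat.mul_le_mul (Nat.sub_le _ _) (Nat.sub_le _ _)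
  omega

theorem countRadix_pos (v : ℕ) : 0 < countRadix I p v := by
  unfold countRadix
  omega

theorem dColor_le (v : ℕ) : dColor I p x K v ≤ 1 := by
  have h1 : dColor I p x K v < colorRadix I p x v := Nat.mod_lt _ (colorRadix_pos v)
  unfold colorRadix at h1
  omega

theorem oppTerm_symm_diff_le {a b : ℕ} (ha : a ≤ 1) (hb : b ≤ 1) : a - b + (b - a) ≤ 1 := by
  omega

theorem flagLeft_le : flagLeft I p x K ≤ 1 :=
  Nat.lt_succ_iff.1 (Nat.mod_lt _ (by omega))

theorem flagNew_le : flagNew I p x K ≤ 1 :=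
  Nat.sub_le _ _

theorem okProd_le (j : ℕ) : okProd I p x K j ≤ 1 :=
  Finset.prod_le_one (fun _ _ => Nat.zero_le _) fun _ _ =>
    Nat.mul_le_mul (Nat.sub_le 1 _) (Nat.sub_le 1 _)

theorem colSum_le (j : ℕ) : colSum I p x K j ≤ j := by
  have := Finset.sum_le_card_nsmul (Finset.range j) (dColor I p x K) 1 fun _ _ => dColor_le _
  simpa [colSum] using this

variable (hI : Admissible I X) (hp : p < inM I) (hx : x < inM I)
include hI hp

theorem countRadix_le {v : ℕ} (hv : v < inN I) : countRadix I p v ≤ inD I + 1 := by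
  have := Nat.mul_le_mul_right (inD I) (hI.bag_le p hp v hv)
  unfold countRadix
  omega

theorem dLeft_le {v : ℕ} (hv : v < inN I) : dLeft I p x K v ≤ inD I := by
  have h1 : dLeft I p x K v < countRadix I p v := Nat.mod_lt _ (countRadix_pos v)
  have h2 := countRadix_le hI hp hv
  omega

include hx

omit hp in
theorem dRight_le {v : ℕ} (hv : v < inN I) : dRight I p x K v ≤ inD I := by
  have h1 : dRight I p x K v < countRadix I x v := Nat.mod_lt _ (countRadix_pos v)
  have h2 := countRadix_le hI hx hv
  omega

theorem radix_le {v : ℕ} (hv : v < inN I) :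
    radix I p x v ≤ 2 * (inD I + 1) * (inD I + 1) :=
  Nat.mul_le_mul (Nat.mul_le_mul (Nat.sub_le _ _) (countRadix_le hI hp hv))
    (countRadix_le hI hx hv)

/-- A crude bound that ignores the bags is enough here, since `X` influences the running time only
through its binary length. The sharp count of pairs is `Describes.place_eq`. -/
theorem place_le {j : ℕ} (hj : j ≤ inN I) : 4 * place I p x j ≤ X := by
  have h1 : place I p x j ≤ (2 * (inD I + 1) * (inD I + 1)) ^ j := by
    refine (Finset.prod_le_prod (fun _ _ => Nat.zero_le _) fun v hv =>
      radix_le hI hp hx (v := v) ?_).trans_eq ?_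
    · have := Finset.mem_range.1 hv
      omega
    · rw [Finset.prod_const, Finset.card_range]
  have h2 : (2 * (inD I + 1) * (inD I + 1)) ^ j ≤ (2 * (inD I + 1) * (inD I + 1)) ^ inN I :=
    Nat.pow_le_pow_right (by positivity) hj
  have h3 := hI.pairs_le
  omega

omit hp in
theorem oppTerm_le {u v : ℕ} (hu : u < inN I) (hv : v < inN I) : oppTerm I p x K v u ≤ 1 :=
  Nat.mul_le_mul (Nat.mul_le_mul (Nat.mul_le_mul (Nat.mul_le_mul (hI.graph_le v hv u hu)
    (hI.bag_le x hx v hv)) (hI.bag_le x hx u hu)) (Nat.sub_le 1 _))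
    (oppTerm_symm_diff_le (dColor_le u) (dColor_le v))

omit hp in
theorem oppSum_le {v j : ℕ} (hv : v < inN I) (hj : j ≤ inN I) : oppSum I p x K v j ≤ j := by
  have := Finset.sum_le_card_nsmul (Finset.range j) (oppTerm I p x K v) 1 fun u hu =>
    oppTerm_le hI hx ((Finset.mem_range.1 hu).trans_le hj) hv
  simpa [oppSum] using this

omit hx in
theorem digitLeft_lt {v : ℕ} (hv : v < inN I) : digitLeft I p x K v < base I := by
  have h1 := Nat.mul_le_mul (hI.bag_le p hp v hv) (dColor_le (I := I) (p := p) (x := x) (K := K) v)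
  have h2 := dLeft_le hI hp (x := x) (K := K) hv
  unfold digitLeft base
  omega

omit hp in
theorem digitRight_lt {v : ℕ} (hv : v < inN I) : digitRight I p x K v < base I := by
  have h1 := Nat.mul_le_mul (hI.bag_le x hx v hv) (dColor_le (I := I) (p := p) (x := x) (K := K) v)
  have h2 := dRight_le hI hx (p := p) (K := K) hv
  unfold digitRight base
  omega

/-- Needed for failing pairs too, because their code is still used as an address. The new count is
at most `2 * d + n`, which the factor four in `base` accommodates. -/
theorem digitNew_lt {v : ℕ} (hv : v < inN I) : digitNew I p x K v < base I := by
  have h1 := Nat.mul_le_mul_right (dColor I p x K v + 2 * newCount I p x K v) (hI.bag_le p hp v hv)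
  have h2 := dColor_le (I := I) (p := p) (x := x) (K := K) v
  have h3 := dLeft_le hI hp (x := x) (K := K) hv
  have h4 := dRight_le hI hx (p := p) (K := K) hv
  have h5 := oppSum_le hI hx (p := p) (K := K) hv le_rfl
  unfold digitNew base
  unfold newCount at h1 ⊢
  omega

omit hp hx in
theorem horner_le {f : ℕ → ℕ} {j : ℕ} (hj : j ≤ inN I) (hf : ∀ v < inN I, f v < base I) :
    horner (base I) f j ≤ X := by
  have h1 : horner (base I) f j < base I ^ j := horner_lt fun v hv => hf v (by omega)
  have h2 : base I ^ j ≤ base I ^ inN I :=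
    Nat.pow_le_pow_right (by unfold base; omega) hj
  have h3 := hI.code_le
  omega

end Bounds

/-! ### The inner loops -/

/-- A second copy `kk` of the counter is stripped along with `u`, so that the colour of `u` can be
read while `k` stays at the place of `v`. The two truncated differences add up to the indicator of
different colours. -/
def uBody : Program :=
  .seq (.assign 13 (rOpp + eG rV rU * eB rLeaf rV * eB rLeaf rU * (1 - eB rPar rV * eB rPar rU) *
    (eColor rkk rU - eColor rk rV + (eColor rk rV - eColor rkk rU))))
  (.seq (.assign 14 (rkk / eRadix rU))
  (.assign 12 (rU + 1)))

def uLoop : Program := .loop (eN - rU) uBody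

/-- All digits of `v` are read before `k` is divided, and `v` advances last because the radix
depends on it. Clearing `u`, `opp` and `kk` makes the pass end exactly in a state of the form
`decoded`. -/
def vBody : Program :=
  .seq (.assign 14 rK)
  (.seq uLoop
  (.seq (.assign 15 (rCp * eBase + (eB rPar rV * eColor rk rV + 2 * eLeft)))
  (.seq (.assign 16 (rCx * eBase + (eB rLeaf rV * eColor rk rV + 2 * eRight)))
  (.seq (.assign 17 (rCn * eBase + eB rPar rV * (eColor rk rV + 2 * (eLeft + eRight + rOpp))))
  -- The first factor tests that the merged count is at most `d`. In the second, `1 - v` vanishes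
  -- unless `v = 0`, so it only demands that vertex zero has colour zero.
  (.seq (.assign 18 (rOk * ((1 - (eLeft + eRight + rOpp - eD)) * (1 - eColor rk rV * (1 - rV)))))
  (.seq (.assign 19 (rCol + eColor rk rV))
  (.seq (.assign 11 (rk / eRadix rV))
  (.seq (.assign 12 0)
  (.seq (.assign 13 0)
  (.seq (.assign 14 0)
  (.assign 8 (rV + 1))))))))))))

def vLoop : Program := .loop (eN - rV) vBody

section InnerLoops

variable {I : List ℕ} {X : ℕ} {h : Mach}

theorem div_place_succ (p x K j : ℕ) :
    K / place I p x j / radix I p x j = K / place I p x (j + 1) := by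
  rw [Nat.div_div_eq_div_mul, place, place, Finset.prod_range_succ]

theorem runsIn_uLoop (hI : Admissible I X) (hB : h.Bdd I X) (hp : h.par < inM I)
    (hx : h.leaf < inM I) (hv : h.v < inN I) {K : ℕ} (hK : K ≤ X)
    (hk : h.k = K / place I h.par h.leaf h.v) :
    RunsIn uLoop (Mach.toState I { h with u := 0, opp := 0, kk := K })
      (Mach.toState I { h with
        u := inN I
        opp := oppSum I h.par h.leaf K h.v (inN I)
        kk := K / place I h.par h.leaf (inN I) })
      (inN I * (stepTime X.size + 3 * stepTime X.size) + stepTime X.size) := by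
  have hNX : inN I ≤ X := hI.input_le 1
  set F : ℕ → Mach := fun j => { h with
        u := j
        opp := oppSum I h.par h.leaf K h.v j
        kk := K / place I h.par h.leaf j } with hF
  have hFB : ∀ j ≤ inN I, (F j).Bdd I X := fun j hj =>
    { hB with
      u := hj.trans hNX
      opp := ((oppSum_le hI hx hv hj).trans hj).trans hNX
      kk := (Nat.div_le_self _ _).trans hK }
  have htest : ∀ j, (eN - rU).val ((F j).toState I) = inN I - j := fun j => by
    rw [Expr.val_sub, val_N hI, val_rU]
  have hcost : ∀ j ≤ inN I, (eN - rU).cost ((F j).toState I) + 1 ≤ stepTime X.size :=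
    fun j hj => Expr.cost_le_stepTime (hFB j hj).bounded (by decide)
  have hloop := runsIn_loop (e := eN - rU) (p := uBody) (fun j => (F j).toState I) (N := inN I)
    (C := stepTime X.size) (T := 3 * stepTime X.size) ?_ ?_
  · have h0 : F 0 = { h with u := 0, opp := 0, kk := K } := by
      simp [hF, oppSum, place]
    rw [← h0]
    exact hloop
  · intro j hj
    have hb := hFB j hj.le
    have hb' := hFB (j + 1) hj
    have hcv : (eColor rk rV).val ((F j).toState I) = dColor I h.par h.leaf K h.v :=
      val_color (h := F j) hI hp hx hk rfl hv
    have hcu : (eColor rkk rU).val ((F j).toState I) = dColor I h.par h.leaf K j :=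
      val_color (h := F j) hI hp hx rfl rfl hj
    refine ⟨by rw [htest]; omega, hcost j hj.le, ?_⟩
    have r1 := hb.assign_opp (e := rOpp + eG rV rU * eB rLeaf rV * eB rLeaf rU *
      (1 - eB rPar rV * eB rPar rU) *
      (eColor rkk rU - eColor rk rV + (eColor rk rV - eColor rkk rU)))
      (w := oppSum I h.par h.leaf K h.v (j + 1)) (by
        simp only [Expr.val_add, Expr.val_mul, Expr.val_sub, Expr.val_one, hcv, hcu,
          val_G hI (val_rV (h := F j)) val_rU hv hj, val_B hI (val_rLeaf (h := F j)) val_rV hx hv,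
          val_B hI (val_rLeaf (h := F j)) val_rU hx hj, val_B hI (val_rPar (h := F j)) val_rV hp hv,
          val_B hI (val_rPar (h := F j)) val_rU hp hj]
        rw [oppSum, Finset.sum_range_succ]
        rfl)
    set h1 : Mach := { F j with opp := oppSum I h.par h.leaf K h.v (j + 1) }
    have hb1 : h1.Bdd I X := { hb with opp := hb'.opp }
    have r2 := hb1.assign_kk (e := rkk / eRadix rU) (w := K / place I h.par h.leaf (j + 1)) (by
        rw [Expr.val_div, val_radix (h := h1) hI hp hx val_rU hj, val_rkk, ← div_place_succ])
    set h2 : Mach := { h1 with kk := K / place I h.par h.leaf (j + 1) }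
    have hb2 : h2.Bdd I X := { hb1 with kk := hb'.kk }
    have r3 := hb2.assign_u (e := rU + 1) (w := j + 1) (by
        rw [Expr.val_add, Expr.val_one, val_rU])
    exact (r1.seq (r2.seq r3)).mono (by omega)
  · exact ⟨by rw [htest]; omega, hcost _ le_rfl⟩

/-- The state after the first `j` vertices of the pair `K` have been decoded. -/
def decoded (I : List ℕ) (h : Mach) (K j : ℕ) : Mach :=
  { h with
    v := j
    k := K / place I h.par h.leaf j
    cp := horner (base I) (digitLeft I h.par h.leaf K) j
    cx := horner (base I) (digitRight I h.par h.leaf K) j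
    cn := horner (base I) (digitNew I h.par h.leaf K) j
    ok := okProd I h.par h.leaf K j
    col := colSum I h.par h.leaf K j
    u := 0
    opp := 0
    kk := 0 }

theorem decoded_bdd (hI : Admissible I X) (hB : h.Bdd I X) (hp : h.par < inM I)
    (hx : h.leaf < inM I) {K j : ℕ} (hK : K ≤ X) (hj : j ≤ inN I) :
    (decoded I h K j).Bdd I X :=
  have hNX : inN I ≤ X := hI.input_le 1
  have hX : 1 ≤ X := by have := hI.length_le; have := hI.length_eq; omega
  { hB with
    v := hj.trans hNX
    k := (Nat.div_le_self _ _).trans hK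
    cp := horner_le hI hj fun _ hv => digitLeft_lt hI hp hv
    cx := horner_le hI hj fun _ hv => digitRight_lt hI hx hv
    cn := horner_le hI hj fun _ hv => digitNew_lt hI hp hx hv
    ok := (okProd_le j).trans hX
    col := ((colSum_le j).trans hj).trans hNX
    u := Nat.zero_le _
    opp := Nat.zero_le _
    kk := Nat.zero_le _ }

theorem runsIn_vBody (hI : Admissible I X) (hB : h.Bdd I X) (hp : h.par < inM I)
    (hx : h.leaf < inM I) (hK : h.K ≤ X) {j : ℕ} (hj : j < inN I) :
    RunsIn vBody ((decoded I h h.K j).toState I) ((decoded I h h.K (j + 1)).toState I)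
      (4 * inN I * stepTime X.size + 12 * stepTime X.size) := by
  have hNX : inN I ≤ X := hI.input_le 1
  generalize hKK : h.K = K at hK ⊢
  have hb := decoded_bdd hI hB hp hx hK hj.le
  have hb' := decoded_bdd hI hB hp hx hK (j := j + 1) hj
  have hdig := oppSum_le hI hx (p := h.par) (K := K) hj le_rfl
  have r1 := hb.assign_kk (e := rK) (w := K) (by rw [val_rK]; exact hKK)
  have r2 := runsIn_uLoop hI hb hp hx hj (K := K) hK rfl
  set h2 : Mach := { decoded I h K j with
        u := inN I
        opp := oppSum I h.par h.leaf K j (inN I)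
        kk := K / place I h.par h.leaf (inN I) } with hh2
  have hb2 : h2.Bdd I X := { hb with
    u := hNX
    opp := hdig.trans hNX
    kk := (Nat.div_le_self _ _).trans hK }
  have r3 := hb2.assign_cp (e := rCp * eBase + (eB rPar rV * eColor rk rV + 2 * eLeft))
    (w := (decoded I h K (j + 1)).cp) (by
      simp only [Expr.val_add, Expr.val_mul, Expr.val_two, val_base hI,
        val_B hI (val_rPar (h := h2)) val_rV hp hj,
        val_color (h := h2) hI hp hx (k := rk) (v := rV) rfl rfl hj,
        val_left (h := h2) hI hp hx hj rfl]
      rfl)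
  set h3 : Mach := { h2 with cp := (decoded I h K (j + 1)).cp } with hh3
  have hb3 : h3.Bdd I X := { hb2 with cp := hb'.cp }
  have r4 := hb3.assign_cx (e := rCx * eBase + (eB rLeaf rV * eColor rk rV + 2 * eRight))
    (w := (decoded I h K (j + 1)).cx) (by
      simp only [Expr.val_add, Expr.val_mul, Expr.val_two, val_base hI,
        val_B hI (val_rLeaf (h := h3)) val_rV hx hj,
        val_color (h := h3) hI hp hx (k := rk) (v := rV) rfl rfl hj,
        val_right (h := h3) hI hp hx hj rfl]
      rfl)
  set h4 : Mach := { h3 with cx := (decoded I h K (j + 1)).cx } with hh4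
  have hb4 : h4.Bdd I X := { hb3 with cx := hb'.cx }
  have r5 := hb4.assign_cn
    (e := rCn * eBase + eB rPar rV * (eColor rk rV + 2 * (eLeft + eRight + rOpp)))
    (w := (decoded I h K (j + 1)).cn) (by
      simp only [Expr.val_add, Expr.val_mul, Expr.val_two, val_base hI,
        val_B hI (val_rPar (h := h4)) val_rV hp hj,
        val_color (h := h4) hI hp hx (k := rk) (v := rV) rfl rfl hj,
        val_left (h := h4) hI hp hx hj rfl, val_right (h := h4) hI hp hx hj rfl]
      rfl)
  set h5 : Mach := { h4 with cn := (decoded I h K (j + 1)).cn } with hh5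
  have hb5 : h5.Bdd I X := { hb4 with cn := hb'.cn }
  have r6 := hb5.assign_ok
    (e := rOk * ((1 - (eLeft + eRight + rOpp - eD)) * (1 - eColor rk rV * (1 - rV))))
    (w := (decoded I h K (j + 1)).ok) (by
      simp only [Expr.val_add, Expr.val_mul, Expr.val_sub, Expr.val_one, val_D hI,
        val_color (h := h5) hI hp hx (k := rk) (v := rV) rfl rfl hj,
        val_left (h := h5) hI hp hx hj rfl, val_right (h := h5) hI hp hx hj rfl]
      change _ = okProd I h.par h.leaf K (j + 1)
      rw [okProd, Finset.prod_range_succ]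
      rfl)
  set h6 : Mach := { h5 with ok := (decoded I h K (j + 1)).ok } with hh6
  have hb6 : h6.Bdd I X := { hb5 with ok := hb'.ok }
  have r7 := hb6.assign_col (e := rCol + eColor rk rV)
    (w := (decoded I h K (j + 1)).col) (by
      simp only [Expr.val_add,
        val_color (h := h6) hI hp hx (k := rk) (v := rV) rfl rfl hj]
      change _ = colSum I h.par h.leaf K (j + 1)
      rw [colSum, Finset.sum_range_succ]
      rfl)
  set h7 : Mach := { h6 with col := (decoded I h K (j + 1)).col } with hh7
  have hb7 : h7.Bdd I X := { hb6 with col := hb'.col }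
  have r8 := hb7.assign_k (e := rk / eRadix rV) (w := (decoded I h K (j + 1)).k) (by
      rw [Expr.val_div, val_radix (h := h7) hI hp hx val_rV hj, val_rk]
      exact div_place_succ _ _ _ _)
  set h8 : Mach := { h7 with k := (decoded I h K (j + 1)).k } with hh8
  have hb8 : h8.Bdd I X := { hb7 with k := hb'.k }
  have r9 := hb8.assign_u (e := 0) (w := 0) (Expr.val_zero _)
  have hb9 : Mach.Bdd I X { h8 with u := 0 } := { hb8 with u := Nat.zero_le _ }
  have r10 := hb9.assign_opp (e := 0) (w := 0) (Expr.val_zero _)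
  have hb10 : Mach.Bdd I X { h8 with u := 0, opp := 0 } := { hb9 with opp := Nat.zero_le _ }
  have r11 := hb10.assign_kk (e := 0) (w := 0) (Expr.val_zero _)
  have hb11 : Mach.Bdd I X { h8 with u := 0, opp := 0, kk := 0 } :=
    { hb10 with kk := Nat.zero_le _ }
  have r12 := hb11.assign_v (e := rV + 1) (w := j + 1) (by
    rw [Expr.val_add, Expr.val_one, val_rV]
    rfl)
  have r := r1.seq (r2.seq (r3.seq (r4.seq (r5.seq (r6.seq (r7.seq (r8.seq (r9.seq (r10.seq
    (r11.seq r12))))))))))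
  -- Eleven assignments and the final test of the inner loop make up the twelve single steps.
  refine RunsIn.mono r ?_
  have : inN I * (stepTime X.size + 3 * stepTime X.size) = 4 * inN I * stepTime X.size := by ring
  omega

theorem runsIn_vLoop (hI : Admissible I X) (hB : h.Bdd I X) (hp : h.par < inM I)
    (hx : h.leaf < inM I) (hK : h.K ≤ X) :
    RunsIn vLoop ((decoded I h h.K 0).toState I) ((decoded I h h.K (inN I)).toState I)
      (inN I * (stepTime X.size + (4 * inN I * stepTime X.size + 12 * stepTime X.size)) +
        stepTime X.size) := by
  have htest : ∀ j, (eN - rV).val ((decoded I h h.K j).toState I) = inN I - j := fun j => by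
    rw [Expr.val_sub, val_N hI, val_rV]
    rfl
  have hcost : ∀ j ≤ inN I, (eN - rV).cost ((decoded I h h.K j).toState I) + 1 ≤ stepTime X.size :=
    fun j hj => Expr.cost_le_stepTime (decoded_bdd hI hB hp hx hK hj).bounded (by decide)
  refine runsIn_loop (e := eN - rV) (p := vBody) (fun j => (decoded I h h.K j).toState I) ?_ ?_
  · intro j hj
    exact ⟨by rw [htest]; omega, hcost j hj.le, runsIn_vBody hI hB hp hx hK hj⟩
  · exact ⟨by rw [htest]; omega, hcost _ le_rfl⟩

end InnerLoops

end DCutProgram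

namespace DCutProgram

open RAM

/-! ### Merging two tables -/

/-- A state in which the registers for temporary values are zero. -/
def idle (i x leaf par v total K : ℕ) (dead ver tab : ℕ → ℕ) : Mach :=
  ⟨i, x, 0, 0, 0, leaf, par, v, total, K, 0, 0, 0, 0, 0, 0, 0, 0, 0, dead, ver, tab⟩

/-- One store reads both old tables and writes into version `i + 1`. The temporary registers are
cleared afterwards so that the next pass starts from an `idle` state again. -/
def KBody : Program :=
  .seq (.assign 11 rK)
  (.seq (.assign 18 1)
  (.seq vLoop
  (.seq (.store (tabAddr (rI + 1) eFlagNew rCn) (1 - (1 - (eTab (rI + 1) eFlagNew rCn +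
    rOk * eAccepts (eVer rPar) eFlagLeft rCp * eAccepts (eVer rLeaf) eFlagRight rCx))))
  (.seq (.assign 8 0)
  (.seq (.assign 11 0)
  (.seq (.assign 15 0)
  (.seq (.assign 16 0)
  (.seq (.assign 17 0)
  (.seq (.assign 18 0)
  (.seq (.assign 19 0)
  (.assign 10 (rK + 1))))))))))))

def KLoop : Program := .loop (rTotal - rK) KBody

/-- Multiplies the radices of all vertices, starting from the four combinations of flags, to get the
number of pairs to be enumerated. -/
def totalBody : Program :=
  .seq (.assign 9 (rTotal * eRadix rV)) (.assign 8 (rV + 1))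

def totalLoop : Program := .loop (eN - rV) totalBody

/-! ### Searching a leaf -/

/-- The sum of the remaining neighbours is accumulated besides their number, because it is the
neighbour itself once the number is one. -/
def yBody : Program :=
  .seq (.assign 4 (rCnt + eT rX rY * (1 - eDead rY)))
  (.seq (.assign 5 (rNbr + eT rX rY * (1 - eDead rY) * rY))
  (.assign 3 (rY + 1)))

def yLoop : Program := .loop (eM - rY) yBody

def eLeafTest : Expr := (1 - eDead rX) * (rX - eR + (eR - rX)) * (rCnt * (2 - rCnt))

/-- A leaf found later overwrites an earlier one, in accordance with `findLeaf`, which prefers the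
largest index. -/
def xBody : Program :=
  .seq yLoop
  (.seq (.cond eLeafTest (.seq (.assign 6 rX) (.assign 7 rNbr)) .skip)
  (.seq (.assign 3 0)
  (.seq (.assign 4 0)
  (.seq (.assign 5 0)
  (.assign 2 (rX + 1))))))

def xLoop : Program := .loop (eM - rX) xBody

/-! ### The main loop -/

/-- The version of the neighbour changes only after the merge, so its old table stays readable
throughout. The pass number `i + 1` is a version not used before. -/
def mainBody : Program :=
  .seq xLoop
  (.seq (.assign 2 0)
  (.seq (.assign 9 4)
  (.seq totalLoop
  (.seq (.assign 8 0)
  (.seq KLoop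
  (.seq (.assign 10 0)
  (.seq (.assign 9 0)
  (.seq (.store (rL + 3 * rLeaf) 1)
  (.seq (.store (rL + 3 * rPar + 1) (rI + 1))
  (.assign 1 (rI + 1)))))))))))

def mainLoop : Program := .loop (eM - 1 - rI) mainBody

/-- The algorithm deciding `d`-Cut. -/
def program : Program :=
  .seq mainLoop (.assign 0 (eTab (eVer eR) 1 0))

/-! ### Execution of the loops over pairs of states -/

section Merging

variable {I : List ℕ} {X : ℕ}

/-- All numbers in an idle state are at most `X`. -/
theorem idle_bdd (hI : Admissible I X) {i x leaf par v total K : ℕ} {dead ver tab : ℕ → ℕ}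
    (h1 : i ≤ X) (h2 : x ≤ X) (h3 : leaf ≤ X) (h4 : par ≤ X) (h5 : v ≤ X) (h6 : total ≤ X)
    (h7 : K ≤ X) (h8 : ∀ a, dead a ≤ X) (h9 : ∀ a, ver a ≤ X) (h10 : ∀ a, tab a ≤ X) :
    (idle i x leaf par v total K dead ver tab).Bdd I X :=
  ⟨hI.length_le, hI.input_le, h1, h2, Nat.zero_le _, Nat.zero_le _, Nat.zero_le _, h3, h4, h5, h6,
    h7, Nat.zero_le _, Nat.zero_le _, Nat.zero_le _, Nat.zero_le _, Nat.zero_le _, Nat.zero_le _,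
    Nat.zero_le _, Nat.zero_le _, Nat.zero_le _, h8, h9, h10⟩

theorem Admissible.one_le (hI : Admissible I X) : 1 ≤ X := by
  have := hI.length_le
  have := hI.length_eq
  omega

theorem mergeTab_le {p x t : ℕ} {ver tab : ℕ → ℕ} (htab : ∀ a, tab a ≤ 1) (J a : ℕ) :
    mergeTab I p x t ver tab J a ≤ 1 := by
  induction J generalizing a with
  | zero => exact htab a
  | succ J ih =>
    simp only [mergeTab, Function.update_apply]
    split_ifs
    · exact Nat.sub_le _ _
    · exact ih a

variable {i leaf par : ℕ} {dead ver tab : ℕ → ℕ}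

/-- The time of one pass of the loop over the pairs of states. -/
def pairTime (n σ : ℕ) : ℕ := n * (σ + (4 * n * σ + 12 * σ)) + 12 * σ

theorem runsIn_KBody (hI : Admissible I X) (hp : par < inM I) (hx : leaf < inM I)
    (hi : i < inM I) {total J : ℕ} (ht : total ≤ X) (hJ : J < total) (hd : ∀ a, dead a ≤ 1)
    (hver : ∀ a, ver a ≤ inM I) (htab : ∀ a, tab a ≤ 1) :
    RunsIn KBody
      ((idle i 0 leaf par 0 total J dead ver (mergeTab I par leaf (i + 1) ver tab J)).toState I)
      ((idle i 0 leaf par 0 total (J + 1) dead ver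
        (mergeTab I par leaf (i + 1) ver tab (J + 1))).toState I)
      (pairTime (inN I) (stepTime X.size)) := by
  have hNX : inN I ≤ X := hI.input_le 1
  have hMX : inM I ≤ X := hI.input_le 2
  have hX := hI.one_le
  set T := mergeTab I par leaf (i + 1) ver tab J with hT
  set T' := mergeTab I par leaf (i + 1) ver tab (J + 1) with hT'
  set h0 := idle i 0 leaf par 0 total J dead ver T with hh0
  have hb0 : h0.Bdd I X := idle_bdd hI (hi.le.trans hMX) (Nat.zero_le _) (hx.le.trans hMX)
    (hp.le.trans hMX) (Nat.zero_le _) ht (hJ.le.trans ht) (fun a => (hd a).trans hX)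
    (fun a => (hver a).trans hMX) (fun a => (mergeTab_le htab J a).trans hX)
  have r1 := hb0.assign_k (e := rK) (w := J) rfl
  set h1 : Mach := { h0 with k := J }
  have hb1 : h1.Bdd I X := { hb0 with k := hJ.le.trans ht }
  have r2 := hb1.assign_ok (e := 1) (w := 1) (Expr.val_one _)
  -- With the full counter in `k` and the empty product one in `ok`, this is the state in which no
  -- vertex has been decoded.
  have hdec : { h1 with ok := 1 } = decoded I h0 J 0 := by
    simp [h1, h0, decoded, horner, place, okProd, colSum, idle]
  rw [hdec] at r2
  have r3 := runsIn_vLoop hI hb0 hp hx (hJ.le.trans ht)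
  change RunsIn vLoop ((decoded I h0 J 0).toState I) _ _ at r3
  set h3 := decoded I h0 J (inN I) with hh3
  have hb3 : h3.Bdd I X := decoded_bdd hI hb0 hp hx (hJ.le.trans ht) le_rfl
  have vI : (rI + 1).val (h3.toState I) = i + 1 := by
    rw [Expr.val_add, val_rI, Expr.val_one]
    rfl
  have vfl : eFlagLeft.val (h3.toState I) = flagLeft I par leaf J := by
    rw [eFlagLeft, Expr.val_mod, Expr.val_two]
    rfl
  have vfr : eFlagRight.val (h3.toState I) = flagRight I par leaf J := by
    rw [eFlagRight, Expr.val_div, Expr.val_two]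
    rfl
  have vfn : eFlagNew.val (h3.toState I) = flagNew I par leaf J := by
    simp only [eFlagNew, Expr.val_sub, Expr.val_add, Expr.val_one, vfl, vfr]
    rfl
  have vcn : rCn.val (h3.toState I) = codeNew I par leaf J := rfl
  have vcp : rCp.val (h3.toState I) = codeLeft I par leaf J := rfl
  have vcx : rCx.val (h3.toState I) = codeRight I par leaf J := rfl
  have r4 := hb3.store_tab hI vI vfn vcn (f := 1 - (1 - (eTab (rI + 1) eFlagNew rCn +
    rOk * eAccepts (eVer rPar) eFlagLeft rCp * eAccepts (eVer rLeaf) eFlagRight rCx)))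
    (w := 1 - (1 - (T (cell I (i + 1) (flagNew I par leaf J) (codeNew I par leaf J)) +
      okProd I par leaf J (inN I) *
      accepts I T (ver par) (flagLeft I par leaf J) (codeLeft I par leaf J) *
      accepts I T (ver leaf) (flagRight I par leaf J) (codeRight I par leaf J)))) (by
      simp only [Expr.val_sub, Expr.val_add, Expr.val_mul, Expr.val_one,
        val_tab hI vI vfn vcn, val_accepts hI (val_ver (h := h3) val_rPar) vfl vcp,
        val_accepts hI (val_ver (h := h3) val_rLeaf) vfr vcx]
      rfl)
  set h4 : Mach := { h3 with tab := T' } with hh4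
  change RunsIn _ _ (h4.toState I) _ at r4
  have hb4 : h4.Bdd I X :=
    { hb3 with tab := fun a => (mergeTab_le htab (J + 1) a).trans hX }
  have r5 := hb4.assign_v (e := 0) (w := 0) (Expr.val_zero _)
  set h5 : Mach := { h4 with v := 0 }
  have hb5 : h5.Bdd I X := { hb4 with v := Nat.zero_le _ }
  have r6 := hb5.assign_k (e := 0) (w := 0) (Expr.val_zero _)
  set h6 : Mach := { h5 with k := 0 }
  have hb6 : h6.Bdd I X := { hb5 with k := Nat.zero_le _ }
  have r7 := hb6.assign_cp (e := 0) (w := 0) (Expr.val_zero _)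
  set h7 : Mach := { h6 with cp := 0 }
  have hb7 : h7.Bdd I X := { hb6 with cp := Nat.zero_le _ }
  have r8 := hb7.assign_cx (e := 0) (w := 0) (Expr.val_zero _)
  set h8 : Mach := { h7 with cx := 0 }
  have hb8 : h8.Bdd I X := { hb7 with cx := Nat.zero_le _ }
  have r9 := hb8.assign_cn (e := 0) (w := 0) (Expr.val_zero _)
  set h9 : Mach := { h8 with cn := 0 }
  have hb9 : h9.Bdd I X := { hb8 with cn := Nat.zero_le _ }
  have r10 := hb9.assign_ok (e := 0) (w := 0) (Expr.val_zero _)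
  set h10 : Mach := { h9 with ok := 0 }
  have hb10 : h10.Bdd I X := { hb9 with ok := Nat.zero_le _ }
  have r11 := hb10.assign_col (e := 0) (w := 0) (Expr.val_zero _)
  set h11 : Mach := { h10 with col := 0 }
  have hb11 : h11.Bdd I X := { hb10 with col := Nat.zero_le _ }
  have r12 := hb11.assign_K (e := rK + 1) (w := J + 1) (by
    rw [Expr.val_add, Expr.val_one]
    rfl)
  have r := r1.seq (r2.seq (r3.seq (r4.seq (r5.seq (r6.seq (r7.seq (r8.seq (r9.seq (r10.seq
    (r11.seq r12))))))))))
  refine RunsIn.mono r ?_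
  unfold pairTime
  omega

theorem runsIn_KLoop (hI : Admissible I X) (hp : par < inM I) (hx : leaf < inM I)
    (hi : i < inM I) {total : ℕ} (ht : total ≤ X) (hd : ∀ a, dead a ≤ 1)
    (hver : ∀ a, ver a ≤ inM I) (htab : ∀ a, tab a ≤ 1) :
    RunsIn KLoop ((idle i 0 leaf par 0 total 0 dead ver tab).toState I)
      ((idle i 0 leaf par 0 total total dead ver
        (mergeTab I par leaf (i + 1) ver tab total)).toState I)
      (total * (stepTime X.size + pairTime (inN I) (stepTime X.size)) + stepTime X.size) := by
  have hMX : inM I ≤ X := hI.input_le 2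
  have hX := hI.one_le
  have hcost : ∀ J ≤ total, (rTotal - rK).cost ((idle i 0 leaf par 0 total J dead ver
      (mergeTab I par leaf (i + 1) ver tab J)).toState I) + 1 ≤ stepTime X.size :=
    fun J hJ => Expr.cost_le_stepTime (idle_bdd hI (hi.le.trans hMX) (Nat.zero_le _)
      (hx.le.trans hMX) (hp.le.trans hMX) (Nat.zero_le _) ht (hJ.trans ht)
      (fun a => (hd a).trans hX) (fun a => (hver a).trans hMX)
      (fun a => (mergeTab_le htab J a).trans hX)).bounded (by decide)
  refine runsIn_loop (e := rTotal - rK) (p := KBody) (fun J => (idle i 0 leaf par 0 total J dead ver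
      (mergeTab I par leaf (i + 1) ver tab J)).toState I) ?_ ?_
  · intro J hJ
    refine ⟨?_, hcost J hJ.le, runsIn_KBody hI hp hx hi ht hJ hd hver htab⟩
    change total - J ≠ 0
    omega
  · exact ⟨Nat.sub_self total, hcost _ le_rfl⟩

theorem runsIn_totalLoop (hI : Admissible I X) (hp : par < inM I) (hx : leaf < inM I)
    (hi : i < inM I) (hd : ∀ a, dead a ≤ 1) (hver : ∀ a, ver a ≤ inM I) (htab : ∀ a, tab a ≤ 1) :
    RunsIn totalLoop ((idle i 0 leaf par 0 4 0 dead ver tab).toState I)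
      ((idle i 0 leaf par (inN I) (4 * place I par leaf (inN I)) 0 dead ver tab).toState I)
      (inN I * (stepTime X.size + 2 * stepTime X.size) + stepTime X.size) := by
  have hNX : inN I ≤ X := hI.input_le 1
  have hMX : inM I ≤ X := hI.input_le 2
  have hX := hI.one_le
  have hbdd : ∀ j ≤ inN I,
      (idle i 0 leaf par j (4 * place I par leaf j) 0 dead ver tab).Bdd I X := fun j hj =>
    idle_bdd hI (hi.le.trans hMX) (Nat.zero_le _) (hx.le.trans hMX) (hp.le.trans hMX)
      (hj.trans hNX) (place_le hI hp hx hj) (Nat.zero_le _) (fun a => (hd a).trans hX)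
      (fun a => (hver a).trans hMX) (fun a => (htab a).trans hX)
  have htest : ∀ j, (eN - rV).val
      ((idle i 0 leaf par j (4 * place I par leaf j) 0 dead ver tab).toState I) = inN I - j :=
    fun j => by
      rw [Expr.val_sub, val_N hI]
      rfl
  refine runsIn_loop (e := eN - rV) (p := totalBody)
    (fun j => (idle i 0 leaf par j (4 * place I par leaf j) 0 dead ver tab).toState I) ?_ ?_
  · intro j hj
    refine ⟨by rw [htest]; omega, Expr.cost_le_stepTime (hbdd j hj.le).bounded (by decide), ?_⟩
    have hb := hbdd j hj.le
    set h := idle i 0 leaf par j (4 * place I par leaf j) 0 dead ver tab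
    have r1 := hb.assign_total (e := rTotal * eRadix rV) (w := 4 * place I par leaf (j + 1)) (by
      rw [Expr.val_mul, val_radix (h := h) hI hp hx val_rV hj, place, Finset.prod_range_succ,
        ← mul_assoc]
      rfl)
    set h1 : Mach := { h with total := 4 * place I par leaf (j + 1) }
    have hb1 : h1.Bdd I X := { hb with total := place_le hI hp hx hj }
    have r2 := hb1.assign_v (e := rV + 1) (w := j + 1) (by
      rw [Expr.val_add, Expr.val_one]
      rfl)
    exact (r1.seq r2).mono (by omega)
  · exact ⟨by rw [htest]; omega, Expr.cost_le_stepTime (hbdd _ le_rfl).bounded (by decide)⟩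

end Merging

/-! ### Execution of the search for a leaf -/

section Searching

variable {I : List ℕ} {X : ℕ} {i x leaf par : ℕ} {dead ver tab : ℕ → ℕ}

theorem nbrCount_le (hI : Admissible I X) (hx : x < inM I) {j : ℕ} (hj : j ≤ inM I) :
    nbrCount I dead x j ≤ j := by
  have := Finset.sum_le_card_nsmul (Finset.range j) (fun y => inT I x y * (1 - dead y)) 1
    fun y hy => Nat.mul_le_mul
      (hI.tree_le x hx y ((Finset.mem_range.1 hy).trans_le hj)) (Nat.sub_le 1 _)
  simpa [nbrCount] using this

theorem nbrSum_le (hI : Admissible I X) (hx : x < inM I) {j : ℕ} (hj : j ≤ inM I) :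
    nbrSum I dead x j ≤ X := by
  have h1 := Finset.sum_le_card_nsmul (Finset.range j) (fun y => inT I x y * (1 - dead y) * y)
    (inM I) fun y hy => by
      have hy := (Finset.mem_range.1 hy).trans_le hj
      have := Nat.mul_le_mul (Nat.mul_le_mul (hI.tree_le x hx y hy) (Nat.sub_le 1 (dead y))) hy.le
      simpa using this
  have h2 : j * inM I ≤ inM I * inM I := Nat.mul_le_mul_right _ hj
  have h3 := hI.sq_le
  unfold nbrSum
  simp only [Finset.card_range, smul_eq_mul] at h1
  omega

theorem findLeaf_le (hI : Admissible I X) {w : ℕ × ℕ} (hw : w.1 ≤ X ∧ w.2 ≤ X) {j : ℕ}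
    (hj : j ≤ inM I) : (findLeaf I dead w j).1 ≤ X ∧ (findLeaf I dead w j).2 ≤ X := by
  have hMX : inM I ≤ X := hI.input_le 2
  induction j with
  | zero => exact hw
  | succ j ih =>
    simp only [findLeaf]
    split_ifs
    · exact ⟨by simp only; omega, nbrSum_le hI (by omega) le_rfl⟩
    · exact ih (by omega)

theorem runsIn_yLoop (hI : Admissible I X) (hx : x < inM I)
    (hB : (idle i x leaf par 0 0 0 dead ver tab).Bdd I X) :
    RunsIn yLoop ((idle i x leaf par 0 0 0 dead ver tab).toState I)
      (Mach.toState I { idle i x leaf par 0 0 0 dead ver tab with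
        y := inM I
        cnt := nbrCount I dead x (inM I)
        nbr := nbrSum I dead x (inM I) })
      (inM I * (stepTime X.size + 3 * stepTime X.size) + stepTime X.size) := by
  have hMX : inM I ≤ X := hI.input_le 2
  set F : ℕ → Mach := fun j => { idle i x leaf par 0 0 0 dead ver tab with
        y := j
        cnt := nbrCount I dead x j
        nbr := nbrSum I dead x j } with hF
  have hFB : ∀ j ≤ inM I, (F j).Bdd I X := fun j hj =>
    { hB with
      y := hj.trans hMX
      cnt := ((nbrCount_le hI hx hj).trans hj).trans hMX
      nbr := nbrSum_le hI hx hj }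
  have htest : ∀ j, (eM - rY).val ((F j).toState I) = inM I - j := fun j => by
    rw [Expr.val_sub, val_M hI]
    rfl
  have hcost : ∀ j ≤ inM I, (eM - rY).cost ((F j).toState I) + 1 ≤ stepTime X.size :=
    fun j hj => Expr.cost_le_stepTime (hFB j hj).bounded (by decide)
  have h0 : F 0 = idle i x leaf par 0 0 0 dead ver tab := by
    simp [hF, nbrCount, nbrSum, idle]
  rw [← h0]
  refine runsIn_loop (e := eM - rY) (p := yBody) (fun j => (F j).toState I) ?_ ?_
  · intro j hj
    have hb := hFB j hj.le
    have hb' := hFB (j + 1) hj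
    refine ⟨by rw [htest]; omega, hcost j hj.le, ?_⟩
    have r1 := hb.assign_cnt (e := rCnt + eT rX rY * (1 - eDead rY)) (w := (F (j + 1)).cnt) (by
      rw [Expr.val_add, Expr.val_mul, Expr.val_sub, Expr.val_one,
        val_T hI (val_rX (h := F j)) val_rY hx hj, val_dead (val_rY (h := F j))]
      change _ = nbrCount I dead x (j + 1)
      rw [nbrCount, Finset.sum_range_succ]
      rfl)
    set h1 : Mach := { F j with cnt := (F (j + 1)).cnt }
    have hb1 : h1.Bdd I X := { hb with cnt := hb'.cnt }
    have r2 := hb1.assign_nbr (e := rNbr + eT rX rY * (1 - eDead rY) * rY)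
      (w := (F (j + 1)).nbr) (by
      rw [Expr.val_add, Expr.val_mul, Expr.val_mul, Expr.val_sub, Expr.val_one,
        val_T hI (val_rX (h := h1)) val_rY hx hj, val_dead (val_rY (h := h1))]
      change _ = nbrSum I dead x (j + 1)
      rw [nbrSum, Finset.sum_range_succ]
      rfl)
    set h2 : Mach := { h1 with nbr := (F (j + 1)).nbr }
    have hb2 : h2.Bdd I X := { hb1 with nbr := hb'.nbr }
    have r3 := hb2.assign_y (e := rY + 1) (w := j + 1) (by
      rw [Expr.val_add, Expr.val_one]
      rfl)
    exact (r1.seq (r2.seq r3)).mono (by omega)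
  · exact ⟨by rw [htest]; omega, hcost _ le_rfl⟩

theorem runsIn_xBody (hI : Admissible I X) (hx : x < inM I)
    (hB : (idle i x leaf par 0 0 0 dead ver tab).Bdd I X) {l p : ℕ}
    (hl : (if leafTest I dead x ≠ 0 then (x, nbrSum I dead x (inM I)) else (leaf, par)) = (l, p)) :
    RunsIn xBody ((idle i x leaf par 0 0 0 dead ver tab).toState I)
      ((idle i (x + 1) l p 0 0 0 dead ver tab).toState I)
      (4 * inM I * stepTime X.size + 8 * stepTime X.size) := by
  have hMX : inM I ≤ X := hI.input_le 2
  have r1 := runsIn_yLoop hI hx hB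
  set h1 : Mach := { idle i x leaf par 0 0 0 dead ver tab with
        y := inM I
        cnt := nbrCount I dead x (inM I)
        nbr := nbrSum I dead x (inM I) } with hh1
  have hb1 : h1.Bdd I X :=
    { hB with
      y := hMX
      cnt := (nbrCount_le hI hx le_rfl).trans hMX
      nbr := nbrSum_le hI hx le_rfl }
  have hbx : x ≤ X := hx.le.trans hMX
  have htest : eLeafTest.val (h1.toState I) = leafTest I dead x := by
    simp only [eLeafTest, Expr.val_mul, Expr.val_sub, Expr.val_add, Expr.val_one, Expr.val_two,
      val_dead (val_rX (h := h1)), val_R hI]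
    rfl
  set h2 : Mach := { h1 with leaf := l, par := p } with hh2
  have r2 : RunsIn (.cond eLeafTest (.seq (.assign 6 rX) (.assign 7 rNbr)) .skip)
      (h1.toState I) (h2.toState I) (stepTime X.size + 2 * stepTime X.size) := by
    refine runsIn_cond hb1.bounded (by decide) ?_ ?_
    · intro ht
      rw [htest] at ht
      rw [if_pos ht, Prod.mk.injEq] at hl
      have s1 := hb1.assign_leaf (e := rX) (w := l) hl.1
      have hb1' : Mach.Bdd I X { h1 with leaf := l } := { hb1 with leaf := hl.1 ▸ hbx }
      have s2 := hb1'.assign_par (e := rNbr) (w := p) hl.2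
      exact (s1.seq s2).mono (by omega)
    · intro ht
      rw [htest] at ht
      rw [if_neg (by simpa using ht), Prod.mk.injEq] at hl
      have h12 : h2 = h1 := by
        rw [hh2, ← hl.1, ← hl.2]
        rfl
      rw [h12]
      exact ⟨1, by unfold stepTime; omega, Runs.skip _⟩
  have hlp : l ≤ X ∧ p ≤ X := by
    split_ifs at hl with ht
    · rw [Prod.mk.injEq] at hl
      exact ⟨hl.1 ▸ hbx, hl.2 ▸ nbrSum_le hI hx le_rfl⟩
    · rw [Prod.mk.injEq] at hl
      exact ⟨hl.1 ▸ hB.leaf, hl.2 ▸ hB.par⟩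
  have hb2 : h2.Bdd I X := { hb1 with leaf := hlp.1, par := hlp.2 }
  have r3 := hb2.assign_y (e := 0) (w := 0) (Expr.val_zero _)
  set h3 : Mach := { h2 with y := 0 }
  have hb3 : h3.Bdd I X := { hb2 with y := Nat.zero_le _ }
  have r4 := hb3.assign_cnt (e := 0) (w := 0) (Expr.val_zero _)
  set h4 : Mach := { h3 with cnt := 0 }
  have hb4 : h4.Bdd I X := { hb3 with cnt := Nat.zero_le _ }
  have r5 := hb4.assign_nbr (e := 0) (w := 0) (Expr.val_zero _)
  set h5 : Mach := { h4 with nbr := 0 }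
  have hb5 : h5.Bdd I X := { hb4 with nbr := Nat.zero_le _ }
  have r6 := hb5.assign_x (e := rX + 1) (w := x + 1) (by
    rw [Expr.val_add, Expr.val_one]
    rfl)
  refine RunsIn.mono (r1.seq (r2.seq (r3.seq (r4.seq (r5.seq r6))))) ?_
  have : inM I * (stepTime X.size + 3 * stepTime X.size) = 4 * inM I * stepTime X.size := by ring
  omega

theorem runsIn_xLoop (hI : Admissible I X)
    (hB : (idle i 0 leaf par 0 0 0 dead ver tab).Bdd I X) :
    RunsIn xLoop ((idle i 0 leaf par 0 0 0 dead ver tab).toState I)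
      ((idle i (inM I) (findLeaf I dead (leaf, par) (inM I)).1
        (findLeaf I dead (leaf, par) (inM I)).2 0 0 0 dead ver tab).toState I)
      (inM I * (stepTime X.size + (4 * inM I * stepTime X.size + 8 * stepTime X.size)) +
        stepTime X.size) := by
  have hMX : inM I ≤ X := hI.input_le 2
  set F : ℕ → Mach := fun j => idle i j (findLeaf I dead (leaf, par) j).1
        (findLeaf I dead (leaf, par) j).2 0 0 0 dead ver tab with hF
  have hFB : ∀ j ≤ inM I, (F j).Bdd I X := fun j hj =>
    have := findLeaf_le (dead := dead) hI (w := (leaf, par)) ⟨hB.leaf, hB.par⟩ hj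
    { hB with
      x := hj.trans hMX
      leaf := this.1
      par := this.2 }
  have htest : ∀ j, (eM - rX).val ((F j).toState I) = inM I - j := fun j => by
    rw [Expr.val_sub, val_M hI]
    rfl
  have hcost : ∀ j ≤ inM I, (eM - rX).cost ((F j).toState I) + 1 ≤ stepTime X.size :=
    fun j hj => Expr.cost_le_stepTime (hFB j hj).bounded (by decide)
  refine runsIn_loop (e := eM - rX) (p := xBody) (fun j => (F j).toState I) ?_ ?_
  · intro j hj
    exact ⟨by rw [htest]; omega, hcost j hj.le, runsIn_xBody hI hj (hFB j hj.le) rfl⟩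
  · exact ⟨by rw [htest]; omega, hcost _ le_rfl⟩

end Searching

/-! ### Execution of one pass of the main loop -/

section MainLoop

variable {I : List ℕ} {X : ℕ} {i leaf par l p : ℕ} {dead ver tab : ℕ → ℕ}

/-- The time of one pass of the main loop, where `Q` bounds the number of pairs of states. -/
def passTime (n m Q σ : ℕ) : ℕ :=
  m * (σ + (4 * m * σ + 8 * σ)) + n * (3 * σ) + Q * (σ + pairTime n σ) + 11 * σ

theorem runsIn_mainBody (hI : Admissible I X) (hleaf : leaf ≤ X) (hpar : par ≤ X)
    (hi : i < inM I) (hd : ∀ a, dead a ≤ 1) (hver : ∀ a, ver a ≤ inM I) (htab : ∀ a, tab a ≤ 1)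
    (hfind : findLeaf I dead (leaf, par) (inM I) = (l, p)) (hl : l < inM I) (hp : p < inM I)
    {Q : ℕ} (hQ : 4 * place I p l (inN I) ≤ Q) :
    RunsIn mainBody ((idle i 0 leaf par 0 0 0 dead ver tab).toState I)
      ((idle (i + 1) 0 l p 0 0 0 (Function.update dead l 1) (Function.update ver p (i + 1))
        (mergeTab I p l (i + 1) ver tab (4 * place I p l (inN I)))).toState I)
      (passTime (inN I) (inM I) Q (stepTime X.size)) := by
  have hNX : inN I ≤ X := hI.input_le 1
  have hMX : inM I ≤ X := hI.input_le 2
  have hX := hI.one_le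
  have hpl := place_le hI hp hl le_rfl
  have hlX := hl.le.trans hMX
  have hpX := hp.le.trans hMX
  have hiX := hi.le.trans hMX
  have h4X : 4 ≤ X := by
    have := hI.length_le
    have := hI.length_eq
    omega
  have hdX := fun a => (hd a).trans hX
  have hvX := fun a => (hver a).trans hMX
  have htX := fun a => (htab a).trans hX
  set tot := 4 * place I p l (inN I) with htot
  set T := mergeTab I p l (i + 1) ver tab tot with hT
  have hTX : ∀ a, T a ≤ X := fun a => (mergeTab_le htab _ a).trans hX
  have r1 := runsIn_xLoop hI (idle_bdd hI hiX (Nat.zero_le _) hleaf hpar (Nat.zero_le _)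
    (Nat.zero_le _) (Nat.zero_le _) hdX hvX htX)
  rw [hfind] at r1
  have r2 := (idle_bdd hI (x := inM I) (leaf := l) (par := p) (v := 0) (total := 0) (K := 0)
    hiX hMX hlX hpX (Nat.zero_le _) (Nat.zero_le _)
    (Nat.zero_le _) hdX hvX htX).assign_x (e := 0) (w := 0) (Expr.val_zero _)
  have r3 := (idle_bdd hI (x := 0) (leaf := l) (par := p) (v := 0) (total := 0) (K := 0)
    hiX (Nat.zero_le _) hlX hpX (Nat.zero_le _) (Nat.zero_le _)
    (Nat.zero_le _) hdX hvX htX).assign_total (e := 4) (w := 4) (Expr.val_four _)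
  have r4 := runsIn_totalLoop hI hp hl hi hd hver htab
  have r5 := (idle_bdd hI (x := 0) (leaf := l) (par := p) (v := inN I) (total := tot) (K := 0)
    hiX (Nat.zero_le _) hlX hpX hNX hpl
    (Nat.zero_le _) hdX hvX htX).assign_v (e := 0) (w := 0) (Expr.val_zero _)
  have r6 := runsIn_KLoop hI hp hl hi hpl hd hver htab
  have r7 := (idle_bdd hI (x := 0) (leaf := l) (par := p) (v := 0) (total := tot) (K := tot)
    hiX (Nat.zero_le _) hlX hpX (Nat.zero_le _) hpl hpl hdX hvX hTX).assign_K (e := 0) (w := 0)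
    (Expr.val_zero _)
  have r8 := (idle_bdd hI (x := 0) (leaf := l) (par := p) (v := 0) (total := tot) (K := 0)
    hiX (Nat.zero_le _) hlX hpX (Nat.zero_le _) hpl (Nat.zero_le _) hdX hvX hTX).assign_total
    (e := 0) (w := 0) (Expr.val_zero _)
  have hb8 := idle_bdd hI (x := 0) (leaf := l) (par := p) (v := 0) (total := 0) (K := 0)
    hiX (Nat.zero_le _) hlX hpX (Nat.zero_le _) (Nat.zero_le _) (Nat.zero_le _) hdX hvX hTX
  have r9 := hb8.store_dead (y := rLeaf) (e := 1) (y' := l) (w := 1) rfl (Expr.val_one _)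
  have hb9 := idle_bdd hI (x := 0) (leaf := l) (par := p) (v := 0) (total := 0) (K := 0)
    (dead := Function.update dead l 1)
    hiX (Nat.zero_le _) hlX hpX (Nat.zero_le _) (Nat.zero_le _) (Nat.zero_le _) (fun a => by
      rw [Function.update_apply]
      split_ifs
      exacts [hX, hdX a]) hvX hTX
  have r10 := hb9.store_ver (y := rPar) (e := rI + 1) (y' := p) (w := i + 1) rfl (by
    rw [Expr.val_add, Expr.val_one]
    rfl)
  have hb10 : Mach.Bdd I X (idle i 0 l p 0 0 0 (Function.update dead l 1)
      (Function.update ver p (i + 1)) T) := { hb9 with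
    ver := fun a => by
      change Function.update ver p (i + 1) a ≤ X
      rw [Function.update_apply]
      split_ifs
      exacts [Nat.le_trans hi hMX, hvX a] }
  have r11 := hb10.assign_i (e := rI + 1) (w := i + 1) (by
    rw [Expr.val_add, Expr.val_one]
    rfl)
  have r := r1.seq (r2.seq (r3.seq (r4.seq (r5.seq (r6.seq (r7.seq (r8.seq (r9.seq (r10.seq
    r11)))))))))
  refine RunsIn.mono r ?_
  have e1 := Nat.mul_le_mul_right (stepTime X.size + pairTime (inN I) (stepTime X.size)) hQ
  have e2 : stepTime X.size + 2 * stepTime X.size = 3 * stepTime X.size := by ring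
  rw [e2]
  unfold passTime
  omega

end MainLoop

end DCutProgram

/-! ### The encoding of an instance -/

section Encoding

theorem divNat_modNat_mk {a b : ℕ} (i : Fin a) (j : Fin b) (h : (i : ℕ) * b + j < a * b) :
    (⟨i * b + j, h⟩ : Fin (a * b)).divNat = i ∧ (⟨i * b + j, h⟩ : Fin (a * b)).modNat = j := by
  have hb : 0 < b := j.pos
  constructor
  · apply Fin.ext
    rw [Fin.coe_divNat]
    change (i * b + j : ℕ) / b = i
    rw [mul_comm, Nat.mul_add_div hb, Nat.div_eq_of_lt j.2, add_zero]
  · apply Fin.ext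
    rw [Fin.coe_modNat]
    change (i * b + j : ℕ) % b = j
    rw [Nat.mul_add_mod', Nat.mod_eq_of_lt j.2]

/-- Indexing the matrix by `Fin (a * b)` gives direct access to the entry at position `i * b + j`.
-/
theorem encodeRel_eq_ofFn {a b : ℕ} (R : Fin a → Fin b → Prop) [∀ i j, Decidable (R i j)] :
    encodeRel R = List.ofFn fun k : Fin (a * b) => if R k.divNat k.modNat then 1 else 0 := by
  rw [List.ofFn_mul]
  unfold encodeRel
  rw [List.flatMap_def, ← List.ofFn_eq_map]
  congr 2
  funext i
  rw [← List.ofFn_eq_map]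
  congr 1
  funext j
  have hlt := DCutProgram.mul_add_lt i.2 j.2
  obtain ⟨h1, h2⟩ := divNat_modNat_mk i j hlt
  rw [h1, h2]
  congr 1

theorem length_encodeRel {a b : ℕ} (R : Fin a → Fin b → Prop) :
    (encodeRel R).length = a * b := by
  classical
  rw [encodeRel_eq_ofFn, List.length_ofFn]

theorem getD_encodeRel {a b : ℕ} (R : Fin a → Fin b → Prop) [∀ i j, Decidable (R i j)]
    (i : Fin a) (j : Fin b) : (encodeRel R).getD (i * b + j) 0 = if R i j then 1 else 0 := by
  have hlt := DCutProgram.mul_add_lt i.2 j.2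
  obtain ⟨h1, h2⟩ := divNat_modNat_mk i j hlt
  rw [List.getD_eq_getElem _ _ (by rwa [length_encodeRel])]
  simp only [encodeRel_eq_ofFn, List.getElem_ofFn, h1, h2]

theorem le_one_of_mem_encodeRel {a b : ℕ} {R : Fin a → Fin b → Prop} {k : ℕ}
    (h : k ∈ encodeRel R) : k ≤ 1 := by
  classical
  rw [encodeRel_eq_ofFn, List.mem_ofFn] at h
  obtain ⟨j, rfl⟩ := h
  split_ifs <;> omega

open DCutProgram

variable {d n m : ℕ} {G : SimpleGraph (Fin n)} {D : TreeDecomposition G (Fin m)} {r : Fin m}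

@[simp] theorem inD_encodeInstance : inD (encodeInstance d G D r) = d := rfl
@[simp] theorem inN_encodeInstance : inN (encodeInstance d G D r) = n := rfl
@[simp] theorem inM_encodeInstance : inM (encodeInstance d G D r) = m := rfl

theorem length_encodeInstance :
    (encodeInstance d G D r).length = 4 + n * n + m * m + m * n := by
  simp only [encodeInstance, List.length_append, length_encodeRel, List.length_cons,
    List.length_nil]

theorem inG_encodeInstance [DecidableRel G.Adj] (u v : Fin n) :
    inG (encodeInstance d G D r) u v = if G.Adj u v then 1 else 0 := by
  have hlt := mul_add_lt u.2 v.2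
  rw [← getD_encodeRel G.Adj u v, inG, inN_encodeInstance, encodeInstance, List.append_assoc,
    List.append_assoc,
    List.getD_append_right _ _ _ _ (by
      simp only [List.length_cons, List.length_nil]; omega),
    List.getD_append _ _ _ _ (by
      rw [length_encodeRel]; simp only [List.length_cons, List.length_nil]; omega)]
  congr 1
  simp only [List.length_cons, List.length_nil]
  omega

theorem inT_encodeInstance [DecidableRel D.tree.Adj] (x y : Fin m) :
    inT (encodeInstance d G D r) x y = if D.tree.Adj x y then 1 else 0 := by
  have hlt := mul_add_lt x.2 y.2
  have hlen : ([d, n, m, (r : ℕ)] ++ encodeRel G.Adj).length = 4 + n * n := by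
    rw [List.length_append, length_encodeRel]
    rfl
  rw [← getD_encodeRel D.tree.Adj x y, inT, inN_encodeInstance, inM_encodeInstance, encodeInstance,
    List.append_assoc, List.getD_append_right _ _ _ _ (by rw [hlen]; omega),
    List.getD_append _ _ _ _ (by rw [length_encodeRel, hlen]; omega), hlen]
  congr 1
  omega

theorem inB_encodeInstance (x : Fin m) (v : Fin n) :
    inB (encodeInstance d G D r) x v = if v ∈ D.bag x then 1 else 0 := by
  have hlt := mul_add_lt x.2 v.2
  have hlen : ([d, n, m, (r : ℕ)] ++ encodeRel G.Adj ++ encodeRel D.tree.Adj).length =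
      4 + n * n + m * m := by
    rw [List.length_append, List.length_append, length_encodeRel, length_encodeRel]
    rfl
  rw [← getD_encodeRel (fun x v => v ∈ D.bag x) x v, inB, inN_encodeInstance, inM_encodeInstance,
    encodeInstance, List.getD_append_right _ _ _ _ (by rw [hlen]; omega), hlen]
  congr 1
  omega

theorem getD_encodeInstance_le {X : ℕ} (hX : d + n + m + 1 ≤ X) (a : ℕ) :
    (encodeInstance d G D r).getD a 0 ≤ X := by
  by_cases ha : a < (encodeInstance d G D r).length
  · rw [List.getD_eq_getElem _ _ ha]
    have hmem := List.getElem_mem ha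
    generalize (encodeInstance d G D r)[a] = k at hmem
    simp only [encodeInstance, List.mem_append, List.mem_cons, List.not_mem_nil, or_false] at hmem
    have := r.2
    rcases hmem with (((h | h | h | h) | h) | h) | h
    · omega
    · omega
    · omega
    · omega
    all_goals
      have := le_one_of_mem_encodeRel h
      omega
  · rw [List.getD_eq_default _ _ (by omega)]
    exact Nat.zero_le _

/-- A bound for all numbers that occur while the program runs. -/
def valueBound (d n m : ℕ) : ℕ :=
  4 + n * n + m * m + m * n + d + n + m + (4 * (d + n + 1)) ^ n +
    4 * (2 * (d + 1) * (d + 1)) ^ n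

theorem admissible_encodeInstance :
    Admissible (encodeInstance d G D r) (valueBound d n m) where
  length_eq := length_encodeInstance
  graph_le u hu v hv := by
    classical
    have h := inG_encodeInstance (d := d) (G := G) (D := D) (r := r) ⟨u, hu⟩ ⟨v, hv⟩
    dsimp only at h
    rw [h]
    split_ifs <;> omega
  tree_le x hx y hy := by
    classical
    have h := inT_encodeInstance (d := d) (G := G) (D := D) (r := r) ⟨x, hx⟩ ⟨y, hy⟩
    dsimp only at h
    rw [h]
    split_ifs <;> omega
  bag_le x hx v hv := by
    have h := inB_encodeInstance (d := d) (G := G) (D := D) (r := r) ⟨x, hx⟩ ⟨v, hv⟩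
    dsimp only at h
    rw [h]
    split_ifs <;> omega
  input_le := getD_encodeInstance_le (by unfold valueBound; omega)
  length_le := by
    rw [length_encodeInstance]
    unfold valueBound
    omega
  sq_le := by
    rw [inM_encodeInstance]
    unfold valueBound
    omega
  code_le := by
    rw [base, inN_encodeInstance, inD_encodeInstance]
    unfold valueBound
    omega
  pairs_le := by
    rw [inN_encodeInstance, inD_encodeInstance]
    unfold valueBound
    omega

end Encoding

namespace DCutProgram

/-! ### The tables of the program -/

section Cells

variable {I : List ℕ}

/-- The flag and the version are low digits with radices two and `m + 1`; the code above them may be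
arbitrary. -/
theorem cell_injective {t t' e e' c c' : ℕ} (ht : t ≤ inM I) (ht' : t' ≤ inM I) (he : e ≤ 1)
    (he' : e' ≤ 1) (h : cell I t e c = cell I t' e' c') : t = t' ∧ e = e' ∧ c = c' := by
  unfold cell at h
  have h1 : e = e' := by omega
  have h2 : c * (inM I + 1) + t = c' * (inM I + 1) + t' := by omega
  have h3 : t = t' := by
    have := congrArg (· % (inM I + 1)) h2
    simpa [Nat.mul_add_mod', Nat.mod_eq_of_lt (Nat.lt_succ_of_le ht),
      Nat.mod_eq_of_lt (Nat.lt_succ_of_le ht')] using this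
  subst h3
  exact ⟨rfl, h1, Nat.eq_of_mul_eq_mul_right (Nat.succ_pos _) (Nat.add_right_cancel h2)⟩

/-- Merging into a new table does not change the old tables. -/
theorem mergeTab_of_ne {p x t : ℕ} {ver tab : ℕ → ℕ} (ht : t ≤ inM I) {t' e c : ℕ}
    (ht' : t' ≤ inM I) (he : e ≤ 1) (hne : t' ≠ t) (J : ℕ) :
    mergeTab I p x t ver tab J (cell I t' e c) = tab (cell I t' e c) := by
  induction J with
  | zero => rfl
  | succ J ih =>
    rw [mergeTab]
    rw [Function.update_of_ne, ih]
    intro h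
    exact hne (cell_injective ht' ht he flagNew_le h).1

theorem flagRight_le {p x K : ℕ} (hK : K < 4 * place I p x (inN I)) :
    flagRight I p x K ≤ 1 := by
  have : K / place I p x (inN I) < 4 := Nat.div_lt_of_lt_mul (by rwa [mul_comm])
  unfold flagRight
  omega

/-- The old tables are read while the new one is being written. Differing versions keep them apart,
so the half-finished merge cannot influence its own tests. -/
theorem accepts_mergeTab {p x t : ℕ} {ver tab : ℕ → ℕ} (ht : t ≤ inM I) {t' e c : ℕ}
    (ht' : t' ≤ inM I) (he : e ≤ 1) (hne : t' ≠ t) (J : ℕ) :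
    accepts I (mergeTab I p x t ver tab J) t' e c = accepts I tab t' e c := by
  unfold accepts
  rw [mergeTab_of_ne ht ht' he hne]

/-- The new table contains the states that arise from accepted compatible pairs. -/
theorem mergeTab_ne_zero_iff {p x t : ℕ} {ver tab : ℕ → ℕ} (ht : t ≤ inM I)
    (hp : ver p < t) (hx : ver x < t) (hnew : ∀ e ≤ 1, ∀ c, tab (cell I t e c) = 0) {J : ℕ}
    (hJ : J ≤ 4 * place I p x (inN I)) {e c : ℕ} (he : e ≤ 1) :
    mergeTab I p x t ver tab J (cell I t e c) ≠ 0 ↔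
      ∃ K < J, okProd I p x K (inN I) ≠ 0 ∧
        accepts I tab (ver p) (flagLeft I p x K) (codeLeft I p x K) ≠ 0 ∧
        accepts I tab (ver x) (flagRight I p x K) (codeRight I p x K) ≠ 0 ∧
        flagNew I p x K = e ∧ codeNew I p x K = c := by
  induction J with
  | zero => simp [mergeTab, hnew e he c]
  | succ J ih =>
    have hfr := flagRight_le (I := I) (p := p) (x := x) (K := J) (by omega)
    have ih := ih (by omega)
    rw [mergeTab]
    rw [accepts_mergeTab ht (by omega) flagLeft_le (by omega),
      accepts_mergeTab ht (by omega) hfr (by omega)]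
    by_cases hcell : cell I t e c = cell I t (flagNew I p x J) (codeNew I p x J)
    · obtain ⟨-, h1, h2⟩ := cell_injective ht ht he flagNew_le hcell
      rw [hcell, Function.update_self, ← hcell]
      have hsub : ∀ k l : ℕ, 1 - (1 - (k + l)) ≠ 0 ↔ k ≠ 0 ∨ l ≠ 0 := by omega
      rw [hsub, ih, mul_ne_zero_iff,
        mul_ne_zero_iff]
      constructor
      · rintro (⟨K, hK, h⟩ | ⟨⟨h3, h4⟩, h5⟩)
        · exact ⟨K, by omega, h⟩
        · exact ⟨J, by omega, h3, h4, h5, h1.symm, h2.symm⟩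
      · rintro ⟨K, hK, h⟩
        rcases Nat.lt_succ_iff_lt_or_eq.1 hK with hK | rfl
        · exact Or.inl ⟨K, hK, h⟩
        · exact Or.inr ⟨⟨h.1, h.2.1⟩, h.2.2.1⟩
    · rw [Function.update_of_ne hcell, ih]
      constructor
      · rintro ⟨K, hK, h⟩
        exact ⟨K, by omega, h⟩
      · rintro ⟨K, hK, h⟩
        rcases Nat.lt_succ_iff_lt_or_eq.1 hK with hK | rfl
        · exact ⟨K, hK, h⟩
        · exact absurd (by rw [h.2.2.2.1, h.2.2.2.2]) hcell

end Cells

/-- The input `I` describes the graph `G` and the tree `t` with the bags `B`. -/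
structure Describes (I : List ℕ) (d : ℕ) {n m : ℕ} (G : SimpleGraph (Fin n))
    (t : SimpleGraph (Fin m)) (B : Fin m → Finset (Fin n)) : Prop where
  inD_eq : inD I = d
  inN_eq : inN I = n
  inM_eq : inM I = m
  adj_eq : ∀ u v : Fin n, inG I u v = 0 ∧ ¬ G.Adj u v ∨ inG I u v = 1 ∧ G.Adj u v
  tree_eq : ∀ x y : Fin m, inT I x y = 0 ∧ ¬ t.Adj x y ∨ inT I x y = 1 ∧ t.Adj x y
  bag_eq : ∀ (x : Fin m) (v : Fin n), inB I x v = 0 ∧ v ∉ B x ∨ inB I x v = 1 ∧ v ∈ B x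

/-- The digit of `v` in the code of a bag state. -/
def stateDigit {n : ℕ} (c a : Fin n → ℕ) (v : ℕ) : ℕ :=
  if h : v < n then c ⟨v, h⟩ + 2 * a ⟨v, h⟩ else 0

/-- The code of a bag state. -/
def stateCode (I : List ℕ) {n : ℕ} (c a : Fin n → ℕ) : ℕ :=
  horner (base I) (stateDigit c a) n

/-- The bag states in the table of a node. -/
def tableOf (I : List ℕ) (m n : ℕ) (ver tab : ℕ → ℕ) (y : Fin m) (e : ℕ) (c a : Fin n → ℕ) : Prop :=
  accepts I tab (ver y) e (stateCode I c a) ≠ 0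

section Merge

variable {I : List ℕ} {d n m : ℕ} {G : SimpleGraph (Fin n)} {t : SimpleGraph (Fin m)}
  {B : Fin m → Finset (Fin n)} {p x : Fin m} {K : ℕ}

theorem stateDigit_coe (c a : Fin n → ℕ) (v : Fin n) : stateDigit c a v = c v + 2 * a v :=
  dif_pos v.2

variable (hI : Describes I d G t B)
include hI

/-- A product of 0/1 entries is the indicator of a conjunction, and for colours at most one the two
truncated differences indicate inequality. -/
theorem Describes.oppSum_eq (v : Fin n) :
    oppSum I p x K v (inN I) =
      oppDeg G (NewPair (B p) (B x)) (fun u => dColor I p x K u) v := by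
  rw [hI.inN_eq, oppSum, Finset.sum_range, oppDeg]
  refine Finset.sum_congr rfl fun u _ => ?_
  have hu := dColor_le (I := I) (p := p) (x := x) (K := K) u
  have hv := dColor_le (I := I) (p := p) (x := x) (K := K) v
  unfold oppTerm NewPair
  split_ifs with h
  · obtain ⟨⟨h1, h2, h3⟩, h4, h5⟩ := h
    have e1 : inG I v u = 1 := by
      rcases hI.adj_eq v u with h | h
      exacts [absurd h4 h.2, h.1]
    have e2 : inB I x v = 1 := by
      rcases hI.bag_eq x v with h | h
      exacts [absurd h1 h.2, h.1]
    have e3 : inB I x u = 1 := by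
      rcases hI.bag_eq x u with h | h
      exacts [absurd h2 h.2, h.1]
    have e4 : inB I p v * inB I p u = 0 := by
      rcases hI.bag_eq p v with h | h
      · rw [h.1, zero_mul]
      · rcases hI.bag_eq p u with h' | h'
        · rw [h'.1, mul_zero]
        · exact absurd ⟨h.2, h'.2⟩ h3
    rw [e1, e2, e3, e4]
    omega
  · rcases hI.adj_eq v u with h1 | h1
    · rw [h1.1]
      simp
    rcases hI.bag_eq x v with h2 | h2
    · rw [h2.1]
      simp
    rcases hI.bag_eq x u with h3 | h3
    · rw [h3.1]
      simp
    by_cases h4 : v ∈ B p ∧ u ∈ B p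
    · have e1 : inB I p v = 1 := by
        rcases hI.bag_eq p v with h | h
        exacts [absurd h4.1 h.2, h.1]
      have e2 : inB I p u = 1 := by
        rcases hI.bag_eq p u with h | h
        exacts [absurd h4.2 h.2, h.1]
      rw [e1, e2]
      simp
    · have h5 : dColor I p x K u = dColor I p x K v := by
        by_contra h5
        exact h ⟨⟨h2.2, h3.2, h4⟩, h1.2, h5⟩
      rw [h5]
      simp

theorem Describes.newCount_eq (v : Fin n) :
    newCount I p x K v = mergedCount G (B p) (B x) (fun u => dColor I p x K u)
      (fun u => dLeft I p x K u) (fun u => dRight I p x K u) v := by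
  rw [newCount, hI.oppSum_eq, mergedCount]

theorem Describes.inB_mul (y : Fin m) (f : Fin n → ℕ) (v : Fin n) :
    inB I y v * f v = restr (B y) f v := by
  rcases hI.bag_eq y v with h | h
  · rw [h.1, zero_mul, restr_of_notMem h.2]
  · rw [h.1, one_mul, restr_of_mem h.2]

theorem Describes.codeLeft_eq :
    codeLeft I p x K = stateCode I (restr (B p) fun u => dColor I p x K u)
      (fun u => dLeft I p x K u) := by
  rw [codeLeft, stateCode, hI.inN_eq]
  refine horner_congr fun v hv => ?_
  have h := hI.inB_mul p (fun u => dColor I p x K u) ⟨v, hv⟩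
  have h' := stateDigit_coe (restr (B p) fun u => dColor I p x K u) (fun u => dLeft I p x K u) ⟨v, hv⟩
  dsimp only at h h'
  rw [digitLeft, h, h']

theorem Describes.codeRight_eq :
    codeRight I p x K = stateCode I (restr (B x) fun u => dColor I p x K u)
      (fun u => dRight I p x K u) := by
  rw [codeRight, stateCode, hI.inN_eq]
  refine horner_congr fun v hv => ?_
  have h := hI.inB_mul x (fun u => dColor I p x K u) ⟨v, hv⟩
  have h' := stateDigit_coe (restr (B x) fun u => dColor I p x K u) (fun u => dRight I p x K u) ⟨v, hv⟩
  dsimp only at h h'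
  rw [digitRight, h, h']

theorem Describes.codeNew_eq :
    codeNew I p x K = stateCode I (restr (B p) fun u => dColor I p x K u)
      (restr (B p) fun u => newCount I p x K u) := by
  rw [codeNew, stateCode, hI.inN_eq]
  refine horner_congr fun v hv => ?_
  have h1 := hI.inB_mul p (fun u => dColor I p x K u) ⟨v, hv⟩
  have h2 := hI.inB_mul p (fun u => newCount I p x K u) ⟨v, hv⟩
  have h' := stateDigit_coe (restr (B p) fun u => dColor I p x K u)
    (restr (B p) fun u => newCount I p x K u) ⟨v, hv⟩
  dsimp only at h1 h2 h'
  rw [digitNew, h', ← h1, ← h2]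
  ring

/-- A digit `c + 2 * a` with `c ≤ 1` determines `c` by parity and then `a`; validity keeps all
digits below the base. -/
theorem Describes.stateCode_injective {e e' : ℕ} {c c' a a' : Fin n → ℕ} {b b' : Finset (Fin n)}
    (h : ValidState d b e c a) (h' : ValidState d b' e' c' a')
    (heq : stateCode I c a = stateCode I c' a') : c = c' ∧ a = a' := by
  have hlt : ∀ {e : ℕ} {c a : Fin n → ℕ} {b : Finset (Fin n)}, ValidState d b e c a →
      ∀ v < n, stateDigit c a v < base I := by
    intro e c a b h v hv
    have h0 := stateDigit_coe c a ⟨v, hv⟩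
    have h1 := h.color_le ⟨v, hv⟩
    have h2 := h.count_le ⟨v, hv⟩
    dsimp only at h0
    rw [h0, base, hI.inD_eq]
    omega
  have key := horner_injective (hlt h) (hlt h') heq
  constructor
  all_goals
    funext v
    have h1 := key v v.2
    rw [stateDigit_coe, stateDigit_coe] at h1
    have h2 := h.color_le v
    have h3 := h'.color_le v
    omega

/-- Radix one means no choice: vertices outside the bags do not increase the number of pairs,
although the counter has a digit for every vertex. -/
theorem Describes.colorRadix_of_notMem {v : Fin n} (hp : v ∉ B p) (hx : v ∉ B x) :
    colorRadix I p x v = 1 := by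
  unfold colorRadix
  rcases hI.bag_eq p v with h | h
  · rcases hI.bag_eq x v with h' | h'
    · rw [h.1, h'.1]
    · exact absurd h'.2 hx
  · exact absurd h.2 hp

theorem Describes.colorRadix_of_mem {v : Fin n} (h : v ∈ B p ∪ B x) :
    colorRadix I p x v = 2 := by
  unfold colorRadix
  rw [Finset.mem_union] at h
  rcases hI.bag_eq p v with h1 | h1
  · rcases hI.bag_eq x v with h2 | h2
    · tauto
    · rw [h2.1]
      simp
  · rw [h1.1]
    simp

theorem Describes.countRadix_of_notMem {v : Fin n} (hp : v ∉ B p) : countRadix I p v = 1 := by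
  unfold countRadix
  rcases hI.bag_eq p v with h | h
  · rw [h.1, zero_mul, add_zero]
  · exact absurd h.2 hp

theorem Describes.countRadix_of_mem {v : Fin n} (hp : v ∈ B p) : countRadix I p v = d + 1 := by
  unfold countRadix
  rcases hI.bag_eq p v with h | h
  · exact absurd hp h.2
  · rw [h.1, hI.inD_eq, one_mul, add_comm]

theorem Describes.countRadix_le' (p : Fin m) (v : Fin n) : countRadix I p v ≤ d + 1 := by
  by_cases h : v ∈ B p
  · exact (hI.countRadix_of_mem h).le
  · rw [hI.countRadix_of_notMem h]
    omega

/-- A decoded pair of states satisfying the tests is compatible. -/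
theorem Describes.compatible (hn : 0 < n) (hK : K < 4 * place I p x (inN I))
    (hok : okProd I p x K (inN I) ≠ 0) :
    Compatible G d ⟨0, hn⟩ (B p) (B x) (flagLeft I p x K) (flagRight I p x K)
      (fun u => dColor I p x K u) (fun u => dLeft I p x K u) (fun u => dRight I p x K u) := by
  have hok' : ∀ v : Fin n, okTerm I p x K v ≠ 0 := fun v =>
    Finset.prod_ne_zero_iff.1 hok v (by rw [hI.inN_eq]; exact Finset.mem_range.2 v.2)
  have hl : ∀ v : Fin n, dLeft I p x K v < countRadix I p v :=
    fun v => Nat.mod_lt _ (countRadix_pos v)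
  have hr : ∀ v : Fin n, dRight I p x K v < countRadix I x v :=
    fun v => Nat.mod_lt _ (countRadix_pos v)
  exact
    { flag_left := flagLeft_le
      flag_right := flagRight_le hK
      color_le := fun v => dColor_le _
      color_eq := fun v hp hx => by
        have h1 : dColor I p x K v < colorRadix I p x v := Nat.mod_lt _ (colorRadix_pos _)
        rw [hI.colorRadix_of_notMem hp hx] at h1
        omega
      left_le := fun v => by
        have h1 := hl v
        have h2 := hI.countRadix_le' p v
        omega
      left_eq := fun v hv => by
        have h1 := hl v
        rw [hI.countRadix_of_notMem hv] at h1
        omega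
      right_le := fun v => by
        have h1 := hr v
        have h2 := hI.countRadix_le' x v
        omega
      right_eq := fun v hv => by
        have h1 := hr v
        rw [hI.countRadix_of_notMem hv] at h1
        omega
      color_base := by
        have h1 := (mul_ne_zero_iff.1 (hok' ⟨0, hn⟩)).2
        dsimp only at h1 ⊢
        omega
      count_le := fun v => by
        have h1 := (mul_ne_zero_iff.1 (hok' v)).1
        rw [hI.newCount_eq, hI.inD_eq] at h1
        omega }

/-- Every compatible pair of states is decoded from some number. -/
theorem Describes.exists_decode {v₀ : Fin n} {ep ex : ℕ} {c a b : Fin n → ℕ}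
    (h : Compatible G d v₀ (B p) (B x) ep ex c a b) :
    ∃ K < 4 * place I p x (inN I), flagLeft I p x K = ep ∧ flagRight I p x K = ex ∧
      (∀ v : Fin n, dColor I p x K v = c v) ∧ (∀ v : Fin n, dLeft I p x K v = a v) ∧
      ∀ v : Fin n, dRight I p x K v = b v := by
  -- The colour is the lowest component, then the count at `p`, then the count at `x`, in the order
  -- in which the decoding strips them.
  set δ : ℕ → ℕ := fun v => if hv : v < n then
    c ⟨v, hv⟩ + colorRadix I p x v * (a ⟨v, hv⟩ + countRadix I p v * b ⟨v, hv⟩) else 0 with hδ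
  have hc : ∀ v : Fin n, c v < colorRadix I p x v := fun v => by
    by_cases hv : v ∈ B p ∪ B x
    · rw [hI.colorRadix_of_mem hv]
      have := h.color_le v
      omega
    · rw [Finset.mem_union, not_or] at hv
      rw [hI.colorRadix_of_notMem hv.1 hv.2, h.color_eq v hv.1 hv.2]
      omega
  have ha : ∀ v : Fin n, a v < countRadix I p v := fun v => by
    by_cases hv : v ∈ B p
    · rw [hI.countRadix_of_mem hv]
      have := h.left_le v
      omega
    · rw [hI.countRadix_of_notMem hv, h.left_eq v hv]
      omega
  have hb : ∀ v : Fin n, b v < countRadix I x v := fun v => by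
    by_cases hv : v ∈ B x
    · rw [hI.countRadix_of_mem hv]
      have := h.right_le v
      omega
    · rw [hI.countRadix_of_notMem hv, h.right_eq v hv]
      omega
  have hδv : ∀ v : Fin n, δ v =
      c v + colorRadix I p x v * (a v + countRadix I p v * b v) := fun v => dif_pos v.2
  have hδlt : ∀ v < n, δ v < radix I p x v := fun v hv => by
    have h1 := hc ⟨v, hv⟩
    have h2 := ha ⟨v, hv⟩
    have h3 := hb ⟨v, hv⟩
    have h0 := hδv ⟨v, hv⟩
    dsimp only at h0 h1 h2 h3
    rw [h0, radix, mul_assoc]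
    generalize c ⟨v, hv⟩ = c', a ⟨v, hv⟩ = a', b ⟨v, hv⟩ = b' at *
    have h4 : a' + countRadix I p v * b' < countRadix I p v * countRadix I x v := by
      have := mul_add_lt h3 h2
      rw [mul_comm b', mul_comm (countRadix I x v)] at this
      omega
    have := mul_add_lt h4 h1
    rw [mul_comm (a' + _), mul_comm (_ * _) (colorRadix I p x v)] at this
    omega
  have hep := h.flag_left
  have hex := h.flag_right
  -- Both flags sit above all vertex digits as a number below four, the flag of `p` in its low bit.
  obtain ⟨K, hK, hd, hq⟩ := exists_mixed_radix (radix I p x) δ n 4 (ep + 2 * ex) hδlt (by omega)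
  have hdig : ∀ v : Fin n, dColor I p x K v = c v ∧ dLeft I p x K v = a v ∧
      dRight I p x K v = b v := fun v => by
    have := hd v v.2
    rw [hδv] at this
    exact mixed_radix_three (hc v) (ha v) (hb v) this
  have hq' : K / place I p x n = ep + 2 * ex := hq
  refine ⟨K, ?_, ?_, ?_, fun v => (hdig v).1, fun v => (hdig v).2.1, fun v => (hdig v).2.2⟩
  · rw [mul_comm, hI.inN_eq]
    exact hK
  · rw [flagLeft, hI.inN_eq, hq']
    omega
  · rw [flagRight, hI.inN_eq, hq']
    omega

/-- The program merges tables correctly. -/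
theorem Describes.tableOf_merge (hn : 0 < n) {i : ℕ} (hi : i < m) {ver tab : ℕ → ℕ}
    (hvp : ver p ≤ i) (hvx : ver x ≤ i) (hnew : ∀ e ≤ 1, ∀ c, tab (cell I (i + 1) e c) = 0)
    {e : ℕ} {c a : Fin n → ℕ} (hval : ValidState d (B p) e c a) :
    tableOf I m n (Function.update ver p (i + 1))
      (mergeTab I p x (i + 1) ver tab (4 * place I p x (inN I))) p e c a ↔
      Merge G d ⟨0, hn⟩ (B p) (B x) (tableOf I m n ver tab p) (tableOf I m n ver tab x) e c a := by
  have ht : i + 1 ≤ inM I := by rw [hI.inM_eq]; omega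
  unfold tableOf
  -- The implicit initial table belongs to version zero. The version `i + 1` is positive, so only
  -- stored entries count.
  rw [Function.update_self, accepts, show 1 - (i + 1) = 0 by omega, zero_mul, zero_add,
    mergeTab_ne_zero_iff ht (by omega) (by omega) hnew le_rfl hval.flag_le]
  have hflag : ∀ K : ℕ, flagNew I p x K =
      min 1 (flagLeft I p x K + flagRight I p x K + ∑ v : Fin n, dColor I p x K v) := fun K => by
    rw [flagNew, colSum, hI.inN_eq, Finset.sum_range]
    omega
  constructor
  · rintro ⟨K, hK, hok, hp, hx, he, hc⟩
    have hcomp := hI.compatible hn hK hok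
    rw [hI.codeLeft_eq] at hp
    rw [hI.codeRight_eq] at hx
    rw [hI.codeNew_eq] at hc
    have hval' : ValidState d (B p) e (restr (B p) fun u => dColor I p x K u)
        (restr (B p) fun u => newCount I p x K u) :=
      { flag_le := hval.flag_le
        color_le := fun v => (restr_le _ _ _).trans (hcomp.color_le v)
        color_eq := fun v hv => restr_of_notMem hv
        count_le := fun v => (restr_le _ _ _).trans (by
          rw [hI.newCount_eq]
          exact hcomp.count_le v)
        count_eq := fun v hv => restr_of_notMem hv }
    -- The table knows codes only. The tests bound the merged counts by `d`, so both states are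
    -- valid and equal codes give equal states.
    obtain ⟨h1, h2⟩ := hI.stateCode_injective hval hval' hc.symm
    refine ⟨_, _, _, _, _, hcomp, hp, hx, ?_, h1, ?_⟩
    · rw [← he, hflag]
    · rw [h2]
      exact restr_congr fun v _ => hI.newCount_eq v
  · rintro ⟨ep, ex, c', a', b', hcomp, hp, hx, he, hc, ha⟩
    obtain ⟨K, hK, h1, h2, h3, h4, h5⟩ := hI.exists_decode hcomp
    have e3 : (fun u : Fin n => dColor I p x K u) = c' := funext h3
    have e4 : (fun u : Fin n => dLeft I p x K u) = a' := funext h4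
    have e5 : (fun u : Fin n => dRight I p x K u) = b' := funext h5
    have e6 : (fun u : Fin n => newCount I p x K u) = mergedCount G (B p) (B x) c' a' b' := by
      funext v
      rw [hI.newCount_eq, e3, e4, e5]
    refine ⟨K, hK, ?_, ?_, ?_, ?_, ?_⟩
    · refine Finset.prod_ne_zero_iff.2 fun v hv => ?_
      rw [hI.inN_eq, Finset.mem_range] at hv
      have h6 := congrFun e6 ⟨v, hv⟩
      have h7 := hcomp.count_le ⟨v, hv⟩
      have h8 := h3 ⟨v, hv⟩
      rw [okTerm, hI.inD_eq, h6, h8]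
      refine mul_ne_zero (by omega) ?_
      have h9 := hcomp.color_base
      rcases Nat.eq_zero_or_pos v with rfl | hv0
      · rw [h9]
        simp
      · rw [show 1 - v = 0 by omega]
        simp
    · rw [hI.codeLeft_eq, e3, e4, h1]
      exact hp
    · rw [hI.codeRight_eq, e3, e5, h2]
      exact hx
    · rw [hflag, h1, h2, he, ← e3]
    · rw [hI.codeNew_eq, e3, e6, ← hc, ← ha]

end Merge

end DCutProgram

namespace DCutProgram

open RAM

/-! ### Correctness -/

/-- The nodes that have not been merged. -/
def remaining (m : ℕ) (dead : ℕ → ℕ) : Finset (Fin m) :=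
  Finset.univ.filter fun y => dead y = 0

theorem mem_remaining {m : ℕ} {dead : ℕ → ℕ} {y : Fin m} : y ∈ remaining m dead ↔ dead y = 0 := by
  simp [remaining]

theorem remaining_update {m : ℕ} {dead : ℕ → ℕ} (x : Fin m) :
    remaining m (Function.update dead x 1) = (remaining m dead).erase x := by
  ext y
  rw [Finset.mem_erase, mem_remaining, mem_remaining, Function.update_apply]
  by_cases h : y = x
  · simp [h]
  · rw [if_neg (Fin.val_ne_of_ne h)]
    exact (and_iff_right h).symm

theorem exists_findLeaf {I : List ℕ} {dead : ℕ → ℕ} (w : ℕ × ℕ) {j : ℕ}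
    (h : ∃ x < j, leafTest I dead x ≠ 0) :
    ∃ x < j, leafTest I dead x ≠ 0 ∧ findLeaf I dead w j = (x, nbrSum I dead x (inM I)) := by
  induction j with
  | zero => obtain ⟨x, hx, -⟩ := h; omega
  | succ j ih =>
    by_cases hj : leafTest I dead j ≠ 0
    · exact ⟨j, by omega, hj, if_pos hj⟩
    · obtain ⟨x, hx, hxt⟩ := h
      rcases Nat.lt_succ_iff_lt_or_eq.1 hx with hx | rfl
      · obtain ⟨y, hy, hyt, he⟩ := ih ⟨x, hx, hxt⟩
        refine ⟨y, by omega, hyt, ?_⟩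
        rw [findLeaf, if_neg hj, he]
      · exact absurd hxt hj

section Correctness

variable {I : List ℕ} {d n m : ℕ} {G : SimpleGraph (Fin n)} {t : SimpleGraph (Fin m)}
  {B : Fin m → Finset (Fin n)} {dead : ℕ → ℕ}

theorem Describes.nbr_term (hI : Describes I d G t B) [DecidableRel t.Adj] (x y : Fin m) :
    inT I x y * (1 - dead y) = if t.Adj x y ∧ y ∈ remaining m dead then 1 else 0 := by
  simp only [mem_remaining]
  rcases hI.tree_eq x y with h | h
  · rw [h.1, if_neg fun h' => h.2 h'.1, zero_mul]
  · rw [h.1, one_mul]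
    split_ifs with h1
    · rw [h1.2]
    · have : dead y ≠ 0 := fun h0 => h1 ⟨h.2, h0⟩
      omega

theorem Describes.leafTest_ne_zero_iff (hI : Describes I d G t B) {r : Fin m} (hr : inR I = r)
    (x : Fin m) :
    leafTest I dead x ≠ 0 ↔ x ∈ remaining m dead ∧ x ≠ r ∧ ∃ p ∈ remaining m dead, t.Adj x p ∧
      (∀ q ∈ remaining m dead, t.Adj x q → q = p) ∧ nbrSum I dead x (inM I) = p := by
  classical
  set F := Finset.univ.filter fun y => t.Adj x y ∧ y ∈ remaining m dead with hF
  have hcnt : nbrCount I dead x (inM I) = F.card := by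
    rw [nbrCount, hI.inM_eq, Finset.sum_range, Finset.card_filter]
    exact Finset.sum_congr rfl fun y _ => hI.nbr_term x y
  have hsum : nbrSum I dead x (inM I) = ∑ y ∈ F, (y : ℕ) := by
    rw [nbrSum, hI.inM_eq, Finset.sum_range, Finset.sum_filter]
    refine Finset.sum_congr rfl fun y _ => ?_
    rw [hI.nbr_term x y]
    split_ifs <;> simp
  have hone : nbrCount I dead x (inM I) * (2 - nbrCount I dead x (inM I)) ≠ 0 ↔ F.card = 1 := by
    rw [hcnt, mul_ne_zero_iff]
    omega
  have hroot : (x : ℕ) - inR I + (inR I - x) ≠ 0 ↔ x ≠ r := by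
    rw [hr, ne_eq x, Fin.ext_iff]
    omega
  have hdead : 1 - dead x ≠ 0 ↔ x ∈ remaining m dead := by
    rw [mem_remaining]
    omega
  rw [leafTest, mul_ne_zero_iff, mul_ne_zero_iff, hone, hroot, hdead, and_assoc]
  refine and_congr_right fun _ => and_congr_right fun _ => ?_
  rw [Finset.card_eq_one, hsum]
  constructor
  · rintro ⟨p, hp⟩
    have hmem : ∀ y, t.Adj x y ∧ y ∈ remaining m dead ↔ y = p := fun y => by
      rw [← Finset.mem_singleton, ← hp, hF, Finset.mem_filter]
      simp
    obtain ⟨h1, h2⟩ := (hmem p).2 rfl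
    refine ⟨p, h2, h1, fun q hq hxq => (hmem q).1 ⟨hxq, hq⟩, ?_⟩
    rw [hp, Finset.sum_singleton]
  · rintro ⟨p, hp, hxp, huniq, -⟩
    refine ⟨p, ?_⟩
    ext q
    rw [hF, Finset.mem_filter, Finset.mem_singleton]
    constructor
    · rintro ⟨-, h1, h2⟩
      exact huniq q h2 h1
    · rintro rfl
      exact ⟨Finset.mem_univ _, hxp, hp⟩

variable (I d G t B) in
/-- What holds after `i` nodes have been merged. -/
structure Progress (X : ℕ) (hn : 0 < n) (r : Fin m) (i leaf par : ℕ) (dead ver tab : ℕ → ℕ) :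
    Prop where
  leaf_le : leaf ≤ X
  par_le : par ≤ X
  dead_le : ∀ a, dead a ≤ 1
  ver_le : ∀ a, ver a ≤ i
  tab_le : ∀ a, tab a ≤ 1
  tab_new : ∀ s, i < s → s ≤ m → ∀ e ≤ 1, ∀ c, tab (cell I s e c) = 0
  root_mem : r ∈ remaining m dead
  card_eq : (remaining m dead).card + i = m
  decomposes : DecomposesOn G t B (remaining m dead)
  solvable : Solvable G d ⟨0, hn⟩ B (remaining m dead) (tableOf I m n ver tab) ↔ HasDCut G d

/-- One more node is merged. -/
theorem Progress.step {X : ℕ} (hA : Admissible I X) (hI : Describes I d G t B) (ht : t.IsAcyclic)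
    {hn : 0 < n} {r : Fin m} (hr : inR I = r) {i leaf par : ℕ} {ver tab : ℕ → ℕ}
    (h : Progress I d G t B X hn r i leaf par dead ver tab) (hi : i + 1 < m) :
    ∃ l p : Fin m, t.Adj l p ∧
      findLeaf I dead (leaf, par) (inM I) = ((l : ℕ), (p : ℕ)) ∧
      Progress I d G t B X hn r (i + 1) l p (Function.update dead l 1)
        (Function.update ver p (i + 1))
        (mergeTab I p l (i + 1) ver tab (4 * place I p l (inN I))) := by
  have hcard := h.card_eq
  have hmX : m ≤ X := by
    have := hA.input_le 2
    rwa [← hI.inM_eq]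
  have htest := fun x => hI.leafTest_ne_zero_iff (dead := dead) hr x
  obtain ⟨x, hx, hxr, p, hp, hxp, huniq⟩ := h.decomposes.linked.exists_leaf ht (by omega) r
  have hsum : nbrSum I dead x (inM I) = p := by
    classical
    rw [nbrSum, hI.inM_eq, Finset.sum_range, Finset.sum_eq_single p]
    · rw [hI.nbr_term x p, if_pos ⟨hxp, hp⟩, one_mul]
    · intro q _ hqp
      rw [hI.nbr_term x q, if_neg fun hq => hqp (huniq q hq.2 hq.1), zero_mul]
    · exact fun hp => absurd (Finset.mem_univ p) hp
  obtain ⟨l, hl, hlt, hfind⟩ := exists_findLeaf (I := I) (dead := dead) (leaf, par) (j := inM I)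
    ⟨x, by rw [hI.inM_eq]; exact x.2, (htest x).2 ⟨hx, hxr, p, hp, hxp, huniq, hsum⟩⟩
  rw [hI.inM_eq] at hl
  -- The search may return a leaf other than `x`; its neighbour and the uniqueness of that neighbour
  -- are read off the test it has passed.
  obtain ⟨hl1, hlr, p, hp, hlp, huniq, hsum⟩ := (htest ⟨l, hl⟩).1 hlt
  dsimp only at hsum
  rw [hsum] at hfind
  have hpl : p ≠ ⟨l, hl⟩ := hlp.ne.symm
  refine ⟨⟨l, hl⟩, p, hlp, hfind, ?_⟩
  have hnew : ∀ e ≤ 1, ∀ c, tab (cell I (i + 1) e c) = 0 := h.tab_new (i + 1) (by omega) hi.le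
  have hiM : i + 1 ≤ inM I := by rw [hI.inM_eq]; omega
  refine
    { leaf_le := hl.le.trans hmX
      par_le := p.2.le.trans hmX
      dead_le := fun a => ?_
      ver_le := fun a => ?_
      tab_le := mergeTab_le h.tab_le _
      tab_new := fun s hs hsm e he c => ?_
      root_mem := ?_
      card_eq := ?_
      decomposes := ?_
      solvable := ?_ }
  · rw [Function.update_apply]
    split_ifs
    exacts [le_rfl, h.dead_le a]
  · rw [Function.update_apply]
    split_ifs
    exacts [le_rfl, (h.ver_le a).trans (by omega)]
  · rw [mergeTab_of_ne hiM (by rw [hI.inM_eq]; exact hsm) he (by omega)]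
    exact h.tab_new s (by omega) hsm e he c
  · rw [remaining_update ⟨l, hl⟩]
    exact Finset.mem_erase.2 ⟨hlr.symm, h.root_mem⟩
  · rw [remaining_update ⟨l, hl⟩, Finset.card_erase_of_mem hl1]
    have := Finset.card_pos.2 ⟨_, hl1⟩
    omega
  · rw [remaining_update ⟨l, hl⟩]
    exact h.decomposes.erase hl1 hp hpl huniq
  · rw [remaining_update ⟨l, hl⟩, ← h.solvable]
    refine (h.decomposes.solvable_erase_iff hl1 hp hpl huniq ?_ ?_).symm
    · intro y hy hyl hyp e he c a
      have hyp' : (y : ℕ) ≠ p := fun h => hyp (Fin.ext h)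
      have hv := h.ver_le y
      unfold tableOf
      rw [Function.update_of_ne hyp', accepts_mergeTab hiM (by omega) he (by omega)]
    · intro e c a hval
      exact hI.tableOf_merge hn (by omega) (h.ver_le _) (h.ver_le _) hnew hval

/-- The time of the program, where `Q` bounds the number of pairs of states. -/
def totalTime (n m Q σ : ℕ) : ℕ :=
  m * (σ + passTime n m Q σ) + 2 * σ

theorem start_eq (I : List ℕ) :
    RAM.start I = (idle 0 0 0 0 0 0 0 (fun _ => 0) (fun _ => 0) (fun _ => 0)).toState I := by
  have e1 : (RAM.start I).reg =
      (idle 0 0 0 0 0 0 0 (fun _ => 0) (fun _ => 0) (fun _ => 0)).reg I.length := by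
    funext j
    change (if j = 0 then I.length else 0) = _
    split_ifs with hj
    · subst hj
      rfl
    · unfold Mach.reg
      split <;> simp_all [idle]
  have e2 : (RAM.start I).mem =
      (idle 0 0 0 0 0 0 0 (fun _ => 0) (fun _ => 0) (fun _ => 0)).mem I := by
    funext a
    change I.getD a 0 = _
    unfold Mach.mem
    split_ifs with h
    · rfl
    all_goals exact List.getD_eq_default _ _ (by omega)
  exact congrArg₂ State.mk e1 e2

/-- `Progress` is preserved by each of the `m - 1` passes, after which counting leaves the root
alone. The only colouring and counts of its empty bag have code zero, so the final assignment reads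
the entry with flag one and code zero in the root's current version. -/
theorem decidesWithin_program {X : ℕ} (hA : Admissible I X) (hI : Describes I d G t B)
    (ht : t.IsAcyclic) (hn : 0 < n) {r : Fin m} (hr : inR I = r) (hBr : B r = ∅)
    (hdec : DecomposesOn G t B Finset.univ)
    (hinit : ∀ T : Fin m → ℕ → (Fin n → ℕ) → (Fin n → ℕ) → Prop,
      (∀ x e c a, ValidState d (B x) e c a → (T x e c a ↔ e = 0)) →
      (Solvable G d ⟨0, hn⟩ B Finset.univ T ↔ HasDCut G d))
    {Q : ℕ} (hQ : ∀ x p : Fin m, t.Adj x p → 4 * place I p x (inN I) ≤ Q) :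
    DecidesWithin program I (HasDCut G d) (totalTime n m Q (stepTime X.size)) := by
  have hmX : m ≤ X := by
    have := hA.input_le 2
    rwa [← hI.inM_eq]
  have hm : 0 < m := r.pos
  have hX := hA.one_le
  have hall : remaining m (fun _ => 0) = Finset.univ := by simp [remaining]
  set Inv : ℕ → State → Prop := fun i s => ∃ leaf par dead ver tab,
    s = (idle i 0 leaf par 0 0 0 dead ver tab).toState I ∧
    Progress I d G t B X hn r i leaf par dead ver tab with hInv
  have hbdd : ∀ {i leaf par dead ver tab}, i < m →
      Progress I d G t B X hn r i leaf par dead ver tab →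
      (idle i 0 leaf par 0 0 0 dead ver tab).Bdd I X := fun hi h =>
    idle_bdd hA (by omega) (Nat.zero_le _) h.leaf_le h.par_le (Nat.zero_le _) (Nat.zero_le _)
      (Nat.zero_le _) (fun a => (h.dead_le a).trans hX)
      (fun a => ((h.ver_le a).trans (by omega)).trans hmX) (fun a => (h.tab_le a).trans hX)
  have htest : ∀ i leaf par dead ver tab, (eM - 1 - rI).val
      ((idle i 0 leaf par 0 0 0 dead ver tab).toState I) = m - 1 - i :=
    fun i leaf par dead ver tab => by
      rw [Expr.val_sub, Expr.val_sub, Expr.val_one, val_M hA, hI.inM_eq]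
      rfl
  have h0 : Inv 0 (RAM.start I) := by
    refine ⟨0, 0, fun _ => 0, fun _ => 0, fun _ => 0, start_eq I, ?_⟩
    refine
      { leaf_le := Nat.zero_le _
        par_le := Nat.zero_le _
        dead_le := fun _ => Nat.zero_le _
        ver_le := fun _ => le_rfl
        tab_le := fun _ => Nat.zero_le _
        tab_new := fun _ _ _ _ _ _ => rfl
        root_mem := mem_remaining.2 rfl
        card_eq := by rw [hall, Finset.card_univ, Fintype.card_fin, add_zero]
        decomposes := hall ▸ hdec
        solvable := ?_ }
    rw [hall]
    refine hinit _ fun x e c a hval => ?_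
    have he := hval.flag_le
    change (1 - 0) * (1 - e) + 0 ≠ 0 ↔ e = 0
    omega
  obtain ⟨s, hrun, leaf, par, dead, ver, tab, rfl, hfin⟩ :=
    runsIn_loop_of_invariant (e := eM - 1 - rI) (p := mainBody) Inv (N := m - 1)
      (C := stepTime X.size) (T := passTime n m Q (stepTime X.size)) (by
        rintro i hi s ⟨leaf, par, dead, ver, tab, rfl, h⟩
        refine ⟨by rw [htest]; omega,
          Expr.cost_le_stepTime (hbdd (by omega) h).bounded (by decide), ?_⟩
        obtain ⟨l, p, hlp, hfind, hstep⟩ := h.step hA hI ht hr (by omega)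
        have hrun := runsIn_mainBody (i := i) (Q := Q) hA h.leaf_le h.par_le (by rw [hI.inM_eq]; omega)
          h.dead_le
          (fun a => (h.ver_le a).trans (by rw [hI.inM_eq]; omega)) h.tab_le hfind
          (by rw [hI.inM_eq]; exact l.2) (by rw [hI.inM_eq]; exact p.2) (hQ l p hlp)
        rw [hI.inM_eq] at hrun
        have hn' : passTime (inN I) m Q (stepTime X.size) = passTime n m Q (stepTime X.size) := by
          rw [hI.inN_eq]
        rw [hn'] at hrun
        exact ⟨_, hrun, _, _, _, _, _, rfl, hstep⟩) (by
        rintro s ⟨leaf, par, dead, ver, tab, rfl, h⟩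
        exact ⟨by rw [htest]; omega,
          Expr.cost_le_stepTime (hbdd (by omega) h).bounded (by decide)⟩) h0
  set h := idle (m - 1) 0 leaf par 0 0 0 dead ver tab with hh
  have hb : h.Bdd I X := hbdd (by omega) hfin
  have hval : (eTab (eVer eR) 1 0).val (h.toState I) = tab (cell I (ver r) 1 0) := by
    rw [val_tab hA (val_ver ((val_R hA).trans hr)) (Expr.val_one _) (Expr.val_zero _)]
    rfl
  have hassign : RunsIn (.assign 0 (eTab (eVer eR) 1 0)) (h.toState I)
      { h.toState I with reg := Function.update (h.toState I).reg 0 (tab (cell I (ver r) 1 0)) }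
      (stepTime X.size) :=
    runsIn_assign hb.bounded (by decide) (by rw [hval])
  obtain ⟨τ, hτ, hruns⟩ := hrun.seq hassign
  refine ⟨_, τ, hruns, ?_, ?_⟩
  · have h1 : (m - 1) * (stepTime X.size + passTime n m Q (stepTime X.size)) ≤
        m * (stepTime X.size + passTime n m Q (stepTime X.size)) :=
      Nat.mul_le_mul_right _ (by omega)
    unfold totalTime
    omega
  · change Function.update (h.toState I).reg 0 (tab (cell I (ver r) 1 0)) 0 = _
    rw [Function.update_self]
    have hS : remaining m dead = {r} := by
      have h1 := hfin.card_eq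
      obtain ⟨r', hr'⟩ := Finset.card_eq_one.1 (show (remaining m dead).card = 1 by omega)
      have h2 := hfin.root_mem
      rw [hr', Finset.mem_singleton] at h2
      rw [hr', h2]
    have hsolv := hfin.solvable
    rw [hS, solvable_singleton_iff _ hBr] at hsolv
    have hcode : stateCode I (fun _ : Fin n => 0) (fun _ => 0) = 0 :=
      (horner_congr fun v hv => dif_pos hv).trans (horner_zero_fun (base I) n)
    rw [tableOf, hcode, accepts, Nat.sub_self, mul_zero, zero_add] at hsolv
    have hle := hfin.tab_le (cell I (ver r) 1 0)
    split_ifs with hcut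
    · have := hsolv.2 hcut
      omega
    · by_contra hne
      exact hcut (hsolv.1 hne)

end Correctness

end DCutProgram

/-! ### The running time -/

/-- A nice tree decomposition has a leaf node. -/
theorem TreeDecomposition.IsNice.exists_isLeafNode {V ι : Type*} [Finite ι] {G : SimpleGraph V}
    {D : TreeDecomposition G ι} {r : ι} (h : D.IsNice r) : ∃ x, D.IsLeafNode r x := by
  have : Nonempty ι := ⟨r⟩
  obtain ⟨x, hx⟩ := Finite.exists_max fun x => D.tree.dist r x
  have hc : D.children r x = ∅ := Set.eq_empty_of_forall_notMem fun y hy => by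
    have h1 := hx y
    have h2 := hy.2
    omega
  refine ⟨x, ?_⟩
  rcases h.2 x with h1 | ⟨y, hy, -⟩ | ⟨y, hy, -⟩ | ⟨y, z, -, hy, -⟩
  · exact h1
  all_goals
    rw [hc] at hy
    have : y ∈ (∅ : Set ι) := by simp [hy]
    exact absurd this (Set.notMem_empty y)

theorem RAM.DecidesWithin.mono {P : Program} {l : List ℕ} {A : Prop} {T T' : ℕ}
    (h : DecidesWithin P l A T) (hT : T ≤ T') : DecidesWithin P l A T' := by
  obtain ⟨s, t, hr, ht, hs⟩ := h
  exact ⟨s, t, hr, ht.trans hT, hs⟩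

theorem RAM.length_le_inputSize (l : List ℕ) : l.length ≤ inputSize l := by
  induction l with
  | nil => exact Nat.zero_le _
  | cons a l ih =>
    simp only [inputSize, List.map_cons, List.sum_cons, List.length_cons] at ih ⊢
    omega

namespace DCutProgram

open RAM

theorem describes_encodeInstance {d n m : ℕ} {G : SimpleGraph (Fin n)}
    {D : TreeDecomposition G (Fin m)} {r : Fin m} :
    Describes (encodeInstance d G D r) d G D.tree D.bag where
  inD_eq := rfl
  inN_eq := rfl
  inM_eq := rfl
  adj_eq u v := by
    classical
    rw [inG_encodeInstance]
    split_ifs with h <;> simp [h]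
  tree_eq x y := by
    classical
    rw [inT_encodeInstance]
    split_ifs with h <;> simp [h]
  bag_eq x v := by
    rw [inB_encodeInstance]
    split_ifs with h <;> simp [h]

/-- The number of pairs of bag states at two nodes. -/
theorem Describes.place_eq {I : List ℕ} {d n m : ℕ} {G : SimpleGraph (Fin n)}
    {t : SimpleGraph (Fin m)} {B : Fin m → Finset (Fin n)} (hI : Describes I d G t B)
    (p x : Fin m) :
    place I p x (inN I) =
      2 ^ (B p ∪ B x).card * (d + 1) ^ (B p).card * (d + 1) ^ (B x).card := by
  have hpow : ∀ (S : Finset (Fin n)) (k : ℕ), (∏ v, if v ∈ S then k else 1) = k ^ S.card :=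
    fun S k => by rw [Finset.prod_ite_mem, Finset.univ_inter, Finset.prod_const]
  have hcount : ∀ (y : Fin m) (v : Fin n), countRadix I y v = if v ∈ B y then d + 1 else 1 := by
    intro y v
    split_ifs with h
    exacts [hI.countRadix_of_mem h, hI.countRadix_of_notMem h]
  rw [place, hI.inN_eq, Finset.prod_range, ← hpow, ← hpow, ← hpow, ← Finset.prod_mul_distrib,
    ← Finset.prod_mul_distrib]
  refine Finset.prod_congr rfl fun v _ => ?_
  have hcolor : colorRadix I p x v = if v ∈ B p ∪ B x then 2 else 1 := by
    split_ifs with h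
    · exact hI.colorRadix_of_mem h
    · rw [Finset.mem_union, not_or] at h
      exact hI.colorRadix_of_notMem h.1 h.2
  rw [radix, hcount, hcount, hcolor]

/-- Since `d` is given in binary it may be as large as about `2 ^ N`, but the powers have exponent
`n ≤ N`; so all values have quadratic length. -/
theorem size_valueBound_le {d n m N : ℕ} (hN : 4 + n * n + m * m + m * n ≤ N) (hd : d.size ≤ N) :
    (valueBound d n m).size ≤ 2 * N * N + 3 * N + 4 := by
  have hn : n ≤ N := by
    have := Nat.le_mul_self n
    omega
  have hm : m ≤ N := by
    have := Nat.le_mul_self m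
    omega
  have hd : d < 2 ^ N := Nat.size_le.1 hd
  have hN2 : N < 2 ^ N := Nat.lt_two_pow_self
  have h1 : (4 * (d + n + 1)) ^ n ≤ 2 ^ (2 * N * N + 3 * N + 2) := by
    calc (4 * (d + n + 1)) ^ n ≤ (2 ^ (N + 3)) ^ N := by
          refine (Nat.pow_le_pow_right (by omega) hn).trans (Nat.pow_le_pow_left ?_ N)
          rw [pow_add]
          omega
      _ ≤ 2 ^ (2 * N * N + 3 * N + 2) := by
          rw [← pow_mul]
          exact Nat.pow_le_pow_right (by omega) (by nlinarith)
  have h2 : 4 * (2 * (d + 1) * (d + 1)) ^ n ≤ 2 ^ (2 * N * N + 3 * N + 2) := by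
    calc 4 * (2 * (d + 1) * (d + 1)) ^ n ≤ 2 ^ 2 * (2 ^ (2 * N + 1)) ^ N := by
          refine Nat.mul_le_mul (by omega)
            ((Nat.pow_le_pow_right (by positivity) hn).trans (Nat.pow_le_pow_left ?_ N))
          calc 2 * (d + 1) * (d + 1) ≤ 2 * 2 ^ N * 2 ^ N := by gcongr <;> omega
            _ = 2 ^ (2 * N + 1) := by ring
      _ ≤ 2 ^ (2 * N * N + 3 * N + 2) := by
          rw [← pow_mul, ← pow_add]
          exact Nat.pow_le_pow_right (by omega) (by nlinarith)
  have h3 : 4 * 2 ^ N ≤ 2 ^ (2 * N * N + 3 * N + 2) := by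
    calc 4 * 2 ^ N = 2 ^ (N + 2) := by ring
      _ ≤ _ := Nat.pow_le_pow_right (by omega) (by nlinarith)
  rw [Nat.size_le]
  have h4 : 2 ^ (2 * N * N + 3 * N + 4) = 4 * 2 ^ (2 * N * N + 3 * N + 2) := by ring
  unfold valueBound
  omega

/-- The number of pairs enters linearly, and the terms without it may be multiplied by `W ≥ 1`, so
`W` factors out. -/
theorem totalTime_le {n m N σ σ' W : ℕ} (hn : n ≤ N) (hm : m ≤ N) (hσ : σ ≤ σ') (hW : 1 ≤ W) :
    totalTime n m (8 * W) σ ≤ totalTime N N 8 σ' * W := by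
  calc totalTime n m (8 * W) σ ≤ totalTime N N (8 * W) σ' := by
        unfold totalTime passTime pairTime
        gcongr
    _ ≤ totalTime N N 8 σ' * W := by
        unfold totalTime passTime
        generalize σ' + pairTime N σ' = b
        generalize N * (σ' + (4 * N * σ' + 8 * σ')) + N * (3 * σ') = a
        calc N * (σ' + (a + 8 * W * b + 11 * σ')) + 2 * σ'
            = N * (σ' + a + 11 * σ') * 1 + 8 * W * b * N + 2 * σ' * 1 := by ring
          _ ≤ N * (σ' + a + 11 * σ') * W + 8 * W * b * N + 2 * σ' * W := by gcongr
          _ = (N * (σ' + (a + 8 * b + 11 * σ')) + 2 * σ') * W := by ring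

/-- The polynomial factor in the running time, as a function of the input size. -/
def timeFactor (N : ℕ) : ℕ :=
  totalTime N N 8 (stepTime (2 * N * N + 3 * N + 4))

theorem exists_polynomial_timeFactor : ∃ q : Polynomial ℕ, ∀ N, q.eval N = timeFactor N := by
  let σ : Polynomial ℕ :=
    2 * (3000 * (3000 * (2 * .X * .X + 3 * .X + 4 + 1) + 1)) + 1
  let ρ : Polynomial ℕ := .X * (σ + (4 * .X * σ + 12 * σ)) + 12 * σ
  let π : Polynomial ℕ :=
    .X * (σ + (4 * .X * σ + 8 * σ)) + .X * (3 * σ) + 8 * (σ + ρ) + 11 * σ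
  refine ⟨.X * (σ + π) + 2 * σ, fun N => ?_⟩
  have hσ : σ.eval N = stepTime (2 * N * N + 3 * N + 4) := by
    simp [σ, stepTime]
  have hρ : ρ.eval N = pairTime N (stepTime (2 * N * N + 3 * N + 4)) := by
    simp [ρ, hσ, pairTime]
  have hπ : π.eval N = passTime N N 8 (stepTime (2 * N * N + 3 * N + 4)) := by
    simp [π, hσ, hρ, passTime]
  simp [hσ, hπ, timeFactor, totalTime]

theorem decidesWithin_encodeInstance (d : ℕ) {n m : ℕ} (G : SimpleGraph (Fin n))
    (D : TreeDecomposition G (Fin m)) (r : Fin m) (hD : D.IsNice r) :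
    DecidesWithin program (encodeInstance d G D r) (HasDCut G d)
      (timeFactor (inputSize (encodeInstance d G D r)) *
        (2 ^ (D.width + 1) * (d + 1) ^ (2 * D.width + 2))) := by
  -- The bag of a leaf node has two elements, so there is a vertex zero whose colour can be fixed.
  have hn : 0 < n := by
    obtain ⟨x, -, hx⟩ := hD.exists_isLeafNode
    have := Finset.card_le_univ (D.bag x)
    rw [Fintype.card_fin] at this
    omega
  have hlen := length_le_inputSize (encodeInstance d G D r)
  rw [length_encodeInstance] at hlen
  have hd : d.size ≤ inputSize (encodeInstance d G D r) := by
    simp only [inputSize, encodeInstance, List.cons_append, List.map_cons, List.sum_cons]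
    omega
  have hnN := Nat.le_mul_self n
  have hmN := Nat.le_mul_self m
  have hσ : stepTime (valueBound d n m).size ≤
      stepTime (2 * inputSize (encodeInstance d G D r) * inputSize (encodeInstance d G D r) +
        3 * inputSize (encodeInstance d G D r) + 4) := by
    have := size_valueBound_le hlen hd
    unfold stepTime
    gcongr
  refine (decidesWithin_program
    (Q := 8 * (2 ^ (D.width + 1) * (d + 1) ^ (2 * D.width + 2))) admissible_encodeInstance
    describes_encodeInstance D.isTree.isAcyclic hn rfl hD.1 D.decomposesOn_univ
    (fun T hT => solvable_univ_iff D ⟨0, hn⟩ hT) fun x p hxp => ?_).mono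
      (totalTime_le (by omega) (by omega) hσ (Nat.mul_pos (by positivity) (by positivity)))
  rw [describes_encodeInstance.place_eq]
  -- Eight is four flag pairs times the one extra vertex by which a union of adjacent bags may
  -- exceed `w + 1`.
  calc 4 * (2 ^ (D.bag p ∪ D.bag x).card * (d + 1) ^ (D.bag p).card * (d + 1) ^ (D.bag x).card)
      ≤ 4 * (2 ^ (D.width + 2) * (d + 1) ^ (D.width + 1) * (d + 1) ^ (D.width + 1)) := by
        gcongr
        · omega
        · exact hD.card_union_le hxp.symm
        · omega
        · exact D.card_bag_le p
        · omega
        · exact D.card_bag_le x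
    _ = 8 * (2 ^ (D.width + 1) * (d + 1) ^ (2 * D.width + 2)) := by ring

end DCutProgram

theorem mainTheorem4 :
    ∃ (P : RAM.Program) (q : Polynomial ℕ),
      ∀ (d : ℕ), 1 ≤ d →
      ∀ (n m : ℕ) (G : SimpleGraph (Fin n)) (D : TreeDecomposition G (Fin m)) (r : Fin m),
        D.IsNice r →
          RAM.DecidesWithin P (encodeInstance d G D r) (HasDCut G d)
            (q.eval (RAM.inputSize (encodeInstance d G D r)) *
              (2 ^ (D.width + 1) * (d + 1) ^ (2 * D.width + 2))) ∧
          (D.width = treewidth G →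
            RAM.DecidesWithin P (encodeInstance d G D r) (HasDCut G d)
              (q.eval (RAM.inputSize (encodeInstance d G D r)) *
                (2 ^ (treewidth G + 1) * (d + 1) ^ (2 * treewidth G + 2)))) := by
  obtain ⟨q, hq⟩ := DCutProgram.exists_polynomial_timeFactor
  refine ⟨DCutProgram.program, q, fun d _ n m G D r hD => ?_⟩
  rw [hq]
  have h := DCutProgram.decidesWithin_encodeInstance d G D r hD
  exact ⟨h, fun hw => hw ▸ h⟩
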